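/- Let $n\ge 2$, let $F_q$ be a finite field of characteristic $p$ with $q$ elements, $G=\mathrm{GL}_n(q)$, $\ell\ne p$ a prime, and $R$ a local principal ideal domain of characteristic $0$ with maximal ideal $\ell R$, containing a primitive $p$-th root of unity; put $K=R/\ell R$. Let $B$ and $U$ be the upper triangular and upper unitriangular subgroups of $G$, $\widehat B=\sum_{b\in B}b$, $\underline e=\sum_{\sigma\in S_n}\mathrm{sg}(\sigma)\,\sigma\widehat B\in RG$, $I=RG\cdot\underline e$ (the Steinberg lattice) and $L=I/\ell I$, a $KG$-module. Let $f$ be the bilinear form on $I$ obtained by restricting the form $(g,h)\mapsto\delta_{g,h}$ of $RG$ and scaling by $1/|B|$, and for $c\ge 0$ put $I(c)=\{x\in I: f(x,I)\subseteq \ell^cR\}$ and $L(c)=(I(c)+\ell I)/\ell I$, so that $L=L(0)\supseteq L(1)\supseteq\cdots$. For a subgroup $P$ of $G$ containing $B$ put $L(P)=L(c)$ and $L(P)^\sharp=L(c+1)$, where $c=\nu_\ell([G:P])$, and $\phi(P)=\nu_\ell([P:B])$. For a group homomorphism $\lambda:U\to R^*$ let $F_\lambda\in L$ be the image of $\sum_{u\in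 U}\lambda(u)u\underline e$, and let $P(\lambda)$ be the subgroup generated by $B$ and the permutation matrices of those transpositions $(i,i+1)$ for which $\lambda$ is non-trivial on the root subgroup $X_{i,i+1}$. For $P\supseteq B$ let $L'(P)$ be the submodule $KG\cdot F_\lambda$ of $L$, for any $\lambda$ with $P(\lambda)=P$ (it does not depend on the choice of $\lambda$). Let $e=\min\{i\ge 2:\ \ell\mid (q^i-1)/(q-1)\}$ and $d=\nu_\ell\big((q^e-1)/(q-1)\big)$. For $a\ge 0$ with $ea\le n$ let $[a,0,\dots,0]$ be the block upper triangular subgroup with consecutive diagonal blocks of sizes $1,\dots,1,e,\dots,e$ ($n-ea$ ones followed by $a$ blocks of size $e$). The socle of a module is the sum of its irreducible submodules, and the socle series of $L$ is given by $soc^0(L)=0$ and $soc^{i+1}(L)/soc^i(L)=soc(L/soc^i(L))$. **Theorem A8.** (a) If $d=1$, then the filtration $L=L(0)\supseteq L(1)\supseteq\cdots$, with repetitions removed, is the socle series of $L$: there are $k\ge 0$ and a strictly increasing chain $0=S_0\subset S_1\subset\cdots\subset S_k=L$ with $\{S_0,\dots,S_k\}=\{L(c):c\ge 0\}$ and $S_i=soc^i(L)$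 for $0\le i\le k$. (b) Let $P$ be a subgroup of $G$ containing $B$. Then either $$soc(L/L(P)^\sharp)=L(P)/L(P)^\sharp,$$ or there is an integer $a$ with $\ell\le a-1<\lfloor n/e\rfloor$ and $d(a-1)<\phi(P)<da$ such that, for $Q=[a,0,\dots,0]$, the module $(L'(Q)+L(P)^\sharp)/L(P)^\sharp$ is irreducible and $$soc(L/L(P)^\sharp)=L(P)/L(P)^\sharp\ \oplus\ (L'(Q)+L(P)^\sharp)/L(P)^\sharp .$$ In particular, $soc(L/L(P)^\sharp)=L(P)/L(P)^\sharp$ whenever $\phi(P)\ge d\lfloor n/e\rfloor$. -/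

import Mathlib

open scoped MatrixGroups

noncomputable section

namespace SteinbergLattice

/-! ### The general linear group and its standard subgroups -/

section Groups

/-- Block upper triangular matrices, where `b i` is the label of the block containing `i`. -/
def blockUpper (n : ℕ) (F : Type*) [Field F] {α : Type*} [LinearOrder α] (b : Fin n → α) :
    Subgroup (GL (Fin n) F) where
  carrier := {g | (g : Matrix (Fin n) (Fin n) F).BlockTriangular b}
  one_mem' := by simpa using Matrix.blockTriangular_one
  mul_mem' := by
    intro x y hx hy
    simpa using Matrix.BlockTriangular.mul hx hy
  inv_mem' := by
    intro x hx
    have : Invertible (x : Matrix (Fin n) (Fin n) F) := Units.invertible x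
    have h := Matrix.blockTriangular_inv_of_blockTriangular
      (M := (x : Matrix (Fin n) (Fin n) F)) hx
    simpa [Matrix.coe_units_inv] using h

/-- The upper triangular group `B`. -/
def borel (n : ℕ) (F : Type*) [Field F] : Subgroup (GL (Fin n) F) :=
  blockUpper n F (fun i => i)

theorem mul_diag_of_mem_borel {n : ℕ} {F : Type*} [Field F] {x y : GL (Fin n) F}
    (hx : x ∈ borel n F) (hy : y ∈ borel n F) (i : Fin n) :
    (x * y : GL (Fin n) F) i i = x i i * y i i := by
  rw [Matrix.GeneralLinearGroup.coe_mul, Matrix.mul_apply]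
  refine Finset.sum_eq_single i ?_ (by simp)
  intro k _ hk
  rcases lt_or_gt_of_ne hk with h | h
  · have : (x : Matrix (Fin n) (Fin n) F) i k = 0 := hx h
    simp [this]
  · have : (y : Matrix (Fin n) (Fin n) F) k i = 0 := hy h
    simp [this]

/-- The upper unitriangular group `U`. -/
def unitriangular (n : ℕ) (F : Type*) [Field F] : Subgroup (GL (Fin n) F) where
  carrier := {g | g ∈ borel n F ∧ ∀ i, g i i = 1}
  one_mem' := ⟨one_mem _, fun i => by simp⟩
  mul_mem' := by
    rintro x y ⟨hx, hx'⟩ ⟨hy, hy'⟩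
    exact ⟨mul_mem hx hy, fun i => by rw [mul_diag_of_mem_borel hx hy, hx', hy', one_mul]⟩
  inv_mem' := by
    rintro x ⟨hx, hx'⟩
    refine ⟨inv_mem hx, fun i => ?_⟩
    have h := mul_diag_of_mem_borel hx (inv_mem hx) i
    rw [mul_inv_cancel, hx', one_mul] at h
    rw [← h]
    simp

/-- The matrix of a permutation `σ`, sending the basis vector `e_i` to `e_{σ i}`. -/
def permGL (n : ℕ) (F : Type*) [Field F] : Equiv.Perm (Fin n) →* GL (Fin n) F :=
  (Matrix.permMatrixHom (n := Fin n) (R := F)).toHomUnits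

/-- The standard parabolic subgroup whose diagonal blocks have the sizes of a composition. -/
def parabolicOfComposition {n : ℕ} (F : Type*) [Field F] (a : Composition n) :
    Subgroup (GL (Fin n) F) :=
  blockUpper n F a.index

end Groups

/-! ### The Steinberg lattice `I`, its filtration, and its reduction `L` -/

section Lattice

variable (n : ℕ) (F : Type*) [Field F] (R : Type*) [CommRing R]

/-- The group algebra `RG` of `G = GL_n(F)`. -/
abbrev GroupAlg : Type _ := MonoidAlgebra R (GL (Fin n) F)

/-- The sum in `RG` of all elements of the subgroup `B` (a finite sum, since `F` will be finite). -/
def borelSum : GroupAlg n F R :=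
  ∑ᶠ b : borel n F, MonoidAlgebra.single (b : GL (Fin n) F) (1 : R)

/-- The generator `∑_σ sg(σ) σ B̂` of the Steinberg lattice. -/
def steinbergGen : GroupAlg n F R :=
  ∑ σ : Equiv.Perm (Fin n),
    MonoidAlgebra.single (permGL n F σ) (((Equiv.Perm.sign σ : ℤˣ) : ℤ) : R) * borelSum n F R

/-- The Steinberg lattice: the left ideal `I` of `RG` generated by `∑_σ sg(σ) σ B̂`. -/
def lattice : Submodule (GroupAlg n F R) (GroupAlg n F R) :=
  Submodule.span (GroupAlg n F R) {steinbergGen n F R}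

/-- The generator of `I`, as an element of `I`. -/
def latticeGen : lattice n F R :=
  ⟨steinbergGen n F R, Submodule.mem_span_singleton_self _⟩

variable {n F R}

/-- The symmetric bilinear form on `RG` with `(g, h) ↦ δ_{g,h}`. -/
def pairing (x y : GroupAlg n F R) : R :=
  x.coeff.sum fun g r => r * y.coeff g

theorem pairing_zero_left (y : GroupAlg n F R) : pairing 0 y = 0 := by
  simp [pairing]

theorem pairing_add_left (x x' y : GroupAlg n F R) :
    pairing (x + x') y = pairing x y + pairing x' y := by
  simp only [pairing, MonoidAlgebra.coeff_add]
  exact Finsupp.sum_add_index' (by simp) (by intros; ring)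

theorem pairing_add_right (x y y' : GroupAlg n F R) :
    pairing x (y + y') = pairing x y + pairing x y' := by
  simp [pairing, mul_add, Finsupp.sum_add]

theorem pairing_single_left (g : GL (Fin n) F) (r : R) (y : GroupAlg n F R) :
    pairing (MonoidAlgebra.single g r) y = r * y.coeff g := by
  simp [pairing]

theorem pairing_single_mul (g : GL (Fin n) F) (r : R) (x y : GroupAlg n F R) :
    pairing (MonoidAlgebra.single g r * x) y
      = pairing x (MonoidAlgebra.single g⁻¹ r * y) := by
  induction x using MonoidAlgebra.induction_linear with
  | zero => simp [pairing_zero_left]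
  | add a b ha hb => rw [mul_add, pairing_add_left, ha, hb, pairing_add_left]
  | single h s =>
    rw [MonoidAlgebra.single_mul_single, pairing_single_left, pairing_single_left,
      MonoidAlgebra.coeff_single_mul_eq_mul_coeff (m₂ := g * h)]
    · ring
    · intro m _
      constructor
      · intro hm
        rw [← hm, mul_inv_cancel_left]
      · intro hm
        rw [hm, inv_mul_cancel_left]

variable [IsDomain R]

/-- The form `f` on `I`: the restriction of the form of `RG`, scaled by `1/|B|`. Its values are
computed in the fraction field of `R`; they lie in `R`. -/
def latticeForm (x y : lattice n F R) : FractionRing R :=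
  ((Nat.card (borel n F) : ℕ) : FractionRing R)⁻¹ *
    algebraMap R (FractionRing R) (pairing (x : GroupAlg n F R) (y : GroupAlg n F R))

/-- `I(c) = {x ∈ I | f(x, I) ⊆ ℓ^c R}`. -/
def latticeFiltration (n : ℕ) (F : Type*) [Field F] (R : Type*) [CommRing R] [IsDomain R]
    (ℓ c : ℕ) : Submodule (GroupAlg n F R) (lattice n F R) where
  carrier := {x | ∀ y : lattice n F R, ∃ r : R,
    latticeForm x y = algebraMap R (FractionRing R) ((ℓ : R) ^ c * r)}
  zero_mem' := fun y => ⟨0, by simp [latticeForm, pairing_zero_left]⟩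
  add_mem' := by
    intro a b ha hb y
    obtain ⟨r, hr⟩ := ha y
    obtain ⟨s, hs⟩ := hb y
    refine ⟨r + s, ?_⟩
    rw [mul_add, map_add, ← hr, ← hs]
    simp [latticeForm, pairing_add_left, mul_add]
  smul_mem' := by
    intro a x hx
    induction a using MonoidAlgebra.induction_linear with
    | zero =>
      intro y
      exact ⟨0, by simp [latticeForm, pairing_zero_left]⟩
    | add a b ha hb =>
      intro y
      obtain ⟨r, hr⟩ := ha y
      obtain ⟨s, hs⟩ := hb y
      refine ⟨r + s, ?_⟩
      rw [mul_add, map_add, ← hr, ← hs]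
      simp [latticeForm, pairing_add_left, mul_add, add_mul]
    | single g s =>
      intro y
      obtain ⟨r, hr⟩ := hx (MonoidAlgebra.single g⁻¹ s • y)
      refine ⟨r, ?_⟩
      rw [← hr]
      simp [latticeForm, pairing_single_mul]

variable (n F R)

/-- The submodule `ℓI` of `I`. -/
def lMultiples (ℓ : ℕ) : Submodule (GroupAlg n F R) (lattice n F R) :=
  LinearMap.range (ℓ • (LinearMap.id : lattice n F R →ₗ[GroupAlg n F R] lattice n F R))

/-- The reduction `L = I/ℓI`. It is a module over `RG` annihilated by `ℓ`, that is, a module over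
`KG` with `K = R/ℓR`; its `RG`-submodules are exactly its `KG`-submodules. -/
abbrev Reduction (ℓ : ℕ) : Type _ :=
  lattice n F R ⧸ lMultiples n F R ℓ

/-- `L(c) = (I(c) + ℓI)/ℓI`. -/
def filtration (ℓ c : ℕ) : Submodule (GroupAlg n F R) (Reduction n F R ℓ) :=
  (latticeFiltration n F R ℓ c).map (lMultiples n F R ℓ).mkQ

end Lattice

/-! ### Linear characters of `U` and the submodules attached to parabolic subgroups -/

section Characters

variable {n : ℕ} {F : Type*} [Field F] {R : Type*} [CommRing R]

/-- `λ` is non-trivial on the root subgroup `X_{ij} = {I_n + a E^{ij} : a ∈ F}`. -/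
def NontrivialOnRoot (χ : unitriangular n F →* Rˣ) (i j : Fin n) : Prop :=
  ∃ (a : F) (u : unitriangular n F),
    ((u : GL (Fin n) F) : Matrix (Fin n) (Fin n) F) = Matrix.transvection i j a ∧ χ u ≠ 1

/-- `P(λ) = ⟨B, J(λ)⟩`, where `J(λ)` is the set of all transpositions `(i, i+1)` such that `λ` is
non-trivial on `X_{i,i+1}`. -/
def parabolicOfChar (χ : unitriangular n F →* Rˣ) : Subgroup (GL (Fin n) F) :=
  borel n F ⊔ Subgroup.closure
    {g | ∃ i j : Fin n, (i : ℕ) + 1 = j ∧ NontrivialOnRoot χ i j ∧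
      g = permGL n F (Equiv.swap i j)}

/-- `E_λ = ∑_{u ∈ U} λ(u) u · ∑_σ sg(σ) σ B̂`, an element of `I`. -/
def charVector (χ : unitriangular n F →* Rˣ) : lattice n F R :=
  ∑ᶠ u : unitriangular n F,
    (MonoidAlgebra.single (u : GL (Fin n) F) ((χ u : Rˣ) : R) : GroupAlg n F R) •
      latticeGen n F R

/-- The image `F_λ` of `E_λ` in `L`. -/
def redCharVector (ℓ : ℕ) (χ : unitriangular n F →* Rˣ) : Reduction n F R ℓ :=
  (lMultiples n F R ℓ).mkQ (charVector χ)

variable (R)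

/-- `L'(P)`: the submodule of `L` generated by the `F_λ` with `P(λ) = P`. (Each single such `F_λ`
generates it, because the `λ` with `P(λ) = P` are conjugate under the diagonal group, which
permutes the corresponding `F_λ`.) -/
def cyclicPart (ℓ : ℕ) (P : Subgroup (GL (Fin n) F)) :
    Submodule (GroupAlg n F R) (Reduction n F R ℓ) :=
  Submodule.span (GroupAlg n F R)
    {x | ∃ χ : unitriangular n F →* Rˣ, parabolicOfChar χ = P ∧ x = redCharVector ℓ χ}

/-- `ϑ(P) = ν_ℓ([G : P])`. -/
def theta (ℓ : ℕ) (P : Subgroup (GL (Fin n) F)) : ℕ :=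
  padicValNat ℓ P.index

/-- `φ(P) = ν_ℓ([P : B])`. -/
def phi (ℓ : ℕ) (P : Subgroup (GL (Fin n) F)) : ℕ :=
  padicValNat ℓ ((borel n F).relIndex P)

variable [IsDomain R]

/-- `L(P) = L(c)`, where `c = ϑ(P)`. -/
def filtrationAt (ℓ : ℕ) (P : Subgroup (GL (Fin n) F)) :
    Submodule (GroupAlg n F R) (Reduction n F R ℓ) :=
  filtration n F R ℓ (theta ℓ P)

/-- `L(P)^♯ = L(c + 1)`, where `c = ϑ(P)`. -/
def filtrationSharp (ℓ : ℕ) (P : Subgroup (GL (Fin n) F)) :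
    Submodule (GroupAlg n F R) (Reduction n F R ℓ) :=
  filtration n F R ℓ (theta ℓ P + 1)

end Characters

/-! ### The numbers `e` and `d` -/

/-- `e = min {i ≥ 2 : ℓ ∣ (q^i - 1)/(q - 1)}`. -/
def eNum (ℓ q : ℕ) : ℕ :=
  sInf {i | 2 ≤ i ∧ ℓ ∣ (q ^ i - 1) / (q - 1)}

/-- `d = ν_ℓ((q^e - 1)/(q - 1))`. -/
def dNum (ℓ q : ℕ) : ℕ :=
  padicValNat ℓ ((q ^ eNum ℓ q - 1) / (q - 1))

/-! ### Socles -/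

section Socle

variable (A : Type*) [Ring A] (M : Type*) [AddCommGroup M] [Module A M]

/-- The socle of a module: the sum of its simple submodules. -/
def socle : Submodule A M :=
  sSup {S : Submodule A M | IsSimpleModule A S}

/-- The socle series: `soc⁰ = 0`, and `socⁱ⁺¹/socⁱ` is the socle of `M/socⁱ`. -/
def socleSeries : ℕ → Submodule A M
  | 0 => ⊥
  | i + 1 => (socle A (M ⧸ socleSeries i)).comap (socleSeries i).mkQ

end Socle

end SteinbergLattice

end

/-! The vectors F_λ control all submodules of L, for two reasons. Any nonzero module on which q is
invertible contains an eigenvector of U for a linear character (`exists_eigenvector`): decompose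
under the abelian group of a single column, use the smaller general linear group to push the
character found onto the last coordinate, and pass to the preceding column. Moreover, the eigenspace
of U in I for each linear character is spanned by E_λ (`exists_charSum_smul_eq`): elements of I are
functions on G/B whose sums over the fibres of G/B → G/P vanish for minimal parabolics P, so an
eigenfunction is determined by its value at the longest permutation. Hence if N < M ≤ L, some F_λ
lies in M and not in N (`exists_redCharVector_mem_not_mem`). Up to the diagonal group, λ matters
only through P(λ), that is, through a composition of n.

The form enters through f(E_λ, e) = [G : P(λ)], with e here the generator of I
(`pairing_charVector_gen`, `charNorm_linChar`). So L'(P) ≤ L(k) exactly when k ≤ ν_ℓ([G:P]).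
Adjointness gives a reciprocity: the coefficients leading from E_λ to E_μ and back differ by the
ratio of the two indices (`exists_adjoint_coefficients`). If the valuations of the indices agree, an
inclusion between two modules L'(P) is therefore an equality (`cyclicPart_le_symm`). It follows that
the image of L'(P) in L/L(P)^♯ is irreducible and that L(P)/L(P)^♯ lies in the socle.

Now let S be an irreducible submodule of L/L(P)^♯ outside L(P)/L(P)^♯, with preimage M. Among the
compositions α with L'(α) inside M but not inside L(P)^♯ take one with the most parts; then φ(α) >
φ(P). Splitting a block shrinks L' (`exists_split`), so by maximality the result falls into L(P)^♯
and its φ is below φ(P): every split lowers φ by at least 2. But φ is the sum over the blocks m of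
d⌊m/e⌋ + ν_ℓ(⌊m/e⌋!), and by Kummer's theorem a block other than 1 and e has a split costing at most
1 (`exists_blockPhi_split`). So all blocks of α are 1 or e, φ(α) = da, and splitting one e gives
d(a-1) < φ(P) < da. These bounds determine a and force ℓ ≤ a-1; the order of the blocks is
immaterial (`cyclicPart_eq_of_perm`), so there is at most one further constituent. For d = 1 no
integer satisfies the bounds, and the socle series climbs the filtration one step at a time. -/

open scoped MatrixGroups

namespace SteinbergLattice

/-! ### Permutation matrices and the Bruhat decomposition -/

section Bruhat

variable {n : ℕ} {F : Type*} [Field F]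

theorem permGL_apply (σ : Equiv.Perm (Fin n)) (i j : Fin n) :
    (permGL n F σ : Matrix (Fin n) (Fin n) F) i j = if i = σ j then 1 else 0 := by
  change Equiv.Perm.permMatrix F σ⁻¹ i j = _
  simp only [Equiv.Perm.permMatrix, PEquiv.toMatrix_apply, Equiv.toPEquiv_apply, Option.mem_def,
    Option.some.injEq]
  congr 1
  rw [Equiv.Perm.inv_def, Equiv.symm_apply_eq]

theorem permGL_mul_apply (σ : Equiv.Perm (Fin n)) (g : GL (Fin n) F) (i j : Fin n) :
    (permGL n F σ * g : GL (Fin n) F) i j = g (σ⁻¹ i) j := by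
  rw [Matrix.GeneralLinearGroup.coe_mul, Matrix.mul_apply,
    Finset.sum_eq_single (σ⁻¹ i) ?_ (by simp)]
  · simp [permGL_apply]
  · intro k _ hk
    rw [permGL_apply, if_neg, zero_mul]
    rintro rfl
    simp at hk

theorem mul_permGL_apply (σ : Equiv.Perm (Fin n)) (g : GL (Fin n) F) (i j : Fin n) :
    (g * permGL n F σ : GL (Fin n) F) i j = g i (σ j) := by
  rw [Matrix.GeneralLinearGroup.coe_mul, Matrix.mul_apply,
    Finset.sum_eq_single (σ j) ?_ (by simp)]
  · simp [permGL_apply]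
  · intro k _ hk
    rw [permGL_apply, if_neg hk, mul_zero]

theorem permGL_conj_apply (σ τ : Equiv.Perm (Fin n)) (g : GL (Fin n) F) (i j : Fin n) :
    ((permGL n F τ)⁻¹ * g * permGL n F σ : GL (Fin n) F) i j = g (τ i) (σ j) := by
  rw [mul_permGL_apply, ← map_inv, permGL_mul_apply, inv_inv]

theorem mem_blockUpper {α : Type*} [LinearOrder α] {b : Fin n → α} {g : GL (Fin n) F} :
    g ∈ blockUpper n F b ↔ ∀ i j, b j < b i → g i j = 0 := Iff.rfl

theorem mem_borel {g : GL (Fin n) F} : g ∈ borel n F ↔ ∀ i j, j < i → g i j = 0 := Iff.rfl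

theorem mem_unitriangular {g : GL (Fin n) F} :
    g ∈ unitriangular n F ↔ (∀ i j, j < i → g i j = 0) ∧ ∀ i, g i i = 1 := Iff.rfl

theorem unitriangular_le_borel : unitriangular n F ≤ borel n F := fun _ h => h.1

theorem borel_le_blockUpper {α : Type*} [LinearOrder α] {b : Fin n → α} (hb : Monotone b) :
    borel n F ≤ blockUpper n F b := by
  intro g hg i j hij
  refine hg ?_
  by_contra h
  exact absurd (hb (not_lt.1 h)) (not_le.2 hij)

theorem permGL_mem_blockUpper {α : Type*} [LinearOrder α] {b : Fin n → α}
    {σ : Equiv.Perm (Fin n)} :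
    permGL n F σ ∈ blockUpper n F b ↔ ∀ j, b (σ j) ≤ b j := by
  rw [mem_blockUpper]
  constructor
  · intro h j
    by_contra hlt
    have := h (σ j) j (not_le.1 hlt)
    rw [permGL_apply, if_pos rfl] at this
    exact one_ne_zero this
  · intro h i j hij
    rw [permGL_apply, if_neg]
    rintro rfl
    exact absurd (h j) (not_le.2 hij)

/-- The invertible matrix `1 + N` for `N` of square zero. -/
def oneAddGL (N : Matrix (Fin n) (Fin n) F) (hN : N * N = 0) : GL (Fin n) F where
  val := 1 + N
  inv := 1 - N
  val_inv := by rw [add_mul, one_mul, mul_sub, mul_one, hN]; abel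
  inv_val := by rw [sub_mul, one_mul, mul_add, mul_one, hN]; abel

@[simp] theorem coe_oneAddGL (N : Matrix (Fin n) (Fin n) F) (hN : N * N = 0) :
    (oneAddGL N hN : Matrix (Fin n) (Fin n) F) = 1 + N := rfl

/-- The invertible matrix with given invertible diagonal entries. -/
def diagGL (t : Fin n → Fˣ) : GL (Fin n) F where
  val := Matrix.diagonal fun i => (t i : F)
  inv := Matrix.diagonal fun i => ((t i)⁻¹ : F)
  val_inv := by simp [Matrix.diagonal_mul_diagonal]
  inv_val := by simp [Matrix.diagonal_mul_diagonal]

@[simp] theorem coe_diagGL (t : Fin n → Fˣ) :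
    (diagGL t : Matrix (Fin n) (Fin n) F) = Matrix.diagonal fun i => (t i : F) := rfl

@[simp] theorem coe_inv_diagGL (t : Fin n → Fˣ) :
    (((diagGL t)⁻¹ : GL (Fin n) F) : Matrix (Fin n) (Fin n) F) =
      Matrix.diagonal fun i => ((t i)⁻¹ : F) := rfl

theorem diagGL_mem_borel (t : Fin n → Fˣ) : diagGL t ∈ borel n F := by
  intro i j hij
  simp [Matrix.diagonal_apply_ne' _ (ne_of_lt hij)]

theorem exists_ne_zero_of_col (g : GL (Fin n) F) (j : Fin n) : ∃ i, g i j ≠ 0 := by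
  by_contra! h
  have h1 : ((g⁻¹ : GL (Fin n) F) * g : GL (Fin n) F) j j = 0 := by
    rw [Matrix.GeneralLinearGroup.coe_mul, Matrix.mul_apply]
    exact Finset.sum_eq_zero fun i _ => by rw [h i, mul_zero]
  rw [inv_mul_cancel] at h1
  simp at h1

/-- Matrices `u g b` whose first `k` columns are distinct standard basis vectors, with zero rows
to the right of these entries. -/
theorem exists_partial_bruhat (g : GL (Fin n) F) (k : ℕ) (hk : k ≤ n) :
    ∃ u ∈ unitriangular n F, ∃ b ∈ borel n F, ∃ s : Fin n → Fin n,
      ∀ j : Fin n, (j : ℕ) < k →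
        (∀ i, (u * g * b : GL (Fin n) F) i j = if i = s j then 1 else 0) ∧
        ∀ j', j' ≠ j → (u * g * b : GL (Fin n) F) (s j) j' = 0 := by
  classical
  induction k with
  | zero => exact ⟨1, one_mem _, 1, one_mem _, id, fun j hj => absurd hj (Nat.not_lt_zero _)⟩
  | succ k ih =>
    obtain ⟨u, hu, b, hb, s, hs⟩ := ih (by omega)
    set M : GL (Fin n) F := u * g * b with hM
    let c : Fin n := ⟨k, by omega⟩
    let S : Finset (Fin n) := Finset.univ.filter fun i => M i c ≠ 0
    have hS : S.Nonempty := by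
      obtain ⟨i, hi⟩ := exists_ne_zero_of_col M c
      exact ⟨i, by simp [S, hi]⟩
    -- The pivot is the lowest nonzero entry of the column, so that clearing the entries above it
    -- only needs upper unitriangular row operations.
    let r : Fin n := S.max' hS
    have hr : M r c ≠ 0 := by
      have := S.max'_mem hS
      simpa [S] using this
    have hr' : ∀ i, r < i → M i c = 0 := by
      intro i hi
      by_contra hne
      have : i ≤ r := S.le_max' i (by simp [S, hne])
      exact absurd hi (not_lt.2 this)
    -- Row r is not an earlier pivot row: those vanish outside their pivot column, hence in column
    -- c, where row r does not.
    have hMr : ∀ j : Fin n, (j : ℕ) < k → M r j = 0 := by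
      intro j hj
      rw [(hs j hj).1, if_neg]
      intro h
      apply hr
      rw [h]
      exact (hs j hj).2 c (by intro h'; rw [← h'] at hj; simp [c] at hj)
    -- row operations
    let N : Matrix (Fin n) (Fin n) F := Matrix.of fun i j =>
      if j = r ∧ i < r then - (M i c / M r c) else 0
    have hN : N * N = 0 := by
      ext i j
      rw [Matrix.mul_apply]
      refine Finset.sum_eq_zero fun l _ => ?_
      by_cases h : l = r
      · simp [N, h]
      · simp [N, h]
    have hNU : oneAddGL N hN ∈ unitriangular n F := by
      rw [mem_unitriangular]
      constructor
      · intro i j hij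
        simp only [coe_oneAddGL, Matrix.add_apply, Matrix.one_apply_ne (ne_of_gt hij), N,
          Matrix.of_apply, zero_add]
        rw [if_neg]
        rintro ⟨rfl, h⟩
        exact absurd h (not_lt.2 hij.le)
      · intro i
        simp only [coe_oneAddGL, Matrix.add_apply, Matrix.one_apply_eq, N, Matrix.of_apply]
        rw [if_neg (by rintro ⟨rfl, h⟩; exact lt_irrefl _ h), add_zero]
    have hrow : ∀ i j, (oneAddGL N hN * M : GL (Fin n) F) i j =
        M i j + if i < r then - (M i c / M r c) * M r j else 0 := by
      intro i j
      rw [Matrix.GeneralLinearGroup.coe_mul, coe_oneAddGL, add_mul, one_mul, Matrix.add_apply,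
        Matrix.mul_apply, Finset.sum_eq_single r]
      · simp [N]
      · intro l _ hl; simp [N, hl]
      · simp
    set M' : GL (Fin n) F := oneAddGL N hN * M with hM'
    have hM'1 : ∀ j : Fin n, (j : ℕ) < k → ∀ i, M' i j = M i j := by
      intro j hj i
      rw [hrow, hMr j hj]; simp
    have hM'r : ∀ j, M' r j = M r j := by intro j; rw [hrow]; simp
    have hM'c : ∀ i, M' i c = if i = r then M r c else 0 := by
      intro i
      rw [hrow]
      rcases lt_trichotomy i r with h | h | h
      · rw [if_pos h, if_neg h.ne]; field_simp; ring
      · simp [h]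
      · simp [h.ne', hr' i h, not_lt.2 h.le]
    have hM's : ∀ j : Fin n, (j : ℕ) < k → ∀ j', M' (s j) j' = M (s j) j' := by
      intro j hj j'
      rw [hrow]
      have : M (s j) c = 0 := (hs j hj).2 c (by intro h'; rw [← h'] at hj; simp [c] at hj)
      rw [this]; simp
    -- column operations
    let N₂ : Matrix (Fin n) (Fin n) F := Matrix.of fun i j =>
      if i = c ∧ c < j then - (M r j / M r c) else 0
    have hN₂ : N₂ * N₂ = 0 := by
      ext i j
      rw [Matrix.mul_apply]
      refine Finset.sum_eq_zero fun l _ => ?_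
      by_cases h : l = c
      · simp [N₂, h]
      · simp [N₂, h]
    let t : Fin n → Fˣ := fun j => if j = c then (Units.mk0 _ hr)⁻¹ else 1
    have hB : oneAddGL N₂ hN₂ * diagGL t ∈ borel n F := by
      refine mul_mem ?_ (diagGL_mem_borel t)
      intro i j hij
      simp only [coe_oneAddGL, Matrix.add_apply, Matrix.one_apply_ne (ne_of_gt hij), N₂,
          Matrix.of_apply, zero_add]
      rw [if_neg]
      rintro ⟨rfl, h⟩
      exact absurd h (not_lt.2 (le_of_lt hij))
    have hcol : ∀ i j, (M' * (oneAddGL N₂ hN₂ * diagGL t) : GL (Fin n) F) i j =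
        (M' i j + if c < j then M' i c * - (M r j / M r c) else 0) * t j := by
      intro i j
      rw [← mul_assoc, Matrix.GeneralLinearGroup.coe_mul, coe_diagGL, Matrix.mul_diagonal,
        Matrix.GeneralLinearGroup.coe_mul, coe_oneAddGL, mul_add, mul_one, Matrix.add_apply,
        Matrix.mul_apply, Finset.sum_eq_single c]
      · simp [N₂]
      · intro l _ hl; simp [N₂, hl]
      · simp
    refine ⟨oneAddGL N hN * u, mul_mem hNU hu, b * (oneAddGL N₂ hN₂ * diagGL t),
      mul_mem hb hB, Function.update s c r, ?_⟩
    have hprod : oneAddGL N hN * u * g * (b * (oneAddGL N₂ hN₂ * diagGL t)) =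
        M' * (oneAddGL N₂ hN₂ * diagGL t) := by
      rw [hM', hM]; group
    rw [hprod]
    intro j hj
    rcases Nat.lt_succ_iff_lt_or_eq.1 hj with hj | hj
    · have hjc : j ≠ c := by intro h'; rw [h'] at hj; simp [c] at hj
      have hcj : ¬ c < j := by
        rw [Fin.lt_def]; simp only [c]; omega
      rw [Function.update_of_ne hjc]
      refine ⟨fun i => ?_, fun j' hj' => ?_⟩
      · rw [hcol, if_neg hcj, hM'1 j hj, (hs j hj).1]
        simp [t, hjc]
      · rw [hcol, hM's j hj, (hs j hj).2 j' hj', hM's j hj, (hs j hj).2 c (Ne.symm hjc)]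
        simp
    · have hjc : j = c := Fin.ext hj
      subst hjc
      rw [Function.update_self]
      refine ⟨fun i => ?_, fun j' hj' => ?_⟩
      · rw [hcol, hM'c]
        by_cases h : i = r
        · simp [h, t, hr]
        · simp [h]
      · rw [hcol, hM'r, hM'c, if_pos rfl]
        rcases lt_or_gt_of_ne hj' with h | h
        · rw [hMr j' (by rw [Fin.lt_def] at h; simpa [hj] using h)]
          simp
        · rw [if_pos h]; field_simp; ring

/-- The Bruhat decomposition `G = U W B`. -/
theorem exists_bruhat (g : GL (Fin n) F) :
    ∃ u ∈ unitriangular n F, ∃ σ : Equiv.Perm (Fin n), ∃ b ∈ borel n F,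
      g = u * permGL n F σ * b := by
  obtain ⟨u, hu, b, hb, s, hs⟩ := exists_partial_bruhat g n le_rfl
  have hinj : Function.Injective s := by
    intro j j' h
    by_contra hne
    have h1 := (hs j j.2).2 j' (Ne.symm hne)
    rw [(hs j' j'.2).1, if_pos h] at h1
    exact one_ne_zero h1
  let σ : Equiv.Perm (Fin n) := Equiv.ofBijective s (Finite.injective_iff_bijective.1 hinj)
  have : u * g * b = permGL n F σ := by
    apply Units.ext
    ext i j
    rw [permGL_apply]
    exact (hs j j.2).1 i
  refine ⟨u⁻¹, inv_mem hu, σ, b⁻¹, inv_mem hb, ?_⟩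
  rw [← this]; group

/-- Both sides have the same sum over all k, so no inequality can be strict. -/
theorem sum_comp_perm_eq_of_le {b : Fin n → ℕ} {σ τ : Equiv.Perm (Fin n)}
    (h : ∀ k, b (τ k) ≤ b (σ k)) : ∀ k, b (τ k) = b (σ k) := by
  have hsum : ∑ k, b (τ k) = ∑ k, b (σ k) := by
    rw [Equiv.sum_comp τ b, Equiv.sum_comp σ b]
  intro k
  exact (Finset.sum_eq_sum_iff_of_le fun i _ => h i).1 hsum k (Finset.mem_univ k)

/-- Disjointness of the cells `U σ P`. -/
theorem label_eq_of_conj_mem_blockUpper {b : Fin n → ℕ} {σ τ : Equiv.Perm (Fin n)}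
    {u : GL (Fin n) F} (hu : u ∈ unitriangular n F)
    (h : (permGL n F τ)⁻¹ * u * permGL n F σ ∈ blockUpper n F b) (k : Fin n) :
    b (τ⁻¹ k) = b (σ⁻¹ k) := by
  refine sum_comp_perm_eq_of_le (fun k => ?_) k
  -- A strict drop of labels would put the entry at (τ⁻¹ k, σ⁻¹ k) below the blocks, but this entry
  -- is the diagonal entry u k k = 1.
  by_contra hlt
  have := h (i := τ⁻¹ k) (j := σ⁻¹ k) (not_le.1 hlt)
  rw [permGL_conj_apply] at this
  rw [← Equiv.Perm.mul_apply, ← Equiv.Perm.mul_apply, mul_inv_cancel, mul_inv_cancel] at this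
  simp only [Equiv.Perm.one_apply] at this
  rw [hu.2 k] at this
  exact one_ne_zero this

theorem perm_eq_of_conj_mem_borel {σ τ : Equiv.Perm (Fin n)} {u : GL (Fin n) F}
    (hu : u ∈ unitriangular n F) (h : (permGL n F τ)⁻¹ * u * permGL n F σ ∈ borel n F) :
    τ = σ := by
  have : τ⁻¹ = σ⁻¹ := by
    ext k
    exact label_eq_of_conj_mem_blockUpper (b := fun i => (i : ℕ)) hu h k
  exact inv_injective this

end Bruhat

/-! ### Inductions on permutations by adjacent transpositions -/

section PermutationInduction

variable {n : ℕ}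

@[simp] theorem perm_apply_inv_self (σ : Equiv.Perm (Fin n)) (k : Fin n) : σ (σ⁻¹ k) = k := by
  rw [← Equiv.Perm.mul_apply, mul_inv_cancel, Equiv.Perm.one_apply]

@[simp] theorem perm_inv_apply_self (σ : Equiv.Perm (Fin n)) (k : Fin n) : σ⁻¹ (σ k) = k := by
  rw [← Equiv.Perm.mul_apply, inv_mul_cancel, Equiv.Perm.one_apply]

theorem le_of_forall_step_le {α : Type*} [Preorder α] {f : Fin n → α} (m : ℕ) :
    ∀ i j : Fin n, (i : ℕ) + m = j →
      (∀ k l : Fin n, i ≤ k → l ≤ j → (k : ℕ) + 1 = l → f k ≤ f l) → f i ≤ f j := by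
  induction m with
  | zero => intro i j h _; rw [show i = j from Fin.ext (by simpa using h)]
  | succ m ih =>
    intro i j h hf
    have hj := j.2
    let k : Fin n := ⟨(i : ℕ) + m, by omega⟩
    have hkj : (k : ℕ) + 1 = j := by simp only [k]; omega
    refine le_trans (ih i k rfl fun a b ha hb => hf a b ha (hb.trans ?_)) (hf k j ?_ le_rfl hkj)
    · rw [Fin.le_def]; omega
    · rw [Fin.le_def]; simp [k]

theorem monotone_of_step_le {α : Type*} [Preorder α] {f : Fin n → α}
    (hf : ∀ i j : Fin n, (i : ℕ) + 1 = j → f i ≤ f j) : Monotone f := fun i j hij =>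
  le_of_forall_step_le (j - i) i j (by rw [Fin.le_def] at hij; omega)
    fun k l _ _ hkl => hf k l hkl

theorem exists_step_of_ne_one {σ : Equiv.Perm (Fin n)} (h : σ ≠ 1) :
    ∃ i j : Fin n, (i : ℕ) + 1 = j ∧ σ⁻¹ j < σ⁻¹ i := by
  by_contra! hcon
  apply h
  have : Monotone (σ⁻¹ : Equiv.Perm (Fin n)) := monotone_of_step_le hcon
  rw [Equiv.Perm.monotone_iff] at this
  exact inv_eq_one.1 this

/-- The set of inversions of a permutation. -/
def inversions (σ : Equiv.Perm (Fin n)) : Finset (Fin n × Fin n) :=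
  Finset.univ.filter fun p => p.1 < p.2 ∧ σ p.2 < σ p.1

theorem mem_inversions {σ : Equiv.Perm (Fin n)} {x y : Fin n} :
    (x, y) ∈ inversions σ ↔ x < y ∧ σ y < σ x := by
  simp [inversions]

/-- Exchanging two adjacent values affects the order of only one pair of positions, and that pair
was an inversion. -/
theorem card_inversions_swap_mul_lt {σ : Equiv.Perm (Fin n)} {i j : Fin n}
    (hij : (i : ℕ) + 1 = j) (h : σ⁻¹ j < σ⁻¹ i) :
    (inversions (Equiv.swap i j * σ)).card < (inversions σ).card := by
  apply Finset.card_lt_card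
  rw [Finset.ssubset_iff_of_subset]
  · refine ⟨(σ⁻¹ j, σ⁻¹ i), ?_, ?_⟩
    · rw [mem_inversions, perm_apply_inv_self, perm_apply_inv_self]
      exact ⟨h, by rw [Fin.lt_def]; omega⟩
    · rw [mem_inversions, Equiv.Perm.mul_apply, Equiv.Perm.mul_apply, perm_apply_inv_self,
        perm_apply_inv_self, Equiv.swap_apply_left, Equiv.swap_apply_right, not_and, not_lt]
      intro _
      rw [Fin.le_def]; omega
  · rintro ⟨x, y⟩
    rw [mem_inversions, mem_inversions, Equiv.Perm.mul_apply, Equiv.Perm.mul_apply]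
    rintro ⟨hxy, hlt⟩
    refine ⟨hxy, ?_⟩
    have hne : σ x ≠ σ y := fun h' => hxy.ne (σ.injective h')
    by_cases hc : σ x = i ∧ σ y = j
    · exfalso
      rw [← hc.1, ← hc.2] at h
      simp only [perm_inv_apply_self] at h
      exact lt_asymm h hxy
    · rw [Equiv.swap_apply_def, Equiv.swap_apply_def] at hlt
      simp only [Fin.ext_iff, Fin.lt_def, ne_eq] at *
      split_ifs at hlt <;> omega

theorem perm_descent_induction {p : Equiv.Perm (Fin n) → Prop} (h1 : p 1)
    (hs : ∀ (σ : Equiv.Perm (Fin n)) (i j : Fin n), (i : ℕ) + 1 = j → σ⁻¹ j < σ⁻¹ i →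
      p (Equiv.swap i j * σ) → p σ) (σ : Equiv.Perm (Fin n)) : p σ := by
  induction hm : (inversions σ).card using Nat.strong_induction_on generalizing σ with
  | _ m ih =>
    by_cases h : σ = 1
    · rw [h]; exact h1
    · obtain ⟨i, j, hij, hlt⟩ := exists_step_of_ne_one h
      exact hs σ i j hij hlt (ih _ (hm ▸ card_inversions_swap_mul_lt hij hlt) _ rfl)

/-- The descent induction seen through τ ↦ w₀τ⁻¹: it starts at the longest element w₀, and left
multiplications become right ones. -/
theorem perm_ascent_induction {p : Equiv.Perm (Fin n) → Prop} (h1 : p Fin.revPerm)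
    (hs : ∀ (σ : Equiv.Perm (Fin n)) (i j : Fin n), (i : ℕ) + 1 = j → σ i < σ j →
      p (σ * Equiv.swap i j) → p σ) (σ : Equiv.Perm (Fin n)) : p σ := by
  have key := perm_descent_induction (p := fun τ => p (Fin.revPerm * τ⁻¹)) (by simpa using h1) (by
    intro τ i j hij hlt h
    refine hs _ i j hij ?_ ?_
    · simpa [Equiv.Perm.mul_apply] using hlt
    · simpa [mul_inv_rev, mul_assoc] using h) (σ⁻¹ * Fin.revPerm)
  have hrev : (Fin.revPerm : Equiv.Perm (Fin n)) * Fin.revPerm⁻¹ = 1 := mul_inv_cancel _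
  have hinv : (Fin.revPerm : Equiv.Perm (Fin n))⁻¹ = Fin.revPerm := by
    rw [Equiv.Perm.inv_def]; exact Fin.revPerm_symm
  simpa [mul_inv_rev, hinv, ← mul_assoc, hinv ▸ hrev] using key

end PermutationInduction

/-! ### Subgroups containing B -/

section Overgroups

variable {n : ℕ} {F : Type*} [Field F]

/-- The root element `1 + t E_{ij}`. -/
def rootGL {i j : Fin n} (h : i ≠ j) (t : F) : GL (Fin n) F :=
  oneAddGL (Matrix.single i j t) (by rw [Matrix.single_mul_single_of_ne _ _ _ _ h.symm])

theorem rootGL_apply {i j : Fin n} (h : i ≠ j) (t : F) (k l : Fin n) :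
    rootGL h t k l = (if k = l then 1 else 0) + if i = k ∧ j = l then t else 0 := by
  simp [rootGL, Matrix.one_apply, Matrix.single_apply]

theorem coe_rootGL {i j : Fin n} (h : i ≠ j) (t : F) :
    (rootGL h t : Matrix (Fin n) (Fin n) F) = Matrix.transvection i j t := rfl

theorem rootGL_mem_unitriangular {i j : Fin n} (h : i < j) (t : F) :
    rootGL h.ne t ∈ unitriangular n F := by
  rw [mem_unitriangular]
  constructor
  · intro k l hkl
    rw [rootGL_apply, if_neg hkl.ne', if_neg, add_zero]
    rintro ⟨rfl, rfl⟩
    exact lt_asymm h hkl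
  · intro k
    rw [rootGL_apply, if_pos rfl, if_neg, add_zero]
    rintro ⟨rfl, rfl⟩
    exact lt_irrefl _ h

theorem permGL_conj_rootGL (σ : Equiv.Perm (Fin n)) {i j : Fin n} (h : i ≠ j) (t : F) :
    (permGL n F σ)⁻¹ * rootGL h t * permGL n F σ =
      rootGL (fun h' => h (σ⁻¹.injective h') : σ⁻¹ i ≠ σ⁻¹ j) t := by
  apply Units.ext
  ext k l
  rw [permGL_conj_apply, rootGL_apply, rootGL_apply]
  simp only [EmbeddingLike.apply_eq_iff_eq]
  congr 2
  rw [Equiv.Perm.inv_eq_iff_eq, Equiv.Perm.inv_eq_iff_eq]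

/-- In the Bruhat form u τ b of the lower root element, τ lies in P. The element belongs to the
minimal parabolic that merges i and j, so τ permutes {i, j} and fixes the rest; it is not 1 because
the element is not upper triangular. Hence τ is the transposition. -/
theorem permGL_swap_mem_of_rootGL_mem {P : Subgroup (GL (Fin n) F)} (hP : borel n F ≤ P)
    {i j : Fin n} (hij : (i : ℕ) + 1 = j) (hne : j ≠ i) {t : F} (ht : t ≠ 0)
    (hmem : rootGL hne t ∈ P) : permGL n F (Equiv.swap i j) ∈ P := by
  obtain ⟨u, hu, τ, b, hb, hg⟩ := exists_bruhat (rootGL hne t)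
  have hτP : permGL n F τ ∈ P := by
    have : permGL n F τ = u⁻¹ * rootGL hne t * b⁻¹ := by rw [hg]; group
    rw [this]
    exact mul_mem (mul_mem (inv_mem (hP (unitriangular_le_borel hu))) hmem) (inv_mem (hP hb))
  let lab : Fin n → ℕ := fun k => if k = j then i else k
  have hlab : Monotone lab := by
    intro k l hkl
    simp only [lab, Fin.ext_iff, Fin.le_def] at *
    split_ifs <;> omega
  have hmemb : u * permGL n F τ ∈ blockUpper n F lab := by
    have h1 : u * permGL n F τ = rootGL hne t * b⁻¹ := by rw [hg]; group
    rw [h1]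
    refine mul_mem ?_ (inv_mem (borel_le_blockUpper hlab hb))
    intro k l hkl
    rw [rootGL_apply, if_neg (by rintro rfl; exact lt_irrefl _ hkl), if_neg, add_zero]
    rintro ⟨rfl, rfl⟩
    simp [lab] at hkl
  have hτ : ∀ k, lab ((1 : Equiv.Perm (Fin n))⁻¹ k) = lab (τ⁻¹ k) :=
    label_eq_of_conj_mem_blockUpper hu (by simpa using hmemb)
  have hτ' : ∀ k, lab k = lab (τ⁻¹ k) := by simpa using hτ
  have hτ1 : τ ≠ 1 := by
    rintro rfl
    have : rootGL hne t ∈ borel n F := by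
      rw [hg]; simpa using mul_mem (unitriangular_le_borel hu) hb
    have h0 := this (i := j) (j := i) (by change i < j; rw [Fin.lt_def]; omega)
    rw [rootGL_apply, if_neg hne] at h0
    simp [ht] at h0
  have hfix : ∀ k, k ≠ i → k ≠ j → τ⁻¹ k = k := by
    intro k hki hkj
    have := hτ' k
    simp only [lab, if_neg hkj] at this
    split_ifs at this with h
    · exact absurd (Fin.ext this) hki
    · exact (Fin.ext this).symm
  have hor : ∀ k, k = i ∨ k = j → τ⁻¹ k = i ∨ τ⁻¹ k = j := by
    intro k hk
    by_contra! hcon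
    have := hfix _ hcon.1 hcon.2
    have := τ⁻¹.injective this
    rw [this] at hcon
    tauto
  have : τ⁻¹ = Equiv.swap i j := by
    rcases hor i (Or.inl rfl) with h | h
    · exfalso
      apply hτ1
      apply inv_injective
      rw [inv_one]
      ext k : 1
      rw [Equiv.Perm.one_apply]
      by_cases hki : k = i
      · rw [hki, h]
      · by_cases hkj : k = j
        · subst hkj
          rcases hor k (Or.inr rfl) with h' | h'
          · exact absurd (τ⁻¹.injective (h'.trans h.symm)) hne
          · exact h'
        · exact hfix k hki hkj
    · ext k : 1
      by_cases hki : k = i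
      · rw [hki, h, Equiv.swap_apply_left]
      · by_cases hkj : k = j
        · subst hkj
          rw [Equiv.swap_apply_right]
          rcases hor k (Or.inr rfl) with h' | h'
          · exact h'
          · exact absurd (τ⁻¹.injective (h'.trans h.symm)) hne
        · rw [Equiv.swap_apply_of_ne_of_ne hki hkj, hfix k hki hkj]
  rw [← this, map_inv]
  exact inv_mem hτP

/-- The subgroup generated by `B` and the simple reflections satisfying a predicate. -/
def simpleClosure (n : ℕ) (F : Type*) [Field F] (J : Fin n → Fin n → Prop) :
    Subgroup (GL (Fin n) F) :=
  borel n F ⊔ Subgroup.closure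
    {g | ∃ i j : Fin n, (i : ℕ) + 1 = j ∧ J i j ∧ g = permGL n F (Equiv.swap i j)}

/-- An overgroup of `B` is generated by `B` and the simple reflections that it contains. -/
theorem eq_simpleClosure_of_borel_le {P : Subgroup (GL (Fin n) F)} (hP : borel n F ≤ P) :
    P = simpleClosure n F fun i j => permGL n F (Equiv.swap i j) ∈ P := by
  set Q := simpleClosure n F fun i j => permGL n F (Equiv.swap i j) ∈ P with hQ
  have hsQ : ∀ i j : Fin n, (i : ℕ) + 1 = j → permGL n F (Equiv.swap i j) ∈ P →
      permGL n F (Equiv.swap i j) ∈ Q := fun i j hij h =>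
    (le_sup_right : _ ≤ Q) (Subgroup.subset_closure ⟨i, j, hij, h, rfl⟩)
  apply le_antisymm
  · have key : ∀ σ, permGL n F σ ∈ P → permGL n F σ ∈ Q := by
      refine perm_descent_induction (fun _ => by simp) ?_
      intro σ i j hij hlt ih hσ
      have hne : j ≠ i := by rintro rfl; omega
      -- At a descent the lower root element at (j, i) is the conjugate by σ of an upper one, so it
      -- lies in P.
      have hs : permGL n F (Equiv.swap i j) ∈ P := by
        refine permGL_swap_mem_of_rootGL_mem hP hij hne one_ne_zero ?_
        have hr := permGL_conj_rootGL σ hne (1 : F)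
        have hr' : rootGL hne (1 : F) = permGL n F σ * rootGL hlt.ne 1 * (permGL n F σ)⁻¹ := by
          rw [← hr]; group
        rw [hr']
        exact mul_mem (mul_mem hσ (hP (unitriangular_le_borel
          (rootGL_mem_unitriangular hlt 1)))) (inv_mem hσ)
      have h1 := ih (by rw [map_mul]; exact mul_mem hs hσ)
      have h2 : permGL n F σ = (permGL n F (Equiv.swap i j))⁻¹ *
          permGL n F (Equiv.swap i j * σ) := by rw [map_mul]; group
      rw [h2]
      exact mul_mem (inv_mem (hsQ i j hij hs)) h1
    intro g hg
    obtain ⟨u, hu, σ, b, hb, rfl⟩ := exists_bruhat g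
    have hBQ : borel n F ≤ Q := le_sup_left
    refine mul_mem (mul_mem (hBQ (unitriangular_le_borel hu)) (key σ ?_)) (hBQ hb)
    have : permGL n F σ = u⁻¹ * (u * permGL n F σ * b) * b⁻¹ := by group
    rw [this]
    exact mul_mem (mul_mem (inv_mem (hP (unitriangular_le_borel hu))) hg) (inv_mem (hP hb))
  · refine sup_le hP ?_
    rw [Subgroup.closure_le]
    rintro g ⟨i, j, _, h, rfl⟩
    exact h

theorem permGL_swap_mem_blockUpper_iff {b : Fin n → ℕ} (hb : Monotone b) {i j : Fin n}
    (hij : (i : ℕ) + 1 = j) :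
    permGL n F (Equiv.swap i j) ∈ blockUpper n F b ↔ b i = b j := by
  have hle : b i ≤ b j := hb (by rw [Fin.le_def]; omega)
  rw [permGL_mem_blockUpper]
  constructor
  · intro h
    have := h i
    rw [Equiv.swap_apply_left] at this
    omega
  · intro h k
    by_cases hki : k = i
    · rw [hki, Equiv.swap_apply_left, h]
    · by_cases hkj : k = j
      · rw [hkj, Equiv.swap_apply_right, h]
      · rw [Equiv.swap_apply_of_ne_of_ne hki hkj]

theorem simpleClosure_congr {J J' : Fin n → Fin n → Prop}
    (h : ∀ i j : Fin n, (i : ℕ) + 1 = j → (J i j ↔ J' i j)) :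
    simpleClosure n F J = simpleClosure n F J' := by
  unfold simpleClosure
  congr 2
  ext g
  constructor
  · rintro ⟨i, j, hij, hJ, rfl⟩; exact ⟨i, j, hij, (h i j hij).1 hJ, rfl⟩
  · rintro ⟨i, j, hij, hJ, rfl⟩; exact ⟨i, j, hij, (h i j hij).2 hJ, rfl⟩

theorem blockUpper_eq_simpleClosure {b : Fin n → ℕ} (hb : Monotone b) :
    blockUpper n F b = simpleClosure n F fun i j => b i = b j := by
  rw [eq_simpleClosure_of_borel_le (borel_le_blockUpper (F := F) hb)]
  exact simpleClosure_congr fun i j hij => permGL_swap_mem_blockUpper_iff hb hij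

theorem blockUpper_eq_blockUpper_iff {b b' : Fin n → ℕ} (hb : Monotone b) (hb' : Monotone b') :
    blockUpper n F b = blockUpper n F b' ↔
      ∀ i j : Fin n, (i : ℕ) + 1 = j → (b i = b j ↔ b' i = b' j) := by
  constructor
  · intro h i j hij
    rw [← permGL_swap_mem_blockUpper_iff (F := F) hb hij, h,
      permGL_swap_mem_blockUpper_iff hb' hij]
  · intro h
    rw [blockUpper_eq_simpleClosure hb, blockUpper_eq_simpleClosure hb']
    exact simpleClosure_congr h

end Overgroups

/-! ### Compositions of n as labels of standard parabolics -/

section Compositions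

variable {n : ℕ}

/-- The label function of a composition. -/
def compLabel (c : Composition n) (i : Fin n) : ℕ := c.index i

theorem compLabel_monotone (c : Composition n) : Monotone (compLabel c) := by
  intro i j hij
  by_contra hlt
  have h : (c.index j : ℕ) + 1 ≤ c.index i := not_le.1 hlt
  have h1 := c.lt_sizeUpTo_index_succ j
  have h2 := c.sizeUpTo_index_le i
  have h3 := c.monotone_sizeUpTo h
  rw [Fin.le_def] at hij
  simp only [Fin.val_succ] at h1
  omega

theorem compLabel_eq_iff (c : Composition n) {i j : Fin n} (hij : (i : ℕ) + 1 = j) :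
    compLabel c i = compLabel c j ↔ ∀ k ≤ c.length, c.sizeUpTo k ≠ j := by
  have hmono := compLabel_monotone c (show i ≤ j by rw [Fin.le_def]; omega)
  have hi1 := c.lt_sizeUpTo_index_succ i
  have hi2 := c.sizeUpTo_index_le i
  have hj1 := c.lt_sizeUpTo_index_succ j
  have hj2 := c.sizeUpTo_index_le j
  simp only [Fin.val_succ] at hi1 hj1
  unfold compLabel at *
  constructor
  · intro h k _ hk
    rw [h] at hi2
    by_cases hkj : k ≤ c.index j
    · have := c.monotone_sizeUpTo hkj
      omega
    · have := c.monotone_sizeUpTo (show (c.index j : ℕ) + 1 ≤ k by omega)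
      omega
  · intro h
    by_contra hne
    have h1 := c.monotone_sizeUpTo (show (c.index i : ℕ) + 1 ≤ c.index j by omega)
    exact h (c.index j) (c.index j).2.le (by omega)

/-- Cut the interval at 0, at n and exactly where consecutive indices are not linked. This turns
sets of simple roots into compositions. -/
theorem exists_composition_of_links (J : Fin n → Fin n → Prop) :
    ∃ c : Composition n, ∀ i j : Fin n, (i : ℕ) + 1 = j →
      (compLabel c i = compLabel c j ↔ J i j) := by
  classical
  let S : CompositionAsSet n :=
    { boundaries := Finset.univ.filter fun x : Fin (n + 1) =>
        x = 0 ∨ x = Fin.last n ∨ ∃ i j : Fin n, (i : ℕ) + 1 = j ∧ (j : ℕ) = x ∧ ¬ J i j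
      zero_mem := by simp
      getLast_mem := by simp }
  refine ⟨S.toComposition, fun i j hij => ?_⟩
  rw [compLabel_eq_iff _ hij]
  have hb : S.toComposition.boundaries = S.boundaries := S.toComposition_boundaries
  have key : (∀ k ≤ S.toComposition.length, S.toComposition.sizeUpTo k ≠ j) ↔
      j.castSucc ∉ S.toComposition.boundaries := by
    simp only [Composition.boundaries, Composition.boundary, Finset.mem_map, Finset.mem_univ,
      true_and, not_exists]
    constructor
    · intro h k hk
      exact h k (Nat.lt_succ_iff.1 k.2) (by simpa [Fin.ext_iff] using hk)
    · intro h k hk hk'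
      exact h ⟨k, Nat.lt_succ_iff.2 hk⟩ (by simpa [Fin.ext_iff] using hk')
  rw [key, hb]
  simp only [S, Finset.mem_filter, Finset.mem_univ, true_and, not_or, not_exists, not_and, not_not]
  constructor
  · intro h
    exact h.2.2 i j hij (by simp)
  · intro h
    refine ⟨?_, ?_, ?_⟩
    · intro h'; simp [Fin.ext_iff] at h'; omega
    · intro h'; simp [Fin.ext_iff] at h'; have := j.2; omega
    · intro a b hab hb
      have hb' : b = j := Fin.ext (by simpa using hb)
      subst hb'
      have : a = i := Fin.ext (by omega)
      rwa [this]

/-- Every subgroup containing `B` is a standard parabolic subgroup. -/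
theorem exists_composition_of_borel_le {F : Type*} [Field F] {P : Subgroup (GL (Fin n) F)}
    (hP : borel n F ≤ P) : ∃ c : Composition n, P = blockUpper n F (compLabel c) := by
  obtain ⟨c, hc⟩ := exists_composition_of_links
    (fun i j => permGL n F (Equiv.swap i j) ∈ P)
  refine ⟨c, ?_⟩
  rw [eq_simpleClosure_of_borel_le hP, blockUpper_eq_simpleClosure (compLabel_monotone c)]
  exact (simpleClosure_congr hc).symm

/-- A block upper triangular group determines which simple reflections it contains. To use this, the
simple roots seen by the character are first realised as the links of a composition. -/
theorem parabolicOfChar_eq_blockUpper_iff {F : Type*} [Field F] {R : Type*} [CommRing R]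
    {χ : unitriangular n F →* Rˣ} {b : Fin n → ℕ} (hb : Monotone b) :
    parabolicOfChar χ = blockUpper n F b ↔
      ∀ i j : Fin n, (i : ℕ) + 1 = j → (NontrivialOnRoot χ i j ↔ b i = b j) := by
  have hχ : parabolicOfChar χ = simpleClosure n F (NontrivialOnRoot χ) := rfl
  constructor
  · intro h i j hij
    obtain ⟨c, hc⟩ := exists_composition_of_links (NontrivialOnRoot χ)
    have h1 : blockUpper n F (compLabel c) = blockUpper n F b := by
      rw [← h, hχ, blockUpper_eq_simpleClosure (compLabel_monotone c)]
      exact simpleClosure_congr hc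
    rw [← hc i j hij]
    exact (blockUpper_eq_blockUpper_iff (compLabel_monotone c) hb).1 h1 i j hij
  · intro h
    rw [hχ, blockUpper_eq_simpleClosure hb]
    exact simpleClosure_congr h

end Compositions

/-! ### Orders of subgroups of U defined by zero patterns -/

section PatternGroups

variable {n : ℕ} {F : Type*} [Field F]

theorem det_eq_one_of_unitriangular {M : Matrix (Fin n) (Fin n) F}
    (h0 : ∀ i j, j < i → M i j = 0) (h1 : ∀ i, M i i = 1) : M.det = 1 := by
  rw [Matrix.det_of_isUpperTriangular (M := M) (fun i j hij => h0 i j hij)]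
  simp [h1]

/-- An upper unitriangular matrix as an element of the general linear group. -/
def unitriangularGL (M : Matrix (Fin n) (Fin n) F)
    (h0 : ∀ i j, j < i → M i j = 0) (h1 : ∀ i, M i i = 1) : GL (Fin n) F :=
  Matrix.GeneralLinearGroup.mkOfDetNeZero M
    (by rw [det_eq_one_of_unitriangular h0 h1]; exact one_ne_zero)

@[simp] theorem unitriangularGL_apply (M : Matrix (Fin n) (Fin n) F)
    (h0 : ∀ i j, j < i → M i j = 0) (h1 : ∀ i, M i i = 1) (i j : Fin n) :
    unitriangularGL M h0 h1 i j = M i j := rfl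

/-- The elements of `U` with a prescribed pattern of zeros are given by their other entries. -/
noncomputable def patternEquiv (K : Fin n → Fin n → Prop) :
    {u : GL (Fin n) F // u ∈ unitriangular n F ∧ ∀ k l, k < l → K k l → u k l = 0} ≃
      ({p : Fin n × Fin n // p.1 < p.2 ∧ ¬ K p.1 p.2} → F) := by
  classical
  exact
  { toFun := fun u p => u.1 p.1.1 p.1.2
    invFun := fun f =>
      ⟨unitriangularGL (Matrix.of fun i j => if h : i < j ∧ ¬ K i j then f ⟨(i, j), h⟩ else
          if i = j then 1 else 0)
        (fun i j hij => by simp [not_lt.2 hij.le, hij.ne']) (fun i => by simp),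
      mem_unitriangular.2 ⟨fun i j hij => by simp [not_lt.2 hij.le, hij.ne'], fun i => by simp⟩,
      fun k l hkl hK => by simp [hK, hkl.ne]⟩
    left_inv := by
      rintro ⟨u, hu, hK⟩
      rw [mem_unitriangular] at hu
      apply Subtype.ext
      apply Units.ext
      ext i j
      simp only [unitriangularGL_apply, Matrix.of_apply]
      split_ifs with h h'
      · rfl
      · rw [h', hu.2]
      · rcases lt_trichotomy i j with h1 | h1 | h1
        · exact (hK i j h1 (by by_contra hc; exact h ⟨h1, hc⟩)).symm
        · exact absurd h1 h'
        · exact (hu.1 i j h1).symm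
    right_inv := by
      intro f
      ext ⟨⟨i, j⟩, h⟩
      simp only [unitriangularGL_apply, Matrix.of_apply]
      rw [dif_pos h] }

theorem card_pattern [Finite F] (K : Fin n → Fin n → Prop) :
    Nat.card {u : GL (Fin n) F // u ∈ unitriangular n F ∧ ∀ k l, k < l → K k l → u k l = 0} =
      Nat.card F ^ Nat.card {p : Fin n × Fin n // p.1 < p.2 ∧ ¬ K p.1 p.2} := by
  rw [Nat.card_congr (patternEquiv K), Nat.card_fun]

variable (F) in
/-- The stabilizer in `U` of the coset `σ P`, where `P` is block upper triangular. -/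
def cellStab (b : Fin n → ℕ) (σ : Equiv.Perm (Fin n)) : Subgroup (GL (Fin n) F) :=
  unitriangular n F ⊓
    (blockUpper n F b).comap (MulAut.conj (permGL n F σ)⁻¹).toMonoidHom

theorem mem_cellStab {b : Fin n → ℕ} {σ : Equiv.Perm (Fin n)} {u : GL (Fin n) F} :
    u ∈ cellStab F b σ ↔ u ∈ unitriangular n F ∧
      (permGL n F σ)⁻¹ * u * permGL n F σ ∈ blockUpper n F b := by
  simp [cellStab, Subgroup.mem_inf, Subgroup.mem_comap]

theorem mem_cellStab_iff_apply {b : Fin n → ℕ} {σ : Equiv.Perm (Fin n)} {u : GL (Fin n) F} :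
    u ∈ cellStab F b σ ↔ u ∈ unitriangular n F ∧
      ∀ k l, k < l → b (σ⁻¹ l) < b (σ⁻¹ k) → u k l = 0 := by
  rw [mem_cellStab]
  refine and_congr_right fun hu => ?_
  rw [mem_blockUpper]
  constructor
  · intro h k l _ hb
    have := h _ _ hb
    rwa [permGL_conj_apply, perm_apply_inv_self, perm_apply_inv_self] at this
  · intro h i j hij
    rw [permGL_conj_apply]
    rcases lt_trichotomy (σ i) (σ j) with h1 | h1 | h1
    · exact h _ _ h1 (by simpa using hij)
    · rw [σ.injective h1] at hij; exact absurd hij (lt_irrefl _)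
    · exact hu.1 h1

theorem card_cellStab [Finite F] (b : Fin n → ℕ) (σ : Equiv.Perm (Fin n)) :
    Nat.card (cellStab F b σ) = Nat.card F ^
      Nat.card {p : Fin n × Fin n // p.1 < p.2 ∧ ¬ b (σ⁻¹ p.2) < b (σ⁻¹ p.1)} := by
  rw [← card_pattern fun k l => b (σ⁻¹ l) < b (σ⁻¹ k)]
  exact Nat.card_congr (Equiv.subtypeEquivRight fun u => mem_cellStab_iff_apply)

theorem card_unitriangular [Finite F] :
    Nat.card (unitriangular n F) = Nat.card F ^ Nat.card {p : Fin n × Fin n // p.1 < p.2} := by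
  have h := card_pattern (F := F) (n := n) (fun _ _ => False)
  simp only [false_imp_iff, implies_true, and_true, not_false_eq_true] at h
  exact h

theorem card_pairs_eq_add (K : Fin n → Fin n → Prop) :
    Nat.card {p : Fin n × Fin n // p.1 < p.2} =
      Nat.card {p : Fin n × Fin n // p.1 < p.2 ∧ K p.1 p.2} +
        Nat.card {p : Fin n × Fin n // p.1 < p.2 ∧ ¬ K p.1 p.2} := by
  classical
  simp only [Nat.card_eq_fintype_card, Fintype.card_subtype]
  rw [← Finset.card_filter_add_card_filter_not (s := Finset.univ.filter
    fun p : Fin n × Fin n => p.1 < p.2) (fun p => K p.1 p.2), Finset.filter_filter,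
    Finset.filter_filter]

end PatternGroups

/-! ### The index of a parabolic as a sum over Bruhat cells -/

section Index

variable {n : ℕ} {F : Type*} [Field F]

/-- The permutations which are increasing on the blocks of a labelling. -/
def IncreasingOn (b : Fin n → ℕ) (σ : Equiv.Perm (Fin n)) : Prop :=
  ∀ i j : Fin n, (i : ℕ) + 1 = j → b i = b j → σ i < σ j

theorem IncreasingOn.lt {b : Fin n → ℕ} (hb : Monotone b) {σ : Equiv.Perm (Fin n)}
    (h : IncreasingOn b σ) {i j : Fin n} (hij : i < j) (hbij : b i = b j) : σ i < σ j := by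
  refine lt_of_le_of_ne ?_ fun h' => hij.ne (σ.injective h')
  refine le_of_forall_step_le (j - i) i j (by rw [Fin.lt_def] at hij; omega) ?_
  intro k l hik hlj hkl
  refine (h k l hkl ?_).le
  have h1 := hb hik
  have h2 := hb hlj
  have h3 := hb (show k ≤ l by rw [Fin.le_def]; omega)
  omega

/-- Bubble sort: exchanging adjacent indices with equal labels does not change the labelling and
removes an inversion. This provides a representative of each cell U σ P. -/
theorem exists_increasingOn (b : Fin n → ℕ) (τ : Equiv.Perm (Fin n)) :
    ∃ σ, IncreasingOn b σ ∧ ∀ k, b (σ⁻¹ k) = b (τ k) := by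
  induction hm : (inversions τ).card using Nat.strong_induction_on generalizing τ with
  | _ m ih =>
    by_cases h : IncreasingOn b τ⁻¹
    · exact ⟨τ⁻¹, h, fun k => by rw [inv_inv]⟩
    · simp only [IncreasingOn, not_forall] at h
      obtain ⟨i, j, hij, hbij, hlt⟩ := h
      have hlt' : τ⁻¹ j < τ⁻¹ i := by
        refine lt_of_le_of_ne (not_lt.1 hlt) fun h' => ?_
        have := τ⁻¹.injective h'
        rw [this] at hij; omega
      obtain ⟨σ, hσ, hσ'⟩ := ih _ (hm ▸ card_inversions_swap_mul_lt hij hlt') _ rfl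
      refine ⟨σ, hσ, fun k => ?_⟩
      rw [hσ', Equiv.Perm.mul_apply, Equiv.swap_apply_def]
      split_ifs with h1 h2
      · rw [h1, hbij]
      · rw [h2, hbij]
      · rfl

/-- The quotient τ⁻¹σ preserves labels and is increasing inside the blocks, hence is monotone, hence
trivial. -/
theorem IncreasingOn.eq {b : Fin n → ℕ} (hb : Monotone b) {σ τ : Equiv.Perm (Fin n)}
    (hσ : IncreasingOn b σ) (hτ : IncreasingOn b τ) (h : ∀ k, b (σ⁻¹ k) = b (τ⁻¹ k)) :
    σ = τ := by
  have hp : ∀ k, b ((τ⁻¹ * σ) k) = b k := by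
    intro k
    rw [Equiv.Perm.mul_apply, ← h, perm_inv_apply_self]
  have hmono : Monotone (τ⁻¹ * σ) := by
    intro i j hij
    by_contra hlt
    rw [not_le] at hlt
    have hij' : i < j := lt_of_le_of_ne hij (by rintro rfl; exact lt_irrefl _ hlt)
    have hbij : b i = b j := by
      have h1 := hb hij
      have h2 := hb hlt.le
      rw [hp, hp] at h2
      omega
    have h1 := hσ.lt hb hij' hbij
    have h2 := hτ.lt hb hlt (by rw [hp, hp, hbij])
    simp only [Equiv.Perm.mul_apply, perm_apply_inv_self] at h2
    exact lt_asymm h1 h2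
  rw [Equiv.Perm.monotone_iff, inv_mul_eq_one] at hmono
  exact hmono.symm

theorem coset_eq_iff {P : Subgroup (GL (Fin n) F)} (σ τ : Equiv.Perm (Fin n))
    (u v : unitriangular n F) :
    u • ((permGL n F σ : GL (Fin n) F) : GL (Fin n) F ⧸ P) =
      v • ((permGL n F τ : GL (Fin n) F) : GL (Fin n) F ⧸ P) ↔
      (permGL n F σ)⁻¹ * ((u : GL (Fin n) F)⁻¹ * v) * permGL n F τ ∈ P := by
  change (((u : GL (Fin n) F) * permGL n F σ : GL (Fin n) F) : GL (Fin n) F ⧸ P) =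
    (((v : GL (Fin n) F) * permGL n F τ : GL (Fin n) F) : GL (Fin n) F ⧸ P) ↔ _
  rw [QuotientGroup.eq]
  simp [mul_assoc]

theorem card_orbit_cell [Finite F] (b : Fin n → ℕ) (σ : Equiv.Perm (Fin n)) :
    Nat.card (MulAction.orbit (unitriangular n F)
      ((permGL n F σ : GL (Fin n) F) : GL (Fin n) F ⧸ blockUpper n F b)) =
      Nat.card F ^ Nat.card {p : Fin n × Fin n // p.1 < p.2 ∧ b (σ⁻¹ p.2) < b (σ⁻¹ p.1)} := by
  set x := ((permGL n F σ : GL (Fin n) F) : GL (Fin n) F ⧸ blockUpper n F b)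
  have h1 := MulAction.index_stabilizer (unitriangular n F) x
  have h2 : Nat.card (MulAction.stabilizer (unitriangular n F) x) =
      Nat.card (cellStab F b σ) := by
    have : MulAction.stabilizer (unitriangular n F) x =
        (cellStab F b σ).subgroupOf (unitriangular n F) := by
      ext u
      rw [MulAction.mem_stabilizer_iff, Subgroup.mem_subgroupOf, mem_cellStab]
      have := coset_eq_iff (P := blockUpper n F b) σ σ 1 u
      rw [one_smul] at this
      rw [eq_comm, this]
      simp
    rw [this]
    exact Nat.card_congr (Subgroup.subgroupOfEquivOfLe inf_le_left).toEquiv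
  have h3 := Subgroup.card_mul_index (MulAction.stabilizer (unitriangular n F) x)
  rw [h2, h1, card_cellStab, card_unitriangular,
    card_pairs_eq_add (fun k l => b (σ⁻¹ l) < b (σ⁻¹ k)), pow_add, mul_comm] at h3
  have hq : 0 < Nat.card F := Nat.card_pos
  rw [Nat.card_coe_set_eq]
  exact Nat.eq_of_mul_eq_mul_right (pow_pos hq _) h3

open scoped Classical in
-- G/P is the disjoint union of the U-orbits of the cosets σP with σ increasing on the blocks, and
-- for such σ the exponent in the orbit size counts ordinary inversions of σ⁻¹.
theorem index_blockUpper_eq_sum [Finite F] {b : Fin n → ℕ} (hb : Monotone b) :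
    (blockUpper n F b).index = ∑ σ : Equiv.Perm (Fin n) with IncreasingOn b σ,
      Nat.card F ^ Nat.card {p : Fin n × Fin n // p.1 < p.2 ∧ σ⁻¹ p.2 < σ⁻¹ p.1} := by
  have hex : ∀ x : GL (Fin n) F ⧸ blockUpper n F b, ∃ σ : Equiv.Perm (Fin n),
      IncreasingOn b σ ∧ ∃ u : unitriangular n F,
        x = u • ((permGL n F σ : GL (Fin n) F) : GL (Fin n) F ⧸ blockUpper n F b) := by
    intro x
    obtain ⟨g, rfl⟩ := QuotientGroup.mk_surjective x
    obtain ⟨u, hu, σ, c, hc, rfl⟩ := exists_bruhat g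
    obtain ⟨τ, hτ, hτ'⟩ := exists_increasingOn b σ⁻¹
    refine ⟨τ, hτ, ⟨u, hu⟩, ?_⟩
    change _ = ((u * permGL n F τ : GL (Fin n) F) : GL (Fin n) F ⧸ blockUpper n F b)
    rw [QuotientGroup.eq]
    have : (u * permGL n F σ * c)⁻¹ * (u * permGL n F τ) =
        c⁻¹ * permGL n F (σ⁻¹ * τ) := by rw [map_mul, map_inv]; group
    rw [this]
    refine mul_mem (inv_mem (borel_le_blockUpper hb hc)) (permGL_mem_blockUpper.2 fun j => ?_)
    rw [Equiv.Perm.mul_apply, ← hτ', perm_inv_apply_self]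
  choose f hf hf' using hex
  have : Finite (GL (Fin n) F ⧸ blockUpper n F b) := inferInstance
  have : Fintype (GL (Fin n) F ⧸ blockUpper n F b) := Fintype.ofFinite _
  rw [Subgroup.index, Nat.card_eq_fintype_card, ← Finset.card_univ,
    Finset.card_eq_sum_card_fiberwise (f := f) (t := Finset.univ.filter (IncreasingOn b))
      (fun x _ => by simpa using hf x)]
  refine Finset.sum_congr rfl fun σ hσ => ?_
  have hσ' : IncreasingOn b σ := by simpa using hσ
  have hset : Nat.card {p : Fin n × Fin n // p.1 < p.2 ∧ σ⁻¹ p.2 < σ⁻¹ p.1} =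
      Nat.card {p : Fin n × Fin n // p.1 < p.2 ∧ b (σ⁻¹ p.2) < b (σ⁻¹ p.1)} := by
    refine Nat.card_congr (Equiv.subtypeEquivRight fun p => and_congr_right fun hp => ?_)
    constructor
    · intro h
      refine lt_of_le_of_ne (hb h.le) fun h' => ?_
      have := hσ'.lt hb h h'
      simp only [perm_apply_inv_self] at this
      exact lt_asymm hp this
    · intro h
      by_contra hlt
      exact absurd (hb (not_lt.1 hlt)) (not_le.2 h)
  rw [hset, ← card_orbit_cell (F := F), Nat.card_eq_card_toFinset]
  congr 1
  ext x
  simp only [Finset.mem_filter, Finset.mem_univ, true_and, Set.mem_toFinset]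
  constructor
  · rintro rfl
    obtain ⟨u, hu⟩ := hf' x
    exact ⟨u, hu.symm⟩
  · rintro ⟨u, hu⟩
    obtain ⟨v, hv⟩ := hf' x
    have hu' : u • ((permGL n F σ : GL (Fin n) F) : GL (Fin n) F ⧸ blockUpper n F b) = x := hu
    nth_rewrite 1 [← hu'] at hv
    rw [coset_eq_iff] at hv
    refine (hf _).eq hb hσ' fun k => ?_
    exact (label_eq_of_conj_mem_blockUpper (mul_mem (inv_mem u.2) v.2) hv k).symm

open scoped Classical in
/-- The index of a parabolic subgroup as a sum over the permutations that reverse its blocks. -/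
theorem sum_card_cellStab_eq_index [Finite F] {b : Fin n → ℕ} (hb : Monotone b) :
    (∑ σ : Equiv.Perm (Fin n) with
      ∀ i j : Fin n, (i : ℕ) + 1 = j → b i = b j → σ⁻¹ j < σ⁻¹ i,
        Nat.card (cellStab F (fun i => (i : ℕ)) σ)) = (blockUpper n F b).index := by
  rw [index_blockUpper_eq_sum hb]
  -- The map σ ↦ w₀σ⁻¹ turns the block-reversing condition into the block-increasing one. It also
  -- turns the pairs kept in order by σ⁻¹, which count the stabilizer, into inversions, which count
  -- the cell.
  refine Finset.sum_nbij' (fun σ => Fin.revPerm * σ⁻¹) (fun σ => σ⁻¹ * Fin.revPerm)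
    ?_ ?_ ?_ ?_ ?_
  · intro σ hσ
    simp only [Finset.mem_filter, Finset.mem_univ, true_and] at hσ ⊢
    intro i j hij hbij
    simpa [Equiv.Perm.mul_apply] using hσ i j hij hbij
  · intro σ hσ
    simp only [Finset.mem_filter, Finset.mem_univ, true_and] at hσ ⊢
    intro i j hij hbij
    have := hσ i j hij hbij
    have hinv : (Fin.revPerm : Equiv.Perm (Fin n))⁻¹ = Fin.revPerm := by
      rw [Equiv.Perm.inv_def]; exact Fin.revPerm_symm
    simpa [Equiv.Perm.mul_apply, mul_inv_rev, hinv] using this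
  · intro σ _
    simp [mul_inv_rev]
  · intro σ _
    simp [mul_inv_rev]
  · intro σ _
    rw [card_cellStab]
    congr 1
    have hinv : (Fin.revPerm : Equiv.Perm (Fin n))⁻¹ = Fin.revPerm := by
      rw [Equiv.Perm.inv_def]; exact Fin.revPerm_symm
    refine Nat.card_congr
      { toFun := fun p => ⟨(Fin.rev (σ⁻¹ p.1.2), Fin.rev (σ⁻¹ p.1.1)), ?_⟩
        invFun := fun p => ⟨(σ (Fin.rev p.1.2), σ (Fin.rev p.1.1)), ?_⟩
        left_inv := ?_
        right_inv := ?_ }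
    · obtain ⟨⟨k, l⟩, h1, h2⟩ := p
      simp only [not_lt] at h1 h2
      have hne : σ⁻¹ k ≠ σ⁻¹ l := fun h' => h1.ne (σ⁻¹.injective h')
      refine ⟨?_, ?_⟩
      · simpa using lt_of_le_of_ne h2 (fun h' => hne (Fin.ext h'))
      · simpa [mul_inv_rev, hinv, Equiv.Perm.mul_apply] using h1
    · obtain ⟨⟨k, l⟩, h1, h2⟩ := p
      refine ⟨?_, ?_⟩
      · simpa [mul_inv_rev, hinv, Equiv.Perm.mul_apply] using h2
      · rw [not_lt]
        simpa only [mul_inv_rev, inv_inv, hinv, Equiv.Perm.mul_apply, Fin.revPerm_apply,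
          Fin.rev_rev, perm_inv_apply_self] using Fin.le_def.1 (Fin.rev_le_rev.2 h1.le)
    · rintro ⟨⟨k, l⟩, h1, h2⟩
      simp
    · rintro ⟨⟨k, l⟩, h1, h2⟩
      simp

end Index

/-! ### Orders of block upper triangular groups -/

section CardParabolic

variable {n : ℕ} {F : Type*} [Field F]

theorem card_GL_congr {ι κ : Type*} [Fintype ι] [DecidableEq ι] [Fintype κ] [DecidableEq κ]
    (e : ι ≃ κ) : Nat.card (GL ι F) = Nat.card (GL κ F) :=
  Nat.card_congr (Units.mapEquiv (Matrix.reindexAlgEquiv F F e).toMulEquiv).toEquiv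

/-- Assemble a block upper triangular matrix. -/
def blockMatrix {m : ℕ} (b : Fin n → Fin m)
    (A : ∀ k, Matrix {i // b i = k} {i // b i = k} F)
    (f : {p : Fin n × Fin n // b p.1 < b p.2} → F) : Matrix (Fin n) (Fin n) F :=
  Matrix.of fun i j => if h : b i = b j then A (b j) ⟨i, h⟩ ⟨j, rfl⟩ else
    if h : b i < b j then f ⟨(i, j), h⟩ else 0

theorem blockMatrix_blockTriangular {m : ℕ} (b : Fin n → Fin m)
    (A : ∀ k, Matrix {i // b i = k} {i // b i = k} F)
    (f : {p : Fin n × Fin n // b p.1 < b p.2} → F) :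
    (blockMatrix b A f).BlockTriangular b := by
  intro i j hij
  simp [blockMatrix, hij.ne', not_lt.2 hij.le]

theorem blockMatrix_toSquareBlock {m : ℕ} (b : Fin n → Fin m)
    (A : ∀ k, Matrix {i // b i = k} {i // b i = k} F)
    (f : {p : Fin n × Fin n // b p.1 < b p.2} → F) (k : Fin m) :
    (blockMatrix b A f).toSquareBlock b k = A k := by
  ext ⟨i, hi⟩ ⟨j, hj⟩
  subst hj
  simp [Matrix.toSquareBlock, Matrix.toSquareBlockProp, blockMatrix, hi]

theorem det_toSquareBlock_ne_zero {m : ℕ} {b : Fin n → Fin m} {g : GL (Fin n) F}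
    (hg : g ∈ blockUpper n F b) (k : Fin m) :
    ((g : Matrix (Fin n) (Fin n) F).toSquareBlock b k).det ≠ 0 := by
  have h1 := Matrix.BlockTriangular.det_fintype (M := (g : Matrix (Fin n) (Fin n) F)) (b := b) hg
  have h2 : (g : Matrix (Fin n) (Fin n) F).det ≠ 0 := g.det_ne_zero
  rw [h1] at h2
  exact (Finset.prod_ne_zero_iff.1 h2) k (Finset.mem_univ k)

/-- A block upper triangular invertible matrix is given by its diagonal blocks and the entries
above them. -/
noncomputable def blockUpperEquiv {m : ℕ} (b : Fin n → Fin m) :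
    blockUpper n F b ≃ (∀ k, GL {i // b i = k} F) × ({p : Fin n × Fin n // b p.1 < b p.2} → F) where
  toFun g := ⟨fun k => Matrix.GeneralLinearGroup.mkOfDetNeZero _
    (det_toSquareBlock_ne_zero g.2 k), fun p => (g : GL (Fin n) F) p.1.1 p.1.2⟩
  invFun x := ⟨Matrix.GeneralLinearGroup.mkOfDetNeZero (blockMatrix b (fun k => (x.1 k).1) x.2)
    (by
      rw [Matrix.BlockTriangular.det_fintype (blockMatrix_blockTriangular b _ _)]
      refine Finset.prod_ne_zero_iff.2 fun k _ => ?_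
      rw [blockMatrix_toSquareBlock]
      exact (x.1 k).det_ne_zero),
    mem_blockUpper.2 fun _ _ hij =>
      blockMatrix_blockTriangular b (fun k => (x.1 k).1) x.2 hij⟩
  left_inv := by
    rintro ⟨g, hg⟩
    apply Subtype.ext
    apply Units.ext
    ext i j
    change blockMatrix b (fun k => (g : Matrix (Fin n) (Fin n) F).toSquareBlock b k)
      (fun p => g p.1.1 p.1.2) i j = g i j
    simp only [blockMatrix, Matrix.of_apply]
    split_ifs with h h'
    · rfl
    · rfl
    · exact (hg (lt_of_le_of_ne (not_lt.1 h') (Ne.symm h))).symm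
  right_inv := by
    rintro ⟨A, f⟩
    refine Prod.ext ?_ ?_
    · funext k
      apply Units.ext
      exact blockMatrix_toSquareBlock b (fun k => (A k).1) f k
    · funext p
      obtain ⟨⟨i, j⟩, h⟩ := p
      change blockMatrix b (fun k => (A k).1) f i j = f ⟨(i, j), h⟩
      simp only at h
      simp [blockMatrix, h, h.ne]

theorem card_blockUpper [Finite F] {m : ℕ} (b : Fin n → Fin m) :
    Nat.card (blockUpper n F b) = (∏ k, Nat.card (GL {i // b i = k} F)) *
      Nat.card F ^ Nat.card {p : Fin n × Fin n // b p.1 < b p.2} := by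
  rw [Nat.card_congr (blockUpperEquiv b), Nat.card_prod, Nat.card_pi, Nat.card_fun]

end CardParabolic

/-! ### The valuation of [P : B] in terms of e and d -/

section Valuations

/-- The `ℓ`-adic valuation of the order of `GL_m(q)`. -/
def glVal (ℓ q m : ℕ) : ℕ := ∑ i ∈ Finset.range m, padicValNat ℓ (q ^ (i + 1) - 1)

variable {ℓ : ℕ} [Fact ℓ.Prime]

theorem padicValNat_prod {ι : Type*} (s : Finset ι) (f : ι → ℕ) (hf : ∀ i ∈ s, f i ≠ 0) :
    padicValNat ℓ (∏ i ∈ s, f i) = ∑ i ∈ s, padicValNat ℓ (f i) := by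
  classical
  induction s using Finset.induction_on with
  | empty => simp
  | insert a s ha ih =>
    rw [Finset.prod_insert ha, Finset.sum_insert ha, padicValNat.mul (hf a (by simp))
      (Finset.prod_ne_zero_iff.2 fun i hi => hf i (by simp [hi])),
      ih fun i hi => hf i (by simp [hi])]

theorem padicValNat_card_GL {F : Type*} [Field F] [Finite F] (hℓ : ¬ ℓ ∣ Nat.card F) (m : ℕ) :
    padicValNat ℓ (Nat.card (GL (Fin m) F)) = glVal ℓ (Nat.card F) m := by
  have := Fintype.ofFinite F
  rw [Matrix.card_GL_field, ← Nat.card_eq_fintype_card]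
  set q := Nat.card F
  have hq : 1 < q := Finite.one_lt_card
  have hpos : ∀ i : Fin m, 0 < q ^ m - q ^ (i : ℕ) := fun i =>
    Nat.sub_pos_of_lt (Nat.pow_lt_pow_right hq i.2)
  rw [padicValNat_prod _ _ fun i _ => (hpos i).ne',
    Fin.sum_univ_eq_sum_range (fun i => padicValNat ℓ (q ^ m - q ^ i)) m,
    ← Finset.sum_range_reflect, glVal]
  refine Finset.sum_congr rfl fun i hi => ?_
  have him := Finset.mem_range.1 hi
  have : q ^ m - q ^ (m - 1 - i) = q ^ (m - 1 - i) * (q ^ (i + 1) - 1) := by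
    rw [Nat.mul_sub, mul_one, ← pow_add]
    congr 2
    omega
  rw [this, padicValNat.mul (pow_ne_zero _ (by omega)) (Nat.sub_pos_of_lt
    (Nat.one_lt_pow (by omega) hq)).ne', padicValNat.eq_zero_of_not_dvd, zero_add]
  intro h
  exact hℓ ((Fact.out : ℓ.Prime).dvd_of_dvd_pow h)

theorem padicValNat_card_blockUpper {n : ℕ} {F : Type*} [Field F] [Finite F]
    (hℓ : ¬ ℓ ∣ Nat.card F) {m : ℕ} (b : Fin n → Fin m) :
    padicValNat ℓ (Nat.card (blockUpper n F b)) =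
      ∑ k, glVal ℓ (Nat.card F) (Nat.card {i // b i = k}) := by
  have hq : 1 < Nat.card F := Finite.one_lt_card
  rw [card_blockUpper, padicValNat.mul (Finset.prod_ne_zero_iff.2 fun k _ => Nat.card_pos.ne')
    (pow_ne_zero _ (by omega)), padicValNat_prod _ _ fun k _ => Nat.card_pos.ne',
    padicValNat.eq_zero_of_not_dvd (n := Nat.card F ^ _), add_zero]
  · refine Finset.sum_congr rfl fun k _ => ?_
    rw [← padicValNat_card_GL hℓ, Nat.card_eq_fintype_card (α := {i // b i = k})]
    rw [card_GL_congr (Fintype.equivFin {i // b i = k})]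
  · intro h
    exact hℓ ((Fact.out : ℓ.Prime).dvd_of_dvd_pow h)

theorem card_fiber_index {n : ℕ} (c : Composition n) (k : Fin c.length) :
    Nat.card {i // c.index i = k} = c.blocksFun k := by
  have e : Fin (c.blocksFun k) ≃ {i // c.index i = k} :=
    { toFun := fun j => ⟨c.embedding k j, c.index_embedding k j⟩
      invFun := fun i => Fin.cast (by rw [i.2]) (c.invEmbedding i.1)
      left_inv := by
        intro j
        apply Fin.ext
        simp
      right_inv := by
        rintro ⟨i, rfl⟩
        apply Subtype.ext
        exact c.embedding_comp_inv i }
  rw [← Nat.card_congr e, Nat.card_fin]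

theorem padicValNat_card_parabolic {n : ℕ} {F : Type*} [Field F] [Finite F]
    (hℓ : ¬ ℓ ∣ Nat.card F) (c : Composition n) :
    padicValNat ℓ (Nat.card (blockUpper n F (compLabel c))) =
      (c.blocks.map (glVal ℓ (Nat.card F))).sum := by
  have h := padicValNat_card_blockUpper (n := n) (F := F) hℓ c.index
  have h' : blockUpper n F (compLabel c) = blockUpper n F c.index := rfl
  rw [h', h]
  simp_rw [card_fiber_index]
  rw [← c.ofFn_blocksFun, List.map_ofFn, List.sum_ofFn]
  rfl

theorem padicValNat_card_borel {n : ℕ} {F : Type*} [Field F] [Finite F]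
    (hℓ : ¬ ℓ ∣ Nat.card F) :
    padicValNat ℓ (Nat.card (borel n F)) = n * glVal ℓ (Nat.card F) 1 := by
  have h := padicValNat_card_blockUpper (n := n) (F := F) hℓ (fun i => i)
  rw [borel, h]
  simp

/-- Lagrange for B ≤ P; the part of B stays on the left to avoid truncated subtraction. -/
theorem phi_add {n : ℕ} {F : Type*} [Field F] [Finite F]
    (hℓ : ¬ ℓ ∣ Nat.card F) (c : Composition n) :
    phi ℓ (blockUpper n F (compLabel c)) + n * glVal ℓ (Nat.card F) 1 =
      (c.blocks.map (glVal ℓ (Nat.card F))).sum := by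
  rw [← padicValNat_card_parabolic hℓ, ← padicValNat_card_borel (n := n) (F := F) hℓ, phi]
  have h := Subgroup.card_mul_index ((borel n F).subgroupOf (blockUpper n F (compLabel c)))
  have hle := borel_le_blockUpper (F := F) (compLabel_monotone c)
  rw [Nat.card_congr (Subgroup.subgroupOfEquivOfLe hle).toEquiv] at h
  have hne : (borel n F).relIndex (blockUpper n F (compLabel c)) ≠ 0 := by
    intro h0
    rw [Subgroup.relIndex] at h0
    rw [h0, mul_zero] at h
    exact Nat.card_pos.ne h
  rw [← h, padicValNat.mul Nat.card_pos.ne' (by exact hne), add_comm]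
  rfl

theorem theta_add_phi {n : ℕ} {F : Type*} [Field F] [Finite F] {P : Subgroup (GL (Fin n) F)}
    (hP : borel n F ≤ P) : theta ℓ P + phi ℓ P = theta ℓ (borel n F) := by
  have h := Subgroup.relIndex_mul_index hP
  have h0 : (borel n F).index ≠ 0 := Subgroup.index_ne_zero_of_finite
  rw [← h] at h0
  rw [theta, theta, phi, ← h, padicValNat.mul (left_ne_zero_of_mul h0) (right_ne_zero_of_mul h0),
    add_comm]

section QuantumIntegers

theorem qint_mul (q i : ℕ) : (q ^ i - 1) / (q - 1) * (q - 1) = q ^ i - 1 :=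
  Nat.div_mul_cancel (by simpa using Nat.sub_dvd_pow_sub_pow q 1 i)

variable {q : ℕ}

/-- Writing [i] for (q^i - 1)/(q - 1), one has [i + j] = [i] + q^i [j], and q is prime to ℓ. -/
theorem dvd_qint_add_iff (hℓq : ¬ ℓ ∣ q) (hq : 2 ≤ q) {i : ℕ} (j : ℕ)
    (h : ℓ ∣ (q ^ i - 1) / (q - 1)) :
    ℓ ∣ (q ^ (i + j) - 1) / (q - 1) ↔ ℓ ∣ (q ^ j - 1) / (q - 1) := by
  rw [← Nat.geomSum_eq hq] at *
  rw [← Nat.geomSum_eq hq, Finset.sum_range_add]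
  rw [(Nat.dvd_add_iff_right h).symm]
  simp_rw [pow_add]
  rw [← Finset.mul_sum]
  constructor
  · intro h'
    exact (Fact.out : ℓ.Prime).coprime_iff_not_dvd.2
      (fun h'' => hℓq ((Fact.out : ℓ.Prime).dvd_of_dvd_pow h'')) |>.dvd_of_dvd_mul_left h'
  · exact fun h' => Dvd.dvd.mul_left h' _

/-- If q ≡ 1 mod ℓ then [ℓ] ≡ ℓ ≡ 0. Otherwise ℓ is odd, Fermat gives ℓ ∣ q^(ℓ-1) - 1, and the
factor q - 1 is prime to ℓ. -/
theorem exists_dvd_qint (hℓq : ¬ ℓ ∣ q) (hq : 2 ≤ q) :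
    ∃ i, 2 ≤ i ∧ ℓ ∣ (q ^ i - 1) / (q - 1) := by
  have hℓ : ℓ.Prime := Fact.out
  have hcop : Nat.Coprime q ℓ := (hℓ.coprime_iff_not_dvd.2 hℓq).symm
  by_cases h : ℓ ∣ q - 1
  · refine ⟨ℓ, hℓ.two_le, ?_⟩
    rw [← Nat.geomSum_eq hq]
    have hq1 : q ≡ 1 [MOD ℓ] := ((Nat.modEq_iff_dvd' (by omega)).2 h).symm
    have : ∑ k ∈ Finset.range ℓ, q ^ k ≡ ∑ k ∈ Finset.range ℓ, 1 [MOD ℓ] := by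
      refine Nat.ModEq.sum fun k _ => ?_
      simpa using hq1.pow k
    rw [Finset.sum_const, Finset.card_range, smul_eq_mul, mul_one] at this
    exact (Nat.modEq_zero_iff_dvd.1 (this.trans (Nat.modEq_zero_iff_dvd.2 dvd_rfl)))
  · have h2 : ℓ ≠ 2 := by
      rintro rfl
      omega
    have h3 := hℓ.two_le
    refine ⟨ℓ - 1, by omega, ?_⟩
    have hf : q ^ (ℓ - 1) ≡ 1 [MOD ℓ] := by
      have := Nat.ModEq.pow_totient hcop
      rwa [Nat.totient_prime hℓ] at this
    have hd : ℓ ∣ q ^ (ℓ - 1) - 1 :=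
      (Nat.modEq_iff_dvd' (Nat.one_le_pow _ _ (by omega))).1 hf.symm
    rw [← qint_mul] at hd
    exact (hℓ.dvd_mul.1 hd).resolve_right h

theorem eNum_spec (hℓq : ¬ ℓ ∣ q) (hq : 2 ≤ q) :
    2 ≤ eNum ℓ q ∧ ℓ ∣ (q ^ eNum ℓ q - 1) / (q - 1) :=
  Nat.sInf_mem (s := {i | 2 ≤ i ∧ ℓ ∣ (q ^ i - 1) / (q - 1)}) (exists_dvd_qint hℓq hq)

theorem dvd_qint_iff (hℓq : ¬ ℓ ∣ q) (hq : 2 ≤ q) {i : ℕ} :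
    ℓ ∣ (q ^ i - 1) / (q - 1) ↔ eNum ℓ q ∣ i := by
  obtain ⟨he, hd⟩ := eNum_spec hℓq hq
  have hmul : ∀ k, ℓ ∣ (q ^ (eNum ℓ q * k) - 1) / (q - 1) := by
    intro k
    induction k with
    | zero => simp
    | succ k ih => rw [mul_add, mul_one, dvd_qint_add_iff hℓq hq _ ih]; exact hd
  constructor
  · intro h
    rw [← Nat.div_add_mod i (eNum ℓ q), dvd_qint_add_iff hℓq hq _ (hmul _)] at h
    have hlt := Nat.mod_lt i (show eNum ℓ q > 0 by omega)
    apply Nat.dvd_of_mod_eq_zero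
    by_contra h0
    -- The minimum defining e runs over i ≥ 2, so remainder 1 needs its own argument: [1] = 1.
    by_cases h1 : i % eNum ℓ q = 1
    · rw [h1, pow_one, Nat.div_self (by omega)] at h
      exact (Fact.out : ℓ.Prime).one_lt.ne' (Nat.dvd_one.1 h)
    · exact absurd (Nat.sInf_le (s := {i | 2 ≤ i ∧ ℓ ∣ (q ^ i - 1) / (q - 1)})
        ⟨by omega, h⟩) (not_le.2 hlt)
  · rintro ⟨k, rfl⟩
    exact hmul k

/-- Lifting the exponent, applied to q^e for odd ℓ. For ℓ = 2 one has e = 2 and d = ν₂(q + 1), and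
the version for even exponents gives the same formula. -/
theorem padicValNat_pow_sub_one (hℓq : ¬ ℓ ∣ q) (hq : 2 ≤ q) {i : ℕ} (hi : i ≠ 0) :
    padicValNat ℓ (q ^ i - 1) = padicValNat ℓ (q - 1) +
      if eNum ℓ q ∣ i then dNum ℓ q + padicValNat ℓ (i / eNum ℓ q) else 0 := by
  have hℓ : ℓ.Prime := Fact.out
  have hne : ∀ j, j ≠ 0 → q ^ j - 1 ≠ 0 := fun j hj => by
    have := Nat.one_lt_pow hj (show 1 < q by omega)
    omega
  have hq1 : q - 1 ≠ 0 := by omega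
  have hval : ∀ j, j ≠ 0 → padicValNat ℓ (q ^ j - 1) =
      padicValNat ℓ ((q ^ j - 1) / (q - 1)) + padicValNat ℓ (q - 1) := by
    intro j hj
    have h := qint_mul q j
    have h0 : (q ^ j - 1) / (q - 1) ≠ 0 := by
      intro h0
      rw [h0, zero_mul] at h
      exact hne j hj h.symm
    rw [← padicValNat.mul h0 hq1, h]
  obtain ⟨he, hd⟩ := eNum_spec hℓq hq
  split_ifs with h
  · obtain ⟨k, rfl⟩ := h
    rw [Nat.mul_div_cancel_left _ (by omega)]
    have hk : k ≠ 0 := right_ne_zero_of_mul hi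
    rcases hℓ.eq_two_or_odd' with rfl | hodd
    · have hqodd : 2 ∣ q - 1 := by omega
      have he2 : eNum 2 q = 2 := by
        refine le_antisymm (Nat.sInf_le ⟨le_rfl, ?_⟩) he
        rw [← Nat.geomSum_eq hq]
        simp [Finset.sum_range_succ]
        omega
      have h1 := padicValNat.pow_two_sub_pow (x := q) (y := 1) (by omega) hqodd hℓq
        (n := 2 * k) (by omega) (by simp)
      have h2 : padicValNat 2 (2 * k) = 1 + padicValNat 2 k := by
        rw [padicValNat.mul (by norm_num) hk, padicValNat.self (by norm_num)]
      have h3 : dNum 2 q = padicValNat 2 (q + 1) := by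
        rw [dNum, he2, ← Nat.geomSum_eq hq]
        simp [Finset.sum_range_succ, add_comm]
      rw [one_pow, h2] at h1
      rw [he2, h3]
      omega
    · have h1 : ℓ ∣ q ^ eNum ℓ q - 1 := by
        rw [← qint_mul]
        exact Dvd.dvd.mul_right hd _
      have h2 := padicValNat.pow_sub_pow (x := q ^ eNum ℓ q) (y := 1) hodd
        (Nat.one_lt_pow (by omega) (by omega)) h1 (fun h' => hℓq (hℓ.dvd_of_dvd_pow h')) hk
      rw [one_pow, ← pow_mul] at h2
      rw [h2, hval _ (by omega), dNum]
      ring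
  · rw [hval i hi, padicValNat.eq_zero_of_not_dvd, zero_add, add_zero]
    rwa [dvd_qint_iff hℓq hq]

/-- The contribution of a block of size `m` to `φ`. -/
def blockPhi (ℓ e d m : ℕ) : ℕ := d * (m / e) + padicValNat ℓ (m / e).factorial

/-- Each multiple ie of e up to m contributes d + ν_ℓ(i) beyond the torus part; the terms ν_ℓ(i) add
up to the valuation of ⌊m/e⌋!. -/
theorem glVal_eq (hℓq : ¬ ℓ ∣ q) (hq : 2 ≤ q) (m : ℕ) :
    glVal ℓ q m = blockPhi ℓ (eNum ℓ q) (dNum ℓ q) m + m * glVal ℓ q 1 := by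
  obtain ⟨he, -⟩ := eNum_spec hℓq hq
  induction m with
  | zero => simp [glVal, blockPhi]
  | succ m ih =>
    have h : glVal ℓ q (m + 1) = glVal ℓ q m + padicValNat ℓ (q ^ (m + 1) - 1) := by
      rw [glVal, Finset.sum_range_succ, glVal]
    have h1 : glVal ℓ q 1 = padicValNat ℓ (q - 1) := by simp [glVal]
    rw [h, ih, padicValNat_pow_sub_one hℓq hq (Nat.succ_ne_zero m), h1, blockPhi, blockPhi,
      Nat.succ_div]
    split_ifs with hdvd
    · rw [Nat.factorial_succ, padicValNat.mul (Nat.succ_ne_zero _) (Nat.factorial_ne_zero _)]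
      ring
    · simp only [add_zero]
      ring

end QuantumIntegers

theorem phi_eq_sum {n : ℕ} {F : Type*} [Field F] [Finite F]
    (hℓ : ¬ ℓ ∣ Nat.card F) (c : Composition n) :
    phi ℓ (blockUpper n F (compLabel c)) =
      (c.blocks.map (blockPhi ℓ (eNum ℓ (Nat.card F)) (dNum ℓ (Nat.card F)))).sum := by
  have h := phi_add hℓ (F := F) c
  have hq : 2 ≤ Nat.card F := Finite.one_lt_card
  have key : ∀ l : List ℕ, (l.map (glVal ℓ (Nat.card F))).sum =
      (l.map (blockPhi ℓ (eNum ℓ (Nat.card F)) (dNum ℓ (Nat.card F)))).sum +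
        l.sum * glVal ℓ (Nat.card F) 1 := by
    intro l
    induction l with
    | nil => simp
    | cons a l ih =>
      simp only [List.map_cons, List.sum_cons, ih]
      rw [glVal_eq hℓ hq a]
      ring
  rw [key, c.blocks_sum] at h
  omega

end Valuations

noncomputable instance fintypeGL {n : ℕ} {F : Type*} [Field F] [Finite F] :
    Fintype (GL (Fin n) F) := Fintype.ofFinite _

noncomputable instance fintypeUnitriangular {n : ℕ} {F : Type*} [Field F] [Finite F] :
    Fintype (unitriangular n F) := Fintype.ofFinite _

noncomputable instance fintypeBorel {n : ℕ} {F : Type*} [Field F] [Finite F] :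
    Fintype (borel n F) := Fintype.ofFinite _

/-! ### The Steinberg lattice as functions on G/B -/

section Functions

open scoped Classical

variable {n : ℕ} {F : Type*} [Field F] [Fintype F] {R : Type*} [CommRing R]

theorem coeff_borelSum (g : GL (Fin n) F) :
    (borelSum n F R).coeff g = if g ∈ borel n F then 1 else 0 := by
  rw [borelSum, finsum_eq_sum_of_fintype, MonoidAlgebra.coeff_sum, Finsupp.finsetSum_apply]
  simp only [MonoidAlgebra.coeff_single, Finsupp.single_apply]
  split_ifs with h
  · rw [Finset.sum_eq_single (⟨g, h⟩ : borel n F)]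
    · simp
    · intro b _ hb
      rw [if_neg]
      rintro rfl
      exact hb rfl
    · simp
  · refine Finset.sum_eq_zero fun b _ => ?_
    rw [if_neg]
    rintro rfl
    exact h b.2

theorem coeff_steinbergGen (g : GL (Fin n) F) :
    (steinbergGen n F R).coeff g = ∑ σ : Equiv.Perm (Fin n),
      (((Equiv.Perm.sign σ : ℤˣ) : ℤ) : R) *
        if (permGL n F σ)⁻¹ * g ∈ borel n F then 1 else 0 := by
  rw [steinbergGen, MonoidAlgebra.coeff_sum, Finsupp.finsetSum_apply]
  refine Finset.sum_congr rfl fun σ _ => ?_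
  rw [MonoidAlgebra.coeff_single_mul_apply, coeff_borelSum]

theorem coeff_steinbergGen_mul_permGL {u : GL (Fin n) F} (hu : u ∈ unitriangular n F)
    (τ : Equiv.Perm (Fin n)) :
    (steinbergGen n F R).coeff (u * permGL n F τ) =
      if (permGL n F τ)⁻¹ * u * permGL n F τ ∈ borel n F then
        (((Equiv.Perm.sign τ : ℤˣ) : ℤ) : R) else 0 := by
  rw [coeff_steinbergGen, Finset.sum_eq_single τ]
  · rw [← mul_assoc]
    split_ifs <;> simp
  · intro σ _ hσ
    rw [if_neg, mul_zero]
    rw [← mul_assoc]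
    exact fun h => hσ (perm_eq_of_conj_mem_borel hu h)
  · simp

omit [Fintype F] in
theorem lattice_induction {p : GroupAlg n F R → Prop} (h0 : p 0)
    (hadd : ∀ x y, p x → p y → p (x + y))
    (hs : ∀ g r, p (MonoidAlgebra.single g r * steinbergGen n F R))
    {x : GroupAlg n F R} (hx : x ∈ lattice n F R) : p x := by
  obtain ⟨a, rfl⟩ := Submodule.mem_span_singleton.1 hx
  induction a using MonoidAlgebra.induction_linear with
  | zero => simpa using h0
  | add a b ha hb =>
    rw [add_smul]
    exact hadd _ _ (ha (Submodule.smul_mem _ _ (Submodule.mem_span_singleton_self _)))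
      (hb (Submodule.smul_mem _ _ (Submodule.mem_span_singleton_self _)))
  | single g r => exact hs g r

/-- Elements of the lattice are right `B`-invariant functions. -/
theorem lattice_coeff_mul_borel {x : GroupAlg n F R} (hx : x ∈ lattice n F R)
    {b : GL (Fin n) F} (hb : b ∈ borel n F) (g : GL (Fin n) F) :
    x.coeff (g * b) = x.coeff g := by
  revert g
  refine lattice_induction (p := fun x => ∀ g, x.coeff (g * b) = x.coeff g) (by simp) ?_ ?_ hx
  · intro x y h1 h2 g
    simp [h1, h2]
  · intro h r g
    rw [MonoidAlgebra.coeff_single_mul_apply, MonoidAlgebra.coeff_single_mul_apply, ← mul_assoc,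
      coeff_steinbergGen, coeff_steinbergGen]
    congr 1
    refine Finset.sum_congr rfl fun σ _ => ?_
    rw [← mul_assoc]
    simp only [Subgroup.mul_mem_cancel_right _ hb]

omit [Fintype F] in
theorem diag_ne_zero_of_mem_borel {g : GL (Fin n) F} (hg : g ∈ borel n F) (i : Fin n) :
    g i i ≠ 0 := by
  have h := mul_diag_of_mem_borel hg (inv_mem hg) i
  rw [mul_inv_cancel] at h
  intro h0
  rw [h0, zero_mul] at h
  simp at h

/-- The labelling that identifies two consecutive indices. -/
def stepLabel (i j k : Fin n) : ℕ := if k = j then i else k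

omit [Fintype F] in
theorem mem_borel_iff_stepLabel {i j : Fin n} (hij : (i : ℕ) + 1 = j) {h : GL (Fin n) F} :
    h ∈ borel n F ↔ h ∈ blockUpper n F (stepLabel i j) ∧ h j i = 0 := by
  rw [mem_borel, mem_blockUpper]
  constructor
  · intro hh
    refine ⟨fun k l hkl => hh k l ?_, hh j i (by rw [Fin.lt_def]; omega)⟩
    simp only [stepLabel, Fin.ext_iff, Fin.lt_def] at *
    split_ifs at hkl <;> omega
  · rintro ⟨h1, h2⟩ k l hkl
    by_cases hc : k = j ∧ l = i
    · rw [hc.1, hc.2, h2]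
    · apply h1
      simp only [stepLabel, Fin.ext_iff, Fin.lt_def] at *
      split_ifs <;> omega

omit [Fintype F] in
-- The right factor replaces column i by column j plus t times column i, and column j by column i;
-- only the entry at (j, i) then gives a condition beyond membership in the minimal parabolic.
theorem mul_rootGL_mul_swap_mem_borel_iff {i j : Fin n} (hij : (i : ℕ) + 1 = j) (hne : i ≠ j)
    (h : GL (Fin n) F) (t : F) :
    h * rootGL hne t * permGL n F (Equiv.swap i j) ∈ borel n F ↔
      h ∈ blockUpper n F (stepLabel i j) ∧ h j j + t * h j i = 0 := by
  have hroot : ∀ k l, (h * rootGL hne t : GL (Fin n) F) k l =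
      h k l + if l = j then t * h k i else 0 := by
    intro k l
    rw [Matrix.GeneralLinearGroup.coe_mul, coe_rootGL, Matrix.transvection, mul_add, mul_one,
      Matrix.add_apply, Matrix.mul_apply, Finset.sum_eq_single i]
    · by_cases hl : l = j
      · simp [hl, mul_comm]
      · simp [hl, Ne.symm hl]
    · intro m _ hm; simp [hm.symm]
    · simp
  have hi : ∀ k, (h * rootGL hne t * permGL n F (Equiv.swap i j) : GL (Fin n) F) k i =
      h k j + t * h k i := by
    intro k; rw [mul_permGL_apply, Equiv.swap_apply_left, hroot, if_pos rfl]
  have hj : ∀ k, (h * rootGL hne t * permGL n F (Equiv.swap i j) : GL (Fin n) F) k j =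
      h k i := by
    intro k; rw [mul_permGL_apply, Equiv.swap_apply_right, hroot, if_neg hne, add_zero]
  have ho : ∀ k l, l ≠ i → l ≠ j →
      (h * rootGL hne t * permGL n F (Equiv.swap i j) : GL (Fin n) F) k l = h k l := by
    intro k l hli hlj
    rw [mul_permGL_apply, Equiv.swap_apply_of_ne_of_ne hli hlj, hroot, if_neg hlj, add_zero]
  rw [mem_borel, mem_blockUpper]
  constructor
  · intro hb
    have h1 : ∀ k, j < k → h k i = 0 := fun k hk => by rw [← hj]; exact hb k j hk
    have h2 : ∀ k, j < k → h k j = 0 := fun k hk => by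
      have := hb k i (lt_trans (by rw [Fin.lt_def]; omega) hk)
      rwa [hi, h1 k hk, mul_zero, add_zero] at this
    refine ⟨fun k l hkl => ?_, ?_⟩
    · by_cases hli : l = i
      · subst hli
        apply h1
        simp only [stepLabel, Fin.ext_iff, Fin.lt_def] at *
        split_ifs at hkl <;> omega
      · by_cases hlj : l = j
        · subst hlj
          apply h2
          simp only [stepLabel, Fin.ext_iff, Fin.lt_def] at *
          split_ifs at hkl <;> omega
        · rw [← ho k l hli hlj]
          apply hb
          simp only [stepLabel, Fin.ext_iff, Fin.lt_def] at *
          split_ifs at hkl <;> omega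
    · rw [← hi]
      exact hb j i (by rw [Fin.lt_def]; omega)
  · rintro ⟨h1, h2⟩ k l hkl
    by_cases hli : l = i
    · subst hli
      rw [hi]
      by_cases hkj : k = j
      · rw [hkj, h2]
      · rw [h1 k j, h1 k l, mul_zero, add_zero]
        all_goals
          simp only [stepLabel, Fin.ext_iff, Fin.lt_def] at *
          split_ifs <;> omega
    · by_cases hlj : l = j
      · subst hlj
        rw [hj]
        apply h1
        simp only [stepLabel, Fin.ext_iff, Fin.lt_def] at *
        split_ifs <;> omega
      · rw [ho k l hli hlj]
        apply h1
        simp only [stepLabel, Fin.ext_iff, Fin.lt_def] at *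
        split_ifs <;> omega

/-- The minimal parabolic subgroup is the disjoint union of `B` and the `B s x(-t)`. -/
theorem sum_indicator_borel {i j : Fin n} (hij : (i : ℕ) + 1 = j) (hne : i ≠ j)
    (h : GL (Fin n) F) :
    (if h ∈ borel n F then (1 : R) else 0) + ∑ t : F,
      (if h * rootGL hne t * permGL n F (Equiv.swap i j) ∈ borel n F then (1 : R) else 0) =
      if h ∈ blockUpper n F (stepLabel i j) then 1 else 0 := by
  simp only [mul_rootGL_mul_swap_mem_borel_iff hij hne]
  rw [if_congr (mem_borel_iff_stepLabel hij) rfl rfl]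
  by_cases hP : h ∈ blockUpper n F (stepLabel i j)
  · simp only [hP, true_and, if_true]
    by_cases h0 : h j i = 0
    · have hjj : h j j ≠ 0 :=
        diag_ne_zero_of_mem_borel ((mem_borel_iff_stepLabel hij).2 ⟨hP, h0⟩) j
      simp [h0, hjj]
    · rw [if_neg h0, zero_add, Finset.sum_eq_single (-(h j j / h j i))]
      · rw [if_pos]; field_simp; ring
      · intro t _ ht
        rw [if_neg]
        intro h1
        apply ht
        field_simp
        linear_combination h1
      · simp
  · simp [hP]

/-- Elements of the lattice are killed by summation over the cosets of minimal parabolics. -/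
theorem lattice_coeff_add_sum {x : GroupAlg n F R} (hx : x ∈ lattice n F R)
    {i j : Fin n} (hij : (i : ℕ) + 1 = j) (hne : i ≠ j) (g : GL (Fin n) F) :
    x.coeff g + ∑ t : F, x.coeff (g * rootGL hne t * permGL n F (Equiv.swap i j)) = 0 := by
  revert g
  refine lattice_induction (p := fun x => ∀ g, x.coeff g +
    ∑ t : F, x.coeff (g * rootGL hne t * permGL n F (Equiv.swap i j)) = 0) (by simp) ?_ ?_ hx
  · intro x y h1 h2 g
    have := congrArg₂ (· + ·) (h1 g) (h2 g)
    simp only [add_zero] at this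
    rw [← this]
    simp only [MonoidAlgebra.coeff_add, Finsupp.add_apply, Finset.sum_add_distrib]
    ring
  · intro h r g
    simp only [MonoidAlgebra.coeff_single_mul_apply]
    rw [← Finset.mul_sum, ← mul_add]
    simp only [mul_assoc h⁻¹ _ _ |>.symm]
    set g' := h⁻¹ * g
    suffices (steinbergGen n F R).coeff g' + ∑ t : F, (steinbergGen n F R).coeff
        (g' * rootGL hne t * permGL n F (Equiv.swap i j)) = 0 by rw [this, mul_zero]
    simp only [coeff_steinbergGen]
    rw [Finset.sum_comm, ← Finset.sum_add_distrib]
    simp only [← Finset.mul_sum, ← mul_add, ← mul_assoc]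
    simp only [sum_indicator_borel hij hne]
    -- The terms of σ and of σ times the transposition cancel: the transposition lies in the minimal
    -- parabolic, so the indicators agree while the signs differ.
    refine Finset.sum_involution (fun σ _ => σ * Equiv.swap i j) ?_ ?_ ?_ ?_
    · intro σ _
      have hs : permGL n F (Equiv.swap i j) ∈ blockUpper n F (stepLabel i j) := by
        rw [permGL_mem_blockUpper]
        intro k
        rw [Equiv.swap_apply_def]
        simp only [stepLabel, Fin.ext_iff] at *
        split_ifs <;> omega
      have : (permGL n F (σ * Equiv.swap i j))⁻¹ * g' ∈ blockUpper n F (stepLabel i j) ↔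
          (permGL n F σ)⁻¹ * g' ∈ blockUpper n F (stepLabel i j) := by
        rw [map_mul, mul_inv_rev, mul_assoc, Subgroup.mul_mem_cancel_left _ (inv_mem hs)]
      simp only [this, Equiv.Perm.sign_mul, Equiv.Perm.sign_swap hne]
      split_ifs <;> simp
    · intro σ _ _ h
      have : Equiv.swap i j = 1 := by simpa using h
      rw [Equiv.swap_eq_one_iff] at this
      exact hne this
    · intro σ _; exact Finset.mem_univ _
    · intro σ _; simp [mul_assoc]

/-- An eigenfunction for `U` in the lattice is determined by its value at the longest element. -/
theorem coeff_eq_zero_of_eigen {x : GroupAlg n F R} (hx : x ∈ lattice n F R)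
    (χ : unitriangular n F → R)
    (hχ : ∀ (u : unitriangular n F) g, x.coeff (u * g) = χ u * x.coeff g)
    (h0 : x.coeff (permGL n F Fin.revPerm) = 0) : x = 0 := by
  have hσ : ∀ σ, x.coeff (permGL n F σ) = 0 := by
    refine perm_ascent_induction h0 ?_
    intro σ i j hij hlt ih
    have hne : i ≠ j := by rintro rfl; omega
    -- At an ascent, conjugation by σ moves the root element into U. Every term of the sum is thus a
    -- multiple of the value at the longer permutation, which vanishes by induction from w₀
    -- downwards.
    have h1 := lattice_coeff_add_sum hx hij hne (permGL n F σ)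
    rw [Finset.sum_eq_zero, add_zero] at h1
    · exact h1
    · intro t _
      have hr := permGL_conj_rootGL σ hlt.ne t
      simp only [perm_inv_apply_self] at hr
      have : permGL n F σ * rootGL hne t * permGL n F (Equiv.swap i j) =
          (⟨rootGL hlt.ne t, rootGL_mem_unitriangular hlt t⟩ : unitriangular n F) *
            permGL n F (σ * Equiv.swap i j) := by
        rw [← hr, map_mul]
        group
      rw [this, hχ, ih, mul_zero]
  ext g
  obtain ⟨u, hu, σ, b, hb, rfl⟩ := exists_bruhat g
  rw [lattice_coeff_mul_borel hx hb, hχ ⟨u, hu⟩, hσ, mul_zero]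
  simp

end Functions

/-! ### The eigenvectors E_λ and their values at permutations -/

section CharVectors

open scoped Classical

variable {n : ℕ} {F : Type*} [Field F] [Fintype F] {R : Type*} [CommRing R]

/-- The element `∑ λ(u) u` of the group algebra. -/
noncomputable def charSum (χ : unitriangular n F →* Rˣ) : GroupAlg n F R :=
  ∑ u : unitriangular n F, MonoidAlgebra.single (u : GL (Fin n) F) ((χ u : Rˣ) : R)

theorem charVector_eq_smul (χ : unitriangular n F →* Rˣ) :
    charVector χ = charSum χ • latticeGen n F R := by
  rw [charVector, finsum_eq_sum_of_fintype, charSum, Finset.sum_smul]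

theorem coe_charVector (χ : unitriangular n F →* Rˣ) :
    (charVector χ : GroupAlg n F R) = charSum χ * steinbergGen n F R := by
  rw [charVector_eq_smul]
  rfl

theorem coeff_charSum_mul (χ : unitriangular n F →* Rˣ) (x : GroupAlg n F R) (g : GL (Fin n) F) :
    (charSum χ * x).coeff g =
      ∑ u : unitriangular n F, ((χ u : Rˣ) : R) * x.coeff ((u : GL (Fin n) F)⁻¹ * g) := by
  rw [charSum, Finset.sum_mul, MonoidAlgebra.coeff_sum, Finsupp.finsetSum_apply]
  simp only [MonoidAlgebra.coeff_single_mul_apply]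

theorem coeff_charSum_mul_left (χ : unitriangular n F →* Rˣ) (x : GroupAlg n F R)
    (v : unitriangular n F) (g : GL (Fin n) F) :
    (charSum χ * x).coeff (v * g) = ((χ v : Rˣ) : R) * (charSum χ * x).coeff g := by
  rw [coeff_charSum_mul, coeff_charSum_mul, Finset.mul_sum,
    ← Equiv.sum_comp (Equiv.mulLeft v)]
  refine Finset.sum_congr rfl fun u _ => ?_
  rw [Equiv.coe_mulLeft, map_mul, Units.val_mul, mul_assoc]
  congr 3
  simp [mul_assoc]

theorem single_mul_charSum (χ : unitriangular n F →* Rˣ) (v : unitriangular n F) :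
    MonoidAlgebra.single (v : GL (Fin n) F) (1 : R) * charSum χ =
      (((χ v)⁻¹ : Rˣ) : R) • charSum χ := by
  rw [charSum, Finset.mul_sum, ← Equiv.sum_comp (Equiv.mulLeft v)
    (fun u : unitriangular n F => MonoidAlgebra.single (u : GL (Fin n) F) ((χ u : Rˣ) : R)),
    Finset.smul_sum]
  refine Finset.sum_congr rfl fun u _ => ?_
  rw [MonoidAlgebra.single_mul_single, MonoidAlgebra.smul_single]
  simp [map_mul]

theorem coeff_charVector_mul_left (χ : unitriangular n F →* Rˣ)
    (v : unitriangular n F) (g : GL (Fin n) F) :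
    (charVector χ : GroupAlg n F R).coeff (v * g) =
      ((χ v : Rˣ) : R) * (charVector χ : GroupAlg n F R).coeff g := by
  rw [coe_charVector, coeff_charSum_mul_left]

/-- The character is trivial on the elements of `U` fixing the flag `σ B`. -/
def TrivialOnCell (χ : unitriangular n F →* Rˣ) (σ : Equiv.Perm (Fin n)) : Prop :=
  ∀ u : unitriangular n F, (u : GL (Fin n) F) ∈ cellStab F (fun i => (i : ℕ)) σ → χ u = 1

omit [Fintype F] in
theorem mem_cellStab_val {σ : Equiv.Perm (Fin n)} {u : unitriangular n F} :
    (u : GL (Fin n) F) ∈ cellStab F (fun i => (i : ℕ)) σ ↔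
      (permGL n F σ)⁻¹ * u * permGL n F σ ∈ borel n F := by
  rw [mem_cellStab, and_iff_right u.2]
  rfl

theorem coeff_charVector_permGL (χ : unitriangular n F →* Rˣ) (σ : Equiv.Perm (Fin n)) :
    (charVector χ : GroupAlg n F R).coeff (permGL n F σ) =
      (((Equiv.Perm.sign σ : ℤˣ) : ℤ) : R) * ∑ u : unitriangular n F,
        if (u : GL (Fin n) F) ∈ cellStab F (fun i => (i : ℕ)) σ then ((χ u : Rˣ) : R) else 0 := by
  rw [coe_charVector, coeff_charSum_mul, Finset.mul_sum]
  refine Finset.sum_congr rfl fun u _ => ?_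
  rw [coeff_steinbergGen_mul_permGL (inv_mem u.2)]
  have : (permGL n F σ)⁻¹ * (u : GL (Fin n) F)⁻¹ * permGL n F σ ∈ borel n F ↔
      (u : GL (Fin n) F) ∈ cellStab F (fun i => (i : ℕ)) σ := by
    rw [mem_cellStab_val, ← inv_mem_iff (x := (permGL n F σ)⁻¹ * (u : GL (Fin n) F) * permGL n F σ)]
    simp [mul_assoc]
  simp only [this]
  split_ifs <;> ring

theorem sum_cell_of_trivial {χ : unitriangular n F →* Rˣ} {σ : Equiv.Perm (Fin n)}
    (h : TrivialOnCell χ σ) :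
    (∑ u : unitriangular n F,
      if (u : GL (Fin n) F) ∈ cellStab F (fun i => (i : ℕ)) σ then ((χ u : Rˣ) : R) else 0) =
      (Nat.card (cellStab F (fun i => (i : ℕ)) σ) : R) := by
  have : ∀ u : unitriangular n F,
      (if (u : GL (Fin n) F) ∈ cellStab F (fun i => (i : ℕ)) σ then ((χ u : Rˣ) : R) else 0) =
      if (u : GL (Fin n) F) ∈ cellStab F (fun i => (i : ℕ)) σ then 1 else 0 := by
    intro u
    split_ifs with hu
    · rw [h u hu, Units.val_one]
    · rfl
  simp only [this]
  rw [Finset.sum_boole]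
  congr 1
  have hle : cellStab F (fun i => (i : ℕ)) σ ≤ unitriangular n F := inf_le_left
  rw [← Nat.card_congr (Subgroup.subgroupOfEquivOfLe hle).toEquiv, Nat.card_eq_fintype_card,
    Fintype.card_subtype]
  rfl

/-- Translating by an element with nontrivial value fixes the sum and also multiplies it by that
value. -/
theorem sum_cell_of_not_trivial [IsDomain R] {χ : unitriangular n F →* Rˣ}
    {σ : Equiv.Perm (Fin n)} (h : ¬ TrivialOnCell χ σ) :
    (∑ u : unitriangular n F,
      if (u : GL (Fin n) F) ∈ cellStab F (fun i => (i : ℕ)) σ then ((χ u : Rˣ) : R) else 0) = 0 := by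
  simp only [TrivialOnCell, not_forall] at h
  obtain ⟨v, hv, hχ⟩ := h
  set S := ∑ u : unitriangular n F,
      if (u : GL (Fin n) F) ∈ cellStab F (fun i => (i : ℕ)) σ then ((χ u : Rˣ) : R) else 0 with hS
  have h1 : ((χ v : Rˣ) : R) * S = S := by
    rw [hS, Finset.mul_sum, ← Equiv.sum_comp (Equiv.mulLeft v) (fun u : unitriangular n F =>
      if (u : GL (Fin n) F) ∈ cellStab F (fun i => (i : ℕ)) σ then ((χ u : Rˣ) : R) else 0)]
    refine Finset.sum_congr rfl fun u _ => ?_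
    rw [Equiv.coe_mulLeft, Subgroup.coe_mul, Subgroup.mul_mem_cancel_left _ hv, map_mul,
      Units.val_mul]
    split_ifs <;> simp
  have h2 : (((χ v : Rˣ) : R) - 1) * S = 0 := by rw [sub_mul, h1, one_mul, sub_self]
  refine (mul_eq_zero.1 h2).resolve_left fun h3 => hχ ?_
  exact Units.ext (sub_eq_zero.1 h3)

theorem coeff_charVector_permGL_of_trivial {χ : unitriangular n F →* Rˣ}
    {σ : Equiv.Perm (Fin n)} (h : TrivialOnCell χ σ) :
    (charVector χ : GroupAlg n F R).coeff (permGL n F σ) =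
      (((Equiv.Perm.sign σ : ℤˣ) : ℤ) : R) *
        (Nat.card (cellStab F (fun i => (i : ℕ)) σ) : R) := by
  rw [coeff_charVector_permGL, sum_cell_of_trivial h]

omit [Fintype F] in
theorem eq_one_of_mem_cellStab_revPerm {u : GL (Fin n) F}
    (hu : u ∈ cellStab F (fun i => (i : ℕ)) Fin.revPerm) : u = 1 := by
  rw [mem_cellStab_iff_apply] at hu
  have hinv : (Fin.revPerm : Equiv.Perm (Fin n))⁻¹ = Fin.revPerm := by
    rw [Equiv.Perm.inv_def]; exact Fin.revPerm_symm
  apply Units.ext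
  ext i j
  rw [Units.val_one]
  rcases lt_trichotomy i j with h | h | h
  · rw [hu.2 i j h, Matrix.one_apply_ne h.ne]
    rw [hinv, Fin.revPerm_apply, Fin.revPerm_apply]
    exact Fin.rev_lt_rev.2 h
  · rw [h, hu.1.2 j, Matrix.one_apply_eq]
  · rw [hu.1.1 h, Matrix.one_apply_ne h.ne']

/-- The stabilizer in U of the flag of w₀ is trivial, so the value is a sign. This normalises E_λ
and keeps it nonzero modulo ℓ. -/
theorem coeff_charVector_revPerm (χ : unitriangular n F →* Rˣ) :
    (charVector χ : GroupAlg n F R).coeff (permGL n F Fin.revPerm) =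
      (((Equiv.Perm.sign (Fin.revPerm : Equiv.Perm (Fin n)) : ℤˣ) : ℤ) : R) := by
  have h : TrivialOnCell χ Fin.revPerm := fun u hu => by
    rw [show u = 1 from Subtype.ext (eq_one_of_mem_cellStab_revPerm hu), map_one]
  rw [coeff_charVector_permGL_of_trivial h]
  have : Nat.card (cellStab F (fun i => (i : ℕ)) (Fin.revPerm : Equiv.Perm (Fin n))) = 1 := by
    rw [Nat.card_eq_one_iff_unique]
    exact ⟨⟨fun a b => Subtype.ext ((eq_one_of_mem_cellStab_revPerm a.2).trans
      (eq_one_of_mem_cellStab_revPerm b.2).symm)⟩, ⟨1⟩⟩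
  rw [this, Nat.cast_one, mul_one]

theorem isUnit_sign (σ : Equiv.Perm (Fin n)) :
    IsUnit (((Equiv.Perm.sign σ : ℤˣ) : ℤ) : R) :=
  (Units.isUnit (Equiv.Perm.sign σ)).map (Int.castRingHom R)

/-- The eigenspaces of `U` in the lattice are spanned by the vectors `E_λ`. -/
theorem exists_charSum_smul_eq (χ : unitriangular n F →* Rˣ) (x : lattice n F R) :
    ∃ c : R, charSum χ • x = c • charVector χ := by
  obtain ⟨s, hs⟩ := isUnit_sign (R := R) (Fin.revPerm : Equiv.Perm (Fin n))
  set v := (charSum χ * (x : GroupAlg n F R)).coeff (permGL n F Fin.revPerm)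
  -- The scalar is the quotient of the values at w₀; the difference is then an eigenfunction
  -- vanishing there.
  refine ⟨v * ((s⁻¹ : Rˣ) : R), ?_⟩
  rw [← sub_eq_zero]
  apply Subtype.ext
  refine coeff_eq_zero_of_eigen (Subtype.mem _) (fun u => ((χ u : Rˣ) : R)) ?_ ?_
  · intro u g
    change (charSum χ * (x : GroupAlg n F R) -
      (v * ((s⁻¹ : Rˣ) : R)) • (charVector χ : GroupAlg n F R)).coeff _ = _ *
      (charSum χ * (x : GroupAlg n F R) -
      (v * ((s⁻¹ : Rˣ) : R)) • (charVector χ : GroupAlg n F R)).coeff _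
    simp only [MonoidAlgebra.coeff_sub, MonoidAlgebra.coeff_smul, Finsupp.sub_apply,
      Finsupp.smul_apply, coeff_charSum_mul_left, coeff_charVector_mul_left, smul_eq_mul]
    ring
  · change (charSum χ * (x : GroupAlg n F R) -
      (v * ((s⁻¹ : Rˣ) : R)) • (charVector χ : GroupAlg n F R)).coeff _ = 0
    simp only [MonoidAlgebra.coeff_sub, MonoidAlgebra.coeff_smul, Finsupp.sub_apply,
      Finsupp.smul_apply, coeff_charVector_revPerm, smul_eq_mul, ← hs]
    rw [mul_assoc, Units.inv_mul, mul_one, sub_self]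

theorem coeff_of_charSum_smul_eq {χ : unitriangular n F →* Rˣ} {x : lattice n F R} {c : R}
    (h : charSum χ • x = c • charVector χ) (g : GL (Fin n) F) :
    (charSum χ * (x : GroupAlg n F R)).coeff g =
      c * (charVector χ : GroupAlg n F R).coeff g := by
  have h' : charSum χ * (x : GroupAlg n F R) = c • (charVector χ : GroupAlg n F R) :=
    congrArg Subtype.val h
  rw [h', MonoidAlgebra.coeff_smul, Finsupp.smul_apply, smul_eq_mul]

theorem charSum_smul_charVector (χ : unitriangular n F →* Rˣ) :
    charSum χ • charVector χ = (Nat.card (unitriangular n F) : R) • charVector χ := by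
  have : ∀ u : unitriangular n F, MonoidAlgebra.single (u : GL (Fin n) F) ((χ u : Rˣ) : R) *
      charSum χ = charSum χ := by
    intro u
    have h : MonoidAlgebra.single (u : GL (Fin n) F) ((χ u : Rˣ) : R) =
        ((χ u : Rˣ) : R) • MonoidAlgebra.single (u : GL (Fin n) F) (1 : R) := by
      rw [MonoidAlgebra.smul_single, smul_eq_mul, mul_one]
    rw [h, smul_mul_assoc, single_mul_charSum, smul_smul, Units.mul_inv, one_smul]
  have h2 : ∑ u : unitriangular n F, MonoidAlgebra.single (u : GL (Fin n) F) ((χ u : Rˣ) : R) *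
      charSum χ = (Nat.card (unitriangular n F) : R) • charSum χ := by
    rw [Finset.sum_congr rfl fun u _ => this u, Finset.sum_const, Finset.card_univ,
      Nat.card_eq_fintype_card, ← Nat.cast_smul_eq_nsmul R]
  have h3 : charSum χ * charSum χ = (Nat.card (unitriangular n F) : R) • charSum χ := by
    rw [← h2, ← Finset.sum_mul]
    rfl
  rw [charVector_eq_smul, ← mul_smul, h3, smul_assoc]

end CharVectors

/-! ### The form on E_λ, and reciprocity of coefficients -/

section Pairing

open scoped Classical

variable {n : ℕ} {F : Type*} [Field F] [Fintype F] {R : Type*} [CommRing R]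

theorem pairing_eq_sum (x y : GroupAlg n F R) : pairing x y = ∑ g, x.coeff g * y.coeff g := by
  rw [pairing, Finsupp.sum_fintype]
  simp

theorem pairing_comm (x y : GroupAlg n F R) : pairing x y = pairing y x := by
  rw [pairing_eq_sum, pairing_eq_sum]
  exact Finset.sum_congr rfl fun g _ => mul_comm _ _

theorem pairing_smul_right (r : R) (x y : GroupAlg n F R) :
    pairing x (r • y) = r * pairing x y := by
  rw [pairing_eq_sum, pairing_eq_sum, Finset.mul_sum]
  refine Finset.sum_congr rfl fun g _ => ?_
  rw [MonoidAlgebra.coeff_smul, Finsupp.smul_apply, smul_eq_mul]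
  ring

theorem pairing_smul_left (r : R) (x y : GroupAlg n F R) :
    pairing (r • x) y = r * pairing x y := by
  rw [pairing_comm, pairing_smul_right, pairing_comm]

omit [Fintype F] in
theorem pairing_sum_left {ι : Type*} (s : Finset ι) (f : ι → GroupAlg n F R)
    (y : GroupAlg n F R) : pairing (∑ i ∈ s, f i) y = ∑ i ∈ s, pairing (f i) y := by
  induction s using Finset.induction_on with
  | empty => simp [pairing_zero_left]
  | insert a s ha ih => rw [Finset.sum_insert ha, Finset.sum_insert ha, pairing_add_left, ih]

theorem pairing_sum_right {ι : Type*} (s : Finset ι) (f : ι → GroupAlg n F R)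
    (y : GroupAlg n F R) : pairing y (∑ i ∈ s, f i) = ∑ i ∈ s, pairing y (f i) := by
  rw [pairing_comm, pairing_sum_left]
  exact Finset.sum_congr rfl fun i _ => pairing_comm _ _

omit [Fintype F] in
-- The adjoint comes from the anti-automorphism g ↦ g⁻¹ of the group algebra.
theorem exists_adjoint (a : GroupAlg n F R) :
    ∃ a' : GroupAlg n F R, ∀ x y, pairing (a * x) y = pairing x (a' * y) := by
  induction a using MonoidAlgebra.induction_linear with
  | zero => exact ⟨0, fun x y => by simp [pairing]⟩
  | add a b ha hb =>
    obtain ⟨a', ha⟩ := ha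
    obtain ⟨b', hb⟩ := hb
    exact ⟨a' + b', fun x y => by rw [add_mul, add_mul, pairing_add_left, pairing_add_right, ha, hb]⟩
  | single g r => exact ⟨_, pairing_single_mul g r⟩

theorem pairing_charSum_mul (χ : unitriangular n F →* Rˣ) (x y : GroupAlg n F R) :
    pairing (charSum χ * x) y = pairing x (charSum χ⁻¹ * y) := by
  rw [charSum, Finset.sum_mul, pairing_sum_left, charSum, Finset.sum_mul, pairing_sum_right,
    ← Equiv.sum_comp (Equiv.inv (unitriangular n F))]
  refine Finset.sum_congr rfl fun u _ => ?_
  rw [pairing_single_mul]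
  simp

/-- The number `f(E_λ, e)`. -/
noncomputable def charNorm (χ : unitriangular n F →* Rˣ) : ℕ :=
  ∑ σ : Equiv.Perm (Fin n) with TrivialOnCell χ σ, Nat.card (cellStab F (fun i => (i : ℕ)) σ)

omit [Fintype F] in
theorem charNorm_inv (χ : unitriangular n F →* Rˣ) : charNorm χ⁻¹ = charNorm χ := by
  have : ∀ σ, TrivialOnCell χ⁻¹ σ ↔ TrivialOnCell χ σ := by
    intro σ
    simp [TrivialOnCell]
  simp only [charNorm, this]

/-- By right B-invariance, the coset σB contributes |B| sg(σ) times the value of E_λ at σ. That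
value again carries sg(σ), so the signs square away and only the stabilizers on which λ is trivial
remain. -/
theorem pairing_charVector_gen [IsDomain R] (χ : unitriangular n F →* Rˣ) :
    pairing (charVector χ : GroupAlg n F R) (steinbergGen n F R) =
      (Nat.card (borel n F) : R) * (charNorm χ : R) := by
  have h1 : ∀ σ : Equiv.Perm (Fin n), (∑ g : GL (Fin n) F,
      (charVector χ : GroupAlg n F R).coeff g *
        ((((Equiv.Perm.sign σ : ℤˣ) : ℤ) : R) *
          if (permGL n F σ)⁻¹ * g ∈ borel n F then 1 else 0)) =
      (Nat.card (borel n F) : R) *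
        if TrivialOnCell χ σ then (Nat.card (cellStab F (fun i => (i : ℕ)) σ) : R) else 0 := by
    intro σ
    rw [← Equiv.sum_comp (Equiv.mulLeft (permGL n F σ))]
    have h2 : ∀ g : GL (Fin n) F, (charVector χ : GroupAlg n F R).coeff
        (Equiv.mulLeft (permGL n F σ) g) * ((((Equiv.Perm.sign σ : ℤˣ) : ℤ) : R) *
          if (permGL n F σ)⁻¹ * (Equiv.mulLeft (permGL n F σ) g) ∈ borel n F then 1 else 0) =
        if g ∈ borel n F then (charVector χ : GroupAlg n F R).coeff (permGL n F σ) *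
          (((Equiv.Perm.sign σ : ℤˣ) : ℤ) : R) else 0 := by
      intro g
      rw [Equiv.coe_mulLeft, inv_mul_cancel_left]
      split_ifs with hg
      · rw [lattice_coeff_mul_borel (Subtype.mem _) hg, mul_one]
      · rw [mul_zero, mul_zero]
    rw [Finset.sum_congr rfl fun g _ => h2 g, ← Finset.sum_filter, Finset.sum_const, nsmul_eq_mul,
      coeff_charVector_permGL]
    have h3 : (Finset.univ.filter fun g : GL (Fin n) F => g ∈ borel n F).card =
        Nat.card (borel n F) := by
      rw [Nat.card_eq_fintype_card, Fintype.card_subtype]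
    rw [h3]
    congr 1
    have hsq : (((Equiv.Perm.sign σ : ℤˣ) : ℤ) : R) * (((Equiv.Perm.sign σ : ℤˣ) : ℤ) : R) = 1 := by
      rw [← Int.cast_mul, ← Units.val_mul, Int.units_mul_self, Units.val_one, Int.cast_one]
    split_ifs with h
    · rw [sum_cell_of_trivial h, mul_right_comm, hsq, one_mul]
    · rw [sum_cell_of_not_trivial h, mul_zero, zero_mul]
  rw [pairing_eq_sum]
  simp only [coeff_steinbergGen, Finset.mul_sum]
  rw [Finset.sum_comm, Finset.sum_congr rfl fun σ _ => h1 σ, ← Finset.mul_sum, ← Finset.sum_filter,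
    charNorm, Nat.cast_sum]

theorem pairing_charVector [IsDomain R] (χ : unitriangular n F →* Rˣ) {y : lattice n F R} {c : R}
    (h : charSum χ⁻¹ • y = c • charVector χ⁻¹) :
    pairing (charVector χ : GroupAlg n F R) (y : GroupAlg n F R) =
      (Nat.card (borel n F) : R) * (c * (charNorm χ : R)) := by
  have h' : charSum χ⁻¹ * (y : GroupAlg n F R) = c • (charVector χ⁻¹ : GroupAlg n F R) :=
    congrArg Subtype.val h
  rw [coe_charVector, pairing_charSum_mul, h', pairing_smul_right, pairing_comm,
    pairing_charVector_gen, charNorm_inv]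
  ring

/-- The symmetry between the transition coefficients of two characters. -/
theorem exists_adjoint_coefficients [IsDomain R] [CharZero R] (χ μ : unitriangular n F →* Rˣ)
    (a : GroupAlg n F R) {c : R} (h : charSum μ • (a • charVector χ) = c • charVector μ) :
    ∃ (a' : GroupAlg n F R) (c' : R),
      charSum χ⁻¹ • (a' • charVector μ⁻¹) = c' • charVector χ⁻¹ ∧
      c' * (charNorm χ : R) = c * (charNorm μ : R) := by
  obtain ⟨a', ha'⟩ := exists_adjoint a
  obtain ⟨c', hc'⟩ := exists_charSum_smul_eq χ⁻¹ (a' • charVector μ⁻¹)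
  refine ⟨a', c', hc', ?_⟩
  have h1 : charSum μ * (a * (charVector χ : GroupAlg n F R)) =
    c • (charVector μ : GroupAlg n F R) := congrArg Subtype.val h
  have h2 : charSum χ⁻¹ * (a' * (charVector μ⁻¹ : GroupAlg n F R)) =
    c' • (charVector χ⁻¹ : GroupAlg n F R) := congrArg Subtype.val hc'
  -- Moving both character sums and the group algebra element across the form computes one number in
  -- two ways, once through each coefficient.
  have h3 : pairing (charSum μ * (a * (charVector χ : GroupAlg n F R))) (steinbergGen n F R) =
      pairing (steinbergGen n F R) (charSum χ⁻¹ * (a' * (charVector μ⁻¹ : GroupAlg n F R))) := by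
    rw [pairing_charSum_mul, ha', coe_charVector χ, pairing_charSum_mul, coe_charVector μ⁻¹]
  rw [h1, h2, pairing_smul_left, pairing_smul_right, pairing_comm (steinbergGen n F R),
    pairing_charVector_gen, pairing_charVector_gen, charNorm_inv] at h3
  have hB : (Nat.card (borel n F) : R) ≠ 0 := Nat.cast_ne_zero.2 Nat.card_pos.ne'
  apply mul_left_cancel₀ hB
  linear_combination -h3

end Pairing

/-! ### Additive characters of a finite field -/

theorem exists_primitive_addChar {F : Type*} [Field F] [Finite F] {p : ℕ} (hp : p.Prime) [CharP F p]
    {R : Type*} [CommRing R] {ζ : R} (hζ : IsPrimitiveRoot ζ p) :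
    ∃ ψ : AddChar F R, ψ.IsPrimitive := by
  have hr : ringChar F = p := ringChar.eq F p
  subst hr
  have : Fact (ringChar F).Prime := ⟨hp⟩
  have : NeZero (ringChar F) := ⟨hp.ne_zero⟩
  let _ : Algebra (ZMod (ringChar F)) F := ZMod.algebra _ _
  let ψ := AddChar.zmodChar (ringChar F) hζ.pow_eq_one
  have hψ : ψ.IsPrimitive := AddChar.zmodChar_primitive_of_primitive_root _ hζ
  -- Composing the character of the prime field with the trace gives a nontrivial character because
  -- the trace is not identically zero; over a field, nontrivial characters are primitive.
  refine ⟨ψ.compAddMonoidHom (Algebra.trace (ZMod (ringChar F)) F).toAddMonoidHom, ?_⟩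
  apply AddChar.IsPrimitive.of_ne_one
  obtain ⟨a, ha⟩ := FiniteField.trace_to_zmod_nondegenerate F (one_ne_zero (α := F))
  rw [one_mul] at ha
  exact AddChar.ne_one_iff.2 ⟨a, fun hf => ha <| (hψ.zmod_char_eq_one_iff _ _).mp hf⟩

section AddChars

variable {F : Type*} [Field F] [Fintype F] {R : Type*} [CommRing R] [IsDomain R]

theorem sum_addChar_mul [DecidableEq F] {ψ : AddChar F R} (hψ : ψ.IsPrimitive) (b : F) :
    ∑ c, ψ (c * b) = if b = 0 then (Fintype.card F : R) else 0 := by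
  rw [AddChar.sum_mulShift b hψ]
  split_ifs <;> simp

/-- Every additive character of a finite field is a shift of a primitive one. -/
theorem exists_eq_mulShift [CharZero R] {ψ : AddChar F R} (hψ : ψ.IsPrimitive) (θ : AddChar F R) :
    ∃ a : F, ∀ t, θ t = ψ (a * t) := by
  classical
  by_contra! hcon
  -- If θ is not a shift of ψ, it is orthogonal to all of them. Summing over all shifts isolates
  -- θ(0) = 1 with the factor |F|, which is nonzero in characteristic 0.
  have h1 : ∀ c, ∑ t, θ t * ψ (c * t) = 0 := by
    intro c
    have : θ * ψ.mulShift c ≠ 1 := by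
      intro h
      obtain ⟨t, ht⟩ := hcon (-c)
      apply ht
      have := congrArg (fun f : AddChar F R => f t) h
      simp only [AddChar.mul_apply, AddChar.mulShift_apply, AddChar.one_apply] at this
      have h2 : ψ (-c * t) * ψ (c * t) = 1 := by
        rw [← AddChar.map_add_eq_mul, neg_mul, neg_add_cancel, AddChar.map_zero_eq_one]
      calc θ t = θ t * (ψ (-c * t) * ψ (c * t)) := by rw [h2, mul_one]
        _ = (θ t * ψ (c * t)) * ψ (-c * t) := by ring
        _ = ψ (-c * t) := by rw [this, one_mul]
    have h := AddChar.sum_eq_zero_of_ne_one this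
    simpa [AddChar.mul_apply, AddChar.mulShift_apply] using h
  have h2 : ∑ c : F, ∑ t, θ t * ψ (c * t) = 0 := Finset.sum_eq_zero fun c _ => h1 c
  rw [Finset.sum_comm] at h2
  simp only [← Finset.mul_sum, sum_addChar_mul hψ] at h2
  simp at h2

end AddChars

/-! ### Superdiagonal entries, column groups and root elements -/

section Superdiagonal

variable {n : ℕ} {F : Type*} [Field F]

/-- The entry just above the diagonal in a given column. -/
def superdiag (g : GL (Fin n) F) (j : Fin n) : F :=
  if 0 < (j : ℕ) then g ⟨j - 1, by omega⟩ j else 0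

theorem superdiag_of_step (g : GL (Fin n) F) {i j : Fin n} (hij : (i : ℕ) + 1 = j) :
    superdiag g j = g i j := by
  rw [superdiag, if_pos (by omega)]
  rw [show (⟨j - 1, by omega⟩ : Fin n) = i from Fin.ext (by simp only; omega)]

theorem superdiag_eq_zero (g : GL (Fin n) F) {j : Fin n} (hj : (j : ℕ) = 0) :
    superdiag g j = 0 := by
  rw [superdiag, if_neg (by omega)]

theorem exists_step_or (j : Fin n) : (j : ℕ) = 0 ∨ ∃ i : Fin n, (i : ℕ) + 1 = j := by
  by_cases h : (j : ℕ) = 0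
  · exact Or.inl h
  · exact Or.inr ⟨⟨j - 1, by omega⟩, by simp only; omega⟩

theorem mul_apply_of_step {u v : GL (Fin n) F} (hu : u ∈ unitriangular n F)
    (hv : v ∈ unitriangular n F) {i j : Fin n} (hij : (i : ℕ) + 1 = j) :
    (u * v : GL (Fin n) F) i j = u i j + v i j := by
  have hne : i ≠ j := by rintro rfl; omega
  rw [Matrix.GeneralLinearGroup.coe_mul, Matrix.mul_apply,
    ← Finset.sum_subset (Finset.subset_univ {i, j}), Finset.sum_pair hne, hu.2, hv.2]
  · ring
  · intro k _ hk
    simp only [Finset.mem_insert, Finset.mem_singleton, not_or] at hk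
    rcases lt_or_ge k i with h | h
    · rw [hu.1 h, zero_mul]
    · have : j < k := by
        have h1 : (k : ℕ) ≠ i := fun h' => hk.1 (Fin.ext h')
        have h2 : (k : ℕ) ≠ j := fun h' => hk.2 (Fin.ext h')
        rw [Fin.le_def] at h
        rw [Fin.lt_def]
        omega
      rw [hv.1 this, mul_zero]

theorem superdiag_mul (u v : unitriangular n F) (j : Fin n) :
    superdiag (u * v : GL (Fin n) F) j = superdiag (u : GL (Fin n) F) j + superdiag v j := by
  rcases exists_step_or j with h | ⟨i, hij⟩
  · simp [superdiag_eq_zero _ h]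
  · rw [superdiag_of_step _ hij, superdiag_of_step _ hij, superdiag_of_step _ hij,
      mul_apply_of_step u.2 v.2 hij]

theorem superdiag_one (j : Fin n) : superdiag (1 : GL (Fin n) F) j = 0 := by
  rcases exists_step_or j with h | ⟨i, hij⟩
  · exact superdiag_eq_zero _ h
  · rw [superdiag_of_step _ hij, Units.val_one, Matrix.one_apply_ne]
    rintro rfl; omega

/-- The column group element with given entries above the diagonal in column `k`. -/
def colU (k : Fin n) (a : Fin n → F) : unitriangular n F :=
  ⟨oneAddGL (Matrix.of fun i j => if j = k ∧ i < k then a i else 0) (by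
    ext i j
    rw [Matrix.mul_apply]
    refine Finset.sum_eq_zero fun l _ => ?_
    by_cases h : l = k
    · simp [h]
    · simp [h]), by
    rw [mem_unitriangular]
    constructor
    · intro i j hij
      simp only [coe_oneAddGL, Matrix.add_apply, Matrix.one_apply_ne hij.ne', Matrix.of_apply,
        zero_add]
      rw [if_neg]
      rintro ⟨rfl, h⟩
      exact lt_asymm h hij
    · intro i
      simp only [coe_oneAddGL, Matrix.add_apply, Matrix.one_apply_eq, Matrix.of_apply]
      rw [if_neg, add_zero]
      rintro ⟨rfl, h⟩
      exact lt_irrefl _ h⟩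

theorem colU_apply (k : Fin n) (a : Fin n → F) (i j : Fin n) :
    (colU k a : GL (Fin n) F) i j =
      (if i = j then 1 else 0) + if j = k ∧ i < k then a i else 0 := by
  simp [colU, Matrix.one_apply]

theorem colU_mul_apply (k : Fin n) (a : Fin n → F) (g : GL (Fin n) F) (i j : Fin n) :
    (colU k a * g : GL (Fin n) F) i j = g i j + if i < k then a i * g k j else 0 := by
  rw [Matrix.GeneralLinearGroup.coe_mul]
  simp only [colU, coe_oneAddGL]
  rw [add_mul, one_mul, Matrix.add_apply, Matrix.mul_apply, Finset.sum_eq_single k]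
  · simp
  · intro l _ hl; simp [hl]
  · simp

theorem colU_add (k : Fin n) (a b : Fin n → F) : colU k (a + b) = colU k a * colU k b := by
  apply Subtype.ext
  apply Units.ext
  ext i j
  rw [Subgroup.coe_mul, colU_mul_apply, colU_apply, colU_apply, colU_apply, Pi.add_apply]
  by_cases hi : i < k
  · by_cases hj : j = k
    · subst hj
      simp [hi]
      ring
    · simp [hi, hj, Ne.symm hj]
  · simp [hi]

theorem colU_zero (k : Fin n) : colU k (0 : Fin n → F) = 1 := by
  apply Subtype.ext
  apply Units.ext
  ext i j
  rw [colU_apply]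
  simp [Matrix.one_apply]

/-- A root element two or more steps off the diagonal is a commutator, so it dies in every abelian
quotient of U. -/
theorem rootGL_commutator {i j k : Fin n} (hij : i < j) (hjk : j < k) (t : F) :
    rootGL hij.ne t * rootGL hjk.ne 1 =
      rootGL (hij.trans hjk).ne t * (rootGL hjk.ne 1 * rootGL hij.ne t) := by
  apply Units.ext
  simp only [Matrix.GeneralLinearGroup.coe_mul, coe_rootGL, Matrix.transvection, mul_add, add_mul,
    mul_one, one_mul, Matrix.single_mul_single_same,
    Matrix.single_mul_single_of_ne _ _ _ _ (hij.trans hjk).ne',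
    Matrix.single_mul_single_of_ne _ _ _ _ hjk.ne', mul_zero]
  abel

/-- The root elements for the simple roots. -/
def simpleRoot (j : Fin n) (t : F) : unitriangular n F :=
  if h : 0 < (j : ℕ) then
    ⟨rootGL (i := ⟨j - 1, by omega⟩) (j := j) (by
      intro h'
      rw [Fin.ext_iff] at h'
      simp only at h'
      omega) t, rootGL_mem_unitriangular (by rw [Fin.lt_def]; simp only; omega) t⟩
  else 1

theorem simpleRoot_of_step {i j : Fin n} (hij : (i : ℕ) + 1 = j) (hlt : i < j) (t : F) :
    (simpleRoot j t : GL (Fin n) F) = rootGL hlt.ne t := by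
  obtain ⟨j, hj⟩ := j
  obtain rfl : (i : ℕ) + 1 = j := hij
  rw [simpleRoot, dif_pos (by simp only; omega)]

theorem simpleRoot_zero (j : Fin n) : simpleRoot j (0 : F) = 1 := by
  apply Subtype.ext
  rcases exists_step_or j with h | ⟨i, hij⟩
  · rw [simpleRoot, dif_neg (by omega)]
  · rw [simpleRoot_of_step hij (by rw [Fin.lt_def]; omega)]
    apply Units.ext
    ext k l
    rw [rootGL_apply]
    simp [Matrix.one_apply]

theorem simpleRoot_add (j : Fin n) (s t : F) :
    simpleRoot j (s + t) = simpleRoot j s * simpleRoot j t := by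
  apply Subtype.ext
  rw [Subgroup.coe_mul]
  rcases exists_step_or j with h | ⟨i, hij⟩
  · rw [simpleRoot, simpleRoot, simpleRoot, dif_neg (by omega), dif_neg (by omega),
      dif_neg (by omega)]
    simp
  · have hlt : i < j := by rw [Fin.lt_def]; omega
    rw [simpleRoot_of_step hij hlt, simpleRoot_of_step hij hlt, simpleRoot_of_step hij hlt]
    apply Units.ext
    simp only [Matrix.GeneralLinearGroup.coe_mul, coe_rootGL]
    exact (Matrix.transvection_mul_transvection_same _ _ hlt.ne s t).symm

theorem colU_single_eq_rootGL {i k : Fin n} (hik : i < k) (t : F) :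
    (colU k (Pi.single i t) : GL (Fin n) F) = rootGL hik.ne t := by
  apply Units.ext
  ext a b
  rw [colU_apply, rootGL_apply]
  congr 1
  by_cases ha : a = i
  · subst ha
    simp [hik, eq_comm]
  · simp [ha, Ne.symm ha]

end Superdiagonal

/-! ### Homomorphisms from U to abelian groups -/

section CharacterStructure

variable {n : ℕ} {F : Type*} [Field F] {A : Type*} [CommGroup A]

/-- For a nonsimple root above the diagonal, inserting the index i + 1 between i and k writes the
element as a commutator; for i ≥ k the element is trivial. -/
theorem map_colU_single (χ : unitriangular n F →* A) (k i : Fin n) (t : F) :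
    χ (colU k (Pi.single i t)) = if (i : ℕ) + 1 = k then χ (simpleRoot k t) else 1 := by
  split_ifs with h
  · congr 1
    apply Subtype.ext
    have hlt : i < k := by rw [Fin.lt_def]; omega
    rw [colU_single_eq_rootGL hlt, simpleRoot_of_step h hlt]
  · rcases lt_or_ge i k with hik | hik
    · let j : Fin n := ⟨i + 1, by rw [Fin.lt_def] at hik; omega⟩
      have hij : i < j := by rw [Fin.lt_def]; simp [j]
      have hjk : j < k := by rw [Fin.lt_def] at *; simp only [j]; omega
      have hc := rootGL_commutator hij hjk t
      rw [← colU_single_eq_rootGL (hij.trans hjk), ← colU_single_eq_rootGL hij,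
        ← colU_single_eq_rootGL hjk] at hc
      have hc' : colU j (Pi.single i t) * colU k (Pi.single j (1 : F)) =
          colU k (Pi.single i t) * (colU k (Pi.single j 1) * colU j (Pi.single i t)) :=
        Subtype.ext hc
      have := congrArg χ hc'
      simp only [map_mul] at this
      rw [mul_comm (χ (colU j (Pi.single i t)))] at this
      exact (mul_eq_right.1 this.symm)
    · rw [show colU k (Pi.single i t) = 1 from ?_, map_one]
      rw [← colU_zero k]
      apply Subtype.ext
      apply Units.ext
      ext a b
      rw [colU_apply, colU_apply]
      congr 1
      by_cases ha : a = i
      · subst ha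
        simp [not_lt.2 hik]
      · simp [ha]

theorem map_colU (χ : unitriangular n F →* A) (k : Fin n) (a : Fin n → F) :
    χ (colU k a) = χ (simpleRoot k (superdiag (colU k a : GL (Fin n) F) k)) := by
  have hadd : ∀ s : Finset (Fin n), χ (colU k (∑ i ∈ s, Pi.single i (a i))) =
      ∏ i ∈ s, χ (colU k (Pi.single i (a i))) := by
    intro s
    induction s using Finset.induction_on with
    | empty => simp [colU_zero]
    | insert b s hb ih => rw [Finset.sum_insert hb, Finset.prod_insert hb, colU_add, map_mul, ih]
  have h := hadd Finset.univ
  rw [Finset.univ_sum_single a] at h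
  rw [h]
  simp only [map_colU_single]
  rcases exists_step_or k with h0 | ⟨i, hi⟩
  · rw [superdiag_eq_zero _ h0, simpleRoot_zero, map_one]
    exact Finset.prod_eq_one fun i _ => if_neg (by omega)
  · have hlt : i < k := by rw [Fin.lt_def]; omega
    rw [superdiag_of_step _ hi, colU_apply, if_neg hlt.ne, if_pos ⟨rfl, hlt⟩, zero_add,
      Finset.prod_eq_single i, if_pos hi]
    · intro j _ hj
      rw [if_neg]
      intro h'
      exact hj (Fin.ext (by omega))
    · simp

/-- Induction on the number m of columns not yet known to be trivial: splitting off the first of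
them on the left makes one more column trivial, and superdiagonal entries add up in products. -/
theorem map_eq_prod_of_columns (χ : unitriangular n F →* A) (m : ℕ) :
    ∀ k, k + m = n → ∀ u : unitriangular n F,
      (∀ i j : Fin n, (j : ℕ) < k → (u : GL (Fin n) F) i j = if i = j then 1 else 0) →
      χ u = ∏ j, χ (simpleRoot j (superdiag (u : GL (Fin n) F) j)) := by
  induction m with
  | zero =>
    intro k hk u hu
    have : u = 1 := by
      apply Subtype.ext
      apply Units.ext
      ext i j
      rw [hu i j (by omega)]
      simp [Matrix.one_apply]
    subst this
    rw [map_one]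
    exact (Finset.prod_eq_one fun j _ => by
      rw [Subgroup.coe_one, superdiag_one, simpleRoot_zero, map_one]).symm
  | succ m ih =>
    intro k hk u hu
    let c : Fin n := ⟨k, by omega⟩
    let a : Fin n → F := fun i => (u : GL (Fin n) F) i c
    have hua := mem_unitriangular.1 u.2
    have hmul : u = colU c a * (colU c (-a) * u) := by
      rw [← mul_assoc, ← colU_add, add_neg_cancel, colU_zero, one_mul]
    have hcol : ∀ i j : Fin n, (j : ℕ) < k + 1 →
        ((colU c (-a) * u : unitriangular n F) : GL (Fin n) F) i j = if i = j then 1 else 0 := by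
      intro i j hj
      rw [Subgroup.coe_mul, colU_mul_apply]
      rcases Nat.lt_succ_iff_lt_or_eq.1 hj with hj | hj
      · rw [hu i j hj, hu c j hj, if_neg (show c ≠ j by rintro rfl; simp [c] at hj)]
        simp
      · have hjc : j = c := Fin.ext hj
        subst hjc
        rw [hua.2 c]
        rcases lt_trichotomy i c with h | h | h
        · rw [if_pos h, if_neg h.ne]; simp [a]
        · rw [h, hua.2 c]; simp
        · rw [hua.1 i c h, if_neg (not_lt.2 h.le), if_neg h.ne', add_zero]
    have hsd : ∀ j : Fin n, superdiag (u : GL (Fin n) F) j =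
        superdiag (colU c a : GL (Fin n) F) j +
          superdiag ((colU c (-a) * u : unitriangular n F) : GL (Fin n) F) j := by
      intro j
      conv_lhs => rw [hmul]
      rw [Subgroup.coe_mul, superdiag_mul]
    conv_lhs => rw [hmul]
    rw [map_mul, ih (k + 1) (by omega) _ hcol, map_colU]
    have hprod : ∀ j, χ (simpleRoot j (superdiag (u : GL (Fin n) F) j)) =
        χ (simpleRoot j (superdiag (colU c a : GL (Fin n) F) j)) *
        χ (simpleRoot j (superdiag ((colU c (-a) * u : unitriangular n F) : GL (Fin n) F) j)) := by
      intro j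
      rw [hsd, simpleRoot_add, map_mul]
    simp only [hprod]
    rw [Finset.prod_mul_distrib]
    congr 1
    rw [Finset.prod_eq_single c]
    · intro j _ hj
      rcases exists_step_or j with h0 | ⟨i, hi⟩
      · rw [superdiag_eq_zero _ h0, simpleRoot_zero, map_one]
      · have hlt : i < j := by rw [Fin.lt_def]; omega
        rw [superdiag_of_step _ hi, colU_apply, if_neg hlt.ne, if_neg (by simp [hj]), add_zero,
          simpleRoot_zero, map_one]
    · simp

/-- A homomorphism from `U` to an abelian group only depends on the entries just above the
diagonal. -/
theorem map_eq_prod (χ : unitriangular n F →* A) (u : unitriangular n F) :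
    χ u = ∏ j, χ (simpleRoot j (superdiag (u : GL (Fin n) F) j)) :=
  map_eq_prod_of_columns χ n 0 (by omega) u fun _ _ h => absurd h (Nat.not_lt_zero _)

end CharacterStructure

/-! ### Linear characters of U given by coefficient vectors -/

section LinearCharacters

variable {n : ℕ} {F : Type*} [Field F] {R : Type*} [CommRing R]

theorem addChar_map_sum {A M ι : Type*} [AddCommMonoid A] [CommMonoid M] (ψ : AddChar A M)
    (s : Finset ι) (f : ι → A) : ψ (∑ i ∈ s, f i) = ∏ i ∈ s, ψ (f i) := by
  classical
  induction s using Finset.induction_on with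
  | empty => simp
  | insert a s ha ih => rw [Finset.sum_insert ha, Finset.prod_insert ha, AddChar.map_add_eq_mul, ih]

/-- The linear character of `U` with given coefficients. -/
def linChar (ψ : AddChar F R) (a : Fin n → F) : unitriangular n F →* Rˣ :=
  MonoidHom.toHomUnits
    { toFun := fun u => ψ (∑ j, a j * superdiag (u : GL (Fin n) F) j)
      map_one' := by simp [superdiag_one]
      map_mul' := by
        intro u v
        simp only [Subgroup.coe_mul, superdiag_mul, mul_add, Finset.sum_add_distrib]
        rw [AddChar.map_add_eq_mul] }

theorem coe_linChar (ψ : AddChar F R) (a : Fin n → F) (u : unitriangular n F) :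
    ((linChar ψ a u : Rˣ) : R) = ψ (∑ j, a j * superdiag (u : GL (Fin n) F) j) := rfl

theorem linChar_inv (ψ : AddChar F R) (a : Fin n → F) :
    (linChar ψ a)⁻¹ = linChar ψ (-a) := by
  ext u
  rw [MonoidHom.inv_apply, ← map_inv, coe_linChar, coe_linChar]
  congr 1
  refine Finset.sum_congr rfl fun j _ => ?_
  have h := superdiag_mul u u⁻¹ j
  rw [Subgroup.coe_inv, mul_inv_cancel, superdiag_one] at h
  rw [Pi.neg_apply, neg_mul, ← mul_neg, Subgroup.coe_inv]
  congr 1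
  linear_combination -h

theorem superdiag_rootGL {i j : Fin n} (hij : (i : ℕ) + 1 = j) (hlt : i < j) (t : F) (k : Fin n) :
    superdiag (rootGL hlt.ne t) k = if k = j then t else 0 := by
  rcases exists_step_or k with h0 | ⟨l, hl⟩
  · rw [superdiag_eq_zero _ h0, if_neg]
    rintro rfl; omega
  · rw [superdiag_of_step _ hl, rootGL_apply, if_neg (by rintro rfl; omega), zero_add]
    by_cases hk : k = j
    · subst hk
      rw [if_pos ⟨Fin.ext (by omega), rfl⟩, if_pos rfl]
    · rw [if_neg (fun h => hk h.2.symm), if_neg hk]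

theorem nontrivialOnRoot_linChar_iff {ψ : AddChar F R} (hψ : ψ.IsPrimitive) (a : Fin n → F)
    {i j : Fin n} (hij : (i : ℕ) + 1 = j) : NontrivialOnRoot (linChar ψ a) i j ↔ a j ≠ 0 := by
  have hlt : i < j := by rw [Fin.lt_def]; omega
  have hval : ∀ (t : F) (u : unitriangular n F), (u : GL (Fin n) F) = rootGL hlt.ne t →
      ((linChar ψ a u : Rˣ) : R) = ψ (a j * t) := by
    intro t u hu
    rw [coe_linChar, hu]
    simp only [superdiag_rootGL hij hlt]
    simp
  constructor
  · rintro ⟨t, u, hu, hχ⟩ h0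
    apply hχ
    apply Units.ext
    rw [hval t u (Units.ext hu), h0, zero_mul, AddChar.map_zero_eq_one, Units.val_one]
  · intro h0
    obtain ⟨t, ht⟩ := AddChar.ne_one_iff.1 (hψ h0)
    rw [AddChar.mulShift_apply] at ht
    refine ⟨t, ⟨rootGL hlt.ne t, rootGL_mem_unitriangular hlt t⟩, rfl, fun h => ht ?_⟩
    rw [← hval t ⟨rootGL hlt.ne t, rootGL_mem_unitriangular hlt t⟩ rfl, h, Units.val_one]

/-- The stabilizer of a flag σB contains precisely those simple root subgroups whose order σ⁻¹
preserves, and its elements vanish at the other simple roots; a linear character sees nothing else.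
-/
theorem trivialOnCell_linChar_iff {ψ : AddChar F R} (hψ : ψ.IsPrimitive) (a : Fin n → F)
    (σ : Equiv.Perm (Fin n)) : TrivialOnCell (linChar ψ a) σ ↔
      ∀ i j : Fin n, (i : ℕ) + 1 = j → a j ≠ 0 → σ⁻¹ j < σ⁻¹ i := by
  constructor
  · intro h i j hij ha
    have hlt : i < j := by rw [Fin.lt_def]; omega
    by_contra hcon
    have hσ : σ⁻¹ i < σ⁻¹ j :=
      lt_of_le_of_ne (not_lt.1 hcon) fun h' => hlt.ne (σ⁻¹.injective h')
    obtain ⟨t, u, hu, hχ⟩ := (nontrivialOnRoot_linChar_iff hψ a hij).2 ha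
    apply hχ
    apply h
    have hu' : (u : GL (Fin n) F) = rootGL hlt.ne t := Units.ext hu
    rw [mem_cellStab_val, hu', permGL_conj_rootGL σ hlt.ne]
    exact unitriangular_le_borel (rootGL_mem_unitriangular hσ t)
  · intro h u hu
    rw [mem_cellStab_iff_apply] at hu
    apply Units.ext
    rw [coe_linChar, Finset.sum_eq_zero, AddChar.map_zero_eq_one, Units.val_one]
    intro j _
    rcases exists_step_or j with h0 | ⟨i, hij⟩
    · rw [superdiag_eq_zero _ h0, mul_zero]
    · by_cases ha : a j = 0
      · rw [ha, zero_mul]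
      · rw [superdiag_of_step _ hij, hu.2 i j (by rw [Fin.lt_def]; omega) (h i j hij ha), mul_zero]

/-- The permutations counted are those reversing the linked neighbours, and their stabilizers sum to
the index. This identifies f(E_λ, e) with [G : P(λ)]. -/
theorem charNorm_linChar [Finite F] {ψ : AddChar F R} (hψ : ψ.IsPrimitive) {a : Fin n → F}
    {b : Fin n → ℕ} (hb : Monotone b)
    (hab : ∀ i j : Fin n, (i : ℕ) + 1 = j → (b i = b j ↔ a j ≠ 0)) :
    charNorm (linChar ψ a) = (blockUpper n F b).index := by
  classical
  rw [← sum_card_cellStab_eq_index hb, charNorm]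
  refine Finset.sum_congr ?_ fun _ _ => rfl
  ext σ
  simp only [Finset.mem_filter, Finset.mem_univ, true_and, trivialOnCell_linChar_iff hψ]
  refine forall_congr' fun i => forall_congr' fun j => forall_congr' fun hij => ?_
  rw [hab i j hij]

/-- A linear character is determined by its restrictions to the simple root subgroups, each a shift
of ψ. -/
theorem exists_eq_linChar [Fintype F] [IsDomain R] [CharZero R] {ψ : AddChar F R}
    (hψ : ψ.IsPrimitive) (χ : unitriangular n F →* Rˣ) : ∃ a : Fin n → F, χ = linChar ψ a := by
  let θ : Fin n → AddChar F R := fun j =>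
    { toFun := fun t => ((χ (simpleRoot j t) : Rˣ) : R)
      map_zero_eq_one' := by simp [simpleRoot_zero]
      map_add_eq_mul' := fun s t => by simp [simpleRoot_add] }
  choose a ha using fun j => exists_eq_mulShift hψ (θ j)
  refine ⟨a, ?_⟩
  ext u
  rw [map_eq_prod, coe_linChar, addChar_map_sum, Units.coe_prod]
  exact Finset.prod_congr rfl fun j _ => ha j _

end LinearCharacters

/-! ### Conjugation of characters by diagonal matrices -/

section Torus

variable {n : ℕ} {F : Type*} [Field F] [Fintype F] {R : Type*} [CommRing R]

omit [Fintype F] in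
theorem permGL_conj_diagGL_mem_borel (σ : Equiv.Perm (Fin n)) (t : Fin n → Fˣ) :
    (permGL n F σ)⁻¹ * diagGL t * permGL n F σ ∈ borel n F := by
  intro i j hij
  rw [permGL_conj_apply, coe_diagGL, Matrix.diagonal_apply_ne]
  exact fun h => (ne_of_gt hij) (σ.injective h)

/-- Permutation matrices normalise the diagonal group, and B̂ absorbs the conjugated element. -/
theorem diagGL_mul_steinbergGen (t : Fin n → Fˣ) :
    MonoidAlgebra.single (diagGL t) (1 : R) * steinbergGen n F R = steinbergGen n F R := by
  classical
  ext g
  rw [MonoidAlgebra.coeff_single_mul_apply, one_mul, coeff_steinbergGen, coeff_steinbergGen]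
  refine Finset.sum_congr rfl fun σ _ => ?_
  have : (permGL n F σ)⁻¹ * ((diagGL t)⁻¹ * g) =
      ((permGL n F σ)⁻¹ * diagGL t * permGL n F σ)⁻¹ * ((permGL n F σ)⁻¹ * g) := by group
  rw [this]
  simp only [Subgroup.mul_mem_cancel_left _ (inv_mem (permGL_conj_diagGL_mem_borel σ t))]

omit [Fintype F] in
theorem diagGL_conj_apply (t : Fin n → Fˣ) (g : GL (Fin n) F) (i j : Fin n) :
    ((diagGL t)⁻¹ * g * diagGL t : GL (Fin n) F) i j = (t i : F)⁻¹ * g i j * t j := by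
  rw [Matrix.GeneralLinearGroup.coe_mul, coe_diagGL, Matrix.mul_diagonal,
    Matrix.GeneralLinearGroup.coe_mul, coe_inv_diagGL, Matrix.diagonal_mul]

omit [Fintype F] in
theorem diagGL_conj_mem (t : Fin n → Fˣ) {g : GL (Fin n) F} (hg : g ∈ unitriangular n F) :
    (diagGL t)⁻¹ * g * diagGL t ∈ unitriangular n F := by
  rw [mem_unitriangular] at *
  refine ⟨fun i j hij => ?_, fun i => ?_⟩
  · rw [diagGL_conj_apply, hg.1 i j hij, mul_zero, zero_mul]
  · rw [diagGL_conj_apply, hg.2 i]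
    simp

theorem diagGL_smul_charVector (t : Fin n → Fˣ) {χ χ' : unitriangular n F →* Rˣ}
    (h : ∀ u : unitriangular n F, χ u = χ' ⟨_, diagGL_conj_mem t u.2⟩) :
    MonoidAlgebra.single (diagGL t) (1 : R) • charVector χ' = charVector χ := by
  apply Subtype.ext
  change MonoidAlgebra.single (diagGL t) (1 : R) * (charVector χ' : GroupAlg n F R) =
    (charVector χ : GroupAlg n F R)
  rw [coe_charVector, coe_charVector, ← mul_assoc]
  have : MonoidAlgebra.single (diagGL t) (1 : R) * charSum χ' =
      charSum χ * MonoidAlgebra.single (diagGL t) (1 : R) := by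
    rw [charSum, charSum, Finset.mul_sum, Finset.sum_mul]
    symm
    refine Finset.sum_bij (fun u _ => ⟨_, diagGL_conj_mem t u.2⟩) (by simp) ?_ ?_ ?_
    · intro u _ v _ huv
      simpa using huv
    · intro u _
      have hmem : diagGL t * u * (diagGL t)⁻¹ ∈ unitriangular n F := by
        have h1 : (diagGL t)⁻¹ = diagGL (F := F) fun i => (t i)⁻¹ := by
          rw [inv_eq_iff_mul_eq_one]
          apply Units.ext
          simp
        have h2 := diagGL_conj_mem (fun i => (t i)⁻¹) u.2
        rw [← h1, inv_inv] at h2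
        exact h2
      refine ⟨⟨_, hmem⟩, by simp, ?_⟩
      apply Subtype.ext
      simp [mul_assoc]
    · intro u _
      rw [MonoidAlgebra.single_mul_single, MonoidAlgebra.single_mul_single, h u]
      simp [mul_assoc]
  rw [this, mul_assoc, diagGL_mul_steinbergGen]

/-- The characters with the same support are conjugate under the diagonal group. -/
theorem exists_diagGL_smul_charVector {ψ : AddChar F R} {a a' : Fin n → F}
    (h : ∀ j : Fin n, 0 < (j : ℕ) → (a j = 0 ↔ a' j = 0)) :
    ∃ t : Fin n → Fˣ, MonoidAlgebra.single (diagGL t) (1 : R) • charVector (linChar ψ a') =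
      charVector (linChar ψ a) := by
  classical
  -- Conjugation multiplies the entry at (j - 1, j) by t_j / t_{j-1}. Partial products of the ratios
  -- a_j / a'_j make this quotient the required one; the value 1 is harmless where the coefficients
  -- vanish.
  let r : ℕ → Fˣ := fun k => if hk : k < n then
    if ha : a ⟨k, hk⟩ = 0 ∨ a' ⟨k, hk⟩ = 0 then 1 else
      Units.mk0 (a ⟨k, hk⟩) (fun h' => ha (Or.inl h')) /
        Units.mk0 (a' ⟨k, hk⟩) (fun h' => ha (Or.inr h')) else 1
  refine ⟨fun i => ∏ k ∈ Finset.range (i + 1), r k, diagGL_smul_charVector _ fun u => ?_⟩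
  apply Units.ext
  rw [coe_linChar, coe_linChar]
  congr 1
  refine Finset.sum_congr rfl fun j _ => ?_
  rcases exists_step_or j with h0 | ⟨i, hij⟩
  · rw [superdiag_eq_zero _ h0, superdiag_eq_zero _ h0, mul_zero, mul_zero]
  · rw [superdiag_of_step _ hij, superdiag_of_step _ hij, diagGL_conj_apply,
      Finset.prod_range_succ _ (j : ℕ), hij]
    have hj := h j (by omega)
    by_cases ha : a j = 0
    · rw [ha, hj.1 ha, zero_mul, zero_mul]
    · have ha' : a' j ≠ 0 := fun h' => ha (hj.2 h')
      have hr : r j = Units.mk0 (a j) ha / Units.mk0 (a' j) ha' := by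
        simp only [r, j.2, dif_pos, Fin.eta]
        rw [dif_neg (by tauto)]
      rw [hr]
      push_cast
      have hne : (∏ k ∈ Finset.range (j : ℕ), (r k : F)) ≠ 0 :=
        Finset.prod_ne_zero_iff.2 fun k _ => (r k).ne_zero
      simp only [Units.val_mk0]
      field_simp

end Torus

/-! ### Conjugation of column-trivial matrices by row-trivial ones -/

section Mirabolic

variable {n : ℕ} {F : Type*} [Field F]

/-- The unitriangular matrices whose columns before `k` are trivial. -/
def TrivialColumns (k : ℕ) (u : GL (Fin n) F) : Prop :=
  ∀ i j : Fin n, (j : ℕ) < k → u i j = if i = j then 1 else 0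

/-- The invertible matrices whose rows from `k` on are trivial. -/
def TrivialRows (k : ℕ) (g : GL (Fin n) F) : Prop :=
  ∀ i j : Fin n, k ≤ (i : ℕ) → g i j = if i = j then 1 else 0

theorem TrivialRows.mul_apply {k : ℕ} {g : GL (Fin n) F} (hg : TrivialRows k g)
    (h : GL (Fin n) F) {i : Fin n} (hi : k ≤ (i : ℕ)) (j : Fin n) :
    (g * h : GL (Fin n) F) i j = h i j := by
  rw [Matrix.GeneralLinearGroup.coe_mul, Matrix.mul_apply, Finset.sum_eq_single i]
  · rw [hg i i hi, if_pos rfl, one_mul]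
  · intro l _ hl
    rw [hg i l hi, if_neg hl.symm, zero_mul]
  · simp

theorem TrivialRows.inv_mul_apply {k : ℕ} {g : GL (Fin n) F} (hg : TrivialRows k g)
    (h : GL (Fin n) F) {i : Fin n} (hi : k ≤ (i : ℕ)) (j : Fin n) :
    (g⁻¹ * h : GL (Fin n) F) i j = h i j := by
  rw [← hg.mul_apply (g⁻¹ * h) hi, mul_inv_cancel_left]

theorem TrivialRows.conj_apply {k : ℕ} {g u : GL (Fin n) F} (hg : TrivialRows k g)
    (hu : u ∈ unitriangular n F) {i : Fin n} (hi : k ≤ (i : ℕ)) (j : Fin n) :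
    (g⁻¹ * (u * g) : GL (Fin n) F) i j = u i j := by
  rw [mem_unitriangular] at hu
  rw [hg.inv_mul_apply _ hi, Matrix.GeneralLinearGroup.coe_mul, Matrix.mul_apply,
    Finset.sum_eq_single j]
  · rcases le_or_gt k j with hj | hj
    · rw [hg j j hj, if_pos rfl, mul_one]
    · rw [hu.1 i j (by rw [Fin.lt_def]; omega), zero_mul]
  · intro l _ hl
    rcases lt_or_ge l i with h | h
    · rw [hu.1 i l h, zero_mul]
    · rw [hg l j (by rw [Fin.le_def] at h; omega), if_neg hl, mul_zero]
  · simp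

theorem TrivialRows.conj_trivialColumns {k : ℕ} {g u : GL (Fin n) F} (hg : TrivialRows k g)
    (hu : TrivialColumns (k + 1) u) : TrivialColumns (k + 1) (g⁻¹ * (u * g)) := by
  intro i j hj
  have h1 : ∀ i, (u * g : GL (Fin n) F) i j = g i j := by
    intro i
    rw [Matrix.GeneralLinearGroup.coe_mul, Matrix.mul_apply, Finset.sum_eq_single i]
    · by_cases hi : (i : ℕ) < k + 1
      · rw [hu i i hi, if_pos rfl, one_mul]
      · have hij : i ≠ j := by rintro rfl; exact hi hj
        rw [hg i j (by omega), if_neg hij, mul_zero]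
    · intro l _ hl
      by_cases hlk : (l : ℕ) < k + 1
      · rw [hu i l hlk, if_neg hl.symm, zero_mul]
      · have hlj : l ≠ j := by rintro rfl; exact hlk hj
        rw [hg l j (by omega), if_neg hlj, mul_zero]
    · simp
  have h2 : (g⁻¹ * (u * g) : GL (Fin n) F) i j = (g⁻¹ * g : GL (Fin n) F) i j := by
    rw [Matrix.GeneralLinearGroup.coe_mul, Matrix.GeneralLinearGroup.coe_mul g⁻¹ g,
      Matrix.mul_apply, Matrix.mul_apply]
    exact Finset.sum_congr rfl fun l _ => by rw [h1]
  rw [h2, inv_mul_cancel, Units.val_one, Matrix.one_apply]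

/-- The conjugation changes neither the rows from k on nor the trivial columns up to k; all other
entries lie strictly above the diagonal. -/
theorem TrivialRows.conj_mem_unitriangular {k : ℕ} {g u : GL (Fin n) F} (hg : TrivialRows k g)
    (hu : u ∈ unitriangular n F) (hu' : TrivialColumns (k + 1) u) :
    g⁻¹ * (u * g) ∈ unitriangular n F := by
  have hu1 := mem_unitriangular.1 hu
  rw [mem_unitriangular]
  refine ⟨fun i j hij => ?_, fun i => ?_⟩
  · rcases le_or_gt k i with hi | hi
    · rw [hg.conj_apply hu hi, hu1.1 i j hij]
    · rw [hg.conj_trivialColumns hu' i j (by rw [Fin.lt_def] at hij; omega), if_neg hij.ne']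
  · rcases le_or_gt k i with hi | hi
    · rw [hg.conj_apply hu hi, hu1.2]
    · rw [hg.conj_trivialColumns hu' i i (by omega), if_pos rfl]

/-- A superdiagonal entry lies either in an unchanged row or in a trivial column. So the row-trivial
matrices preserve an eigenvector condition on the later columns. -/
theorem TrivialRows.superdiag_conj {k : ℕ} {g u : GL (Fin n) F} (hg : TrivialRows k g)
    (hu : u ∈ unitriangular n F) (hu' : TrivialColumns (k + 1) u) (j : Fin n) :
    superdiag (g⁻¹ * (u * g)) j = superdiag u j := by
  rcases exists_step_or j with h0 | ⟨i, hij⟩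
  · rw [superdiag_eq_zero _ h0, superdiag_eq_zero _ h0]
  · rw [superdiag_of_step _ hij, superdiag_of_step _ hij]
    rcases le_or_gt k i with hi | hi
    · rw [hg.conj_apply hu hi]
    · rw [hg.conj_trivialColumns hu' i j (by omega), hu' i j (by omega)]

theorem trivialRows_colU {c : Fin n} (v : Fin n → F) :
    TrivialRows (c : ℕ) (colU c v : GL (Fin n) F) := by
  intro i j hi
  rw [colU_apply, if_neg (c := j = c ∧ i < c), add_zero]
  rintro ⟨_, h⟩
  rw [Fin.lt_def] at h
  omega

/-- Conjugation acts on the group of column c through the upper left block of g; the hypothesis says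
that this block sends v' to v. -/
theorem colU_mul_eq_mul_colU {c : Fin n} {g : GL (Fin n) F} (hg : TrivialRows (c : ℕ) g)
    {v v' : Fin n → F}
    (h : ∀ i < c, ∑ l, g i l * (if l < c then v' l else 0) = v i) :
    (colU c v : GL (Fin n) F) * g = g * colU c v' := by
  apply Units.ext
  ext i j
  rw [colU_mul_apply]
  have h1 : (g * colU c v' : GL (Fin n) F) i j =
      g i j + if j = c then ∑ l, g i l * (if l < c then v' l else 0) else 0 := by
    rw [Matrix.GeneralLinearGroup.coe_mul, Matrix.mul_apply]
    simp only [colU_apply, mul_add, Finset.sum_add_distrib]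
    congr 1
    · simp
    · split_ifs with hj
      · refine Finset.sum_congr rfl fun l _ => ?_
        simp [hj]
      · exact Finset.sum_eq_zero fun l _ => by simp [hj]
  rw [h1]
  congr 1
  rw [hg c j le_rfl]
  by_cases hj : j = c
  · rw [if_pos hj]
    by_cases hi : i < c
    · rw [if_pos hi, h i hi, if_pos hj.symm, mul_one]
    · rw [if_neg hi]
      refine (Finset.sum_eq_zero fun l _ => ?_).symm
      rw [hg i l (by rw [Fin.lt_def] at hi; omega)]
      by_cases hl : l < c
      · rw [if_neg, zero_mul]
        rintro rfl
        exact hi hl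
      · rw [if_neg hl, mul_zero]
  · rw [if_neg hj, if_neg (Ne.symm hj), mul_zero, ite_self]

theorem colU_congr {c : Fin n} {v w : Fin n → F} (h : ∀ i < c, v i = w i) :
    colU c v = colU c w := by
  apply Subtype.ext
  apply Units.ext
  ext i j
  rw [colU_apply, colU_apply]
  congr 1
  by_cases hi : i < c
  · rw [h i hi]
  · simp [hi]

end Mirabolic

/-! ### Existence of eigenvectors for U in nonzero modules -/

section Eigenvectors

variable {n : ℕ} {F : Type*} [Field F] [Fintype F] {R : Type*} [CommRing R]
  {M : Type*} [AddCommGroup M] [Module R M] [Module (GroupAlg n F R) M]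
  [IsScalarTower R (GroupAlg n F R) M]

/-- The action of a group element on a module over the group algebra. -/
noncomputable def act (R : Type*) [CommRing R] {M : Type*} [AddCommGroup M] [Module R M]
    [Module (GroupAlg n F R) M] [IsScalarTower R (GroupAlg n F R) M]
    (g : GL (Fin n) F) : M →ₗ[R] M where
  toFun y := MonoidAlgebra.single g (1 : R) • y
  map_add' := smul_add _
  map_smul' _ _ := smul_comm _ _ _

omit [Fintype F] in
theorem act_mul (g h : GL (Fin n) F) (y : M) : act R (g * h) y = act R g (act R h y) := by
  change MonoidAlgebra.single (g * h) (1 : R) • y =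
    MonoidAlgebra.single g (1 : R) • MonoidAlgebra.single h (1 : R) • y
  rw [← mul_smul, MonoidAlgebra.single_mul_single, mul_one]

omit [Fintype F] in
theorem act_one (y : M) : act R (1 : GL (Fin n) F) y = y := by
  change MonoidAlgebra.single (1 : GL (Fin n) F) (1 : R) • y = y
  rw [← MonoidAlgebra.one_def, one_smul]

omit [Fintype F] in
theorem act_ne_zero (g : GL (Fin n) F) {y : M} (hy : y ≠ 0) : act R g y ≠ 0 := by
  intro h
  apply hy
  rw [← act_one (n := n) (F := F) (R := R) y, ← inv_mul_cancel g, act_mul, h, map_zero]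

/-- `y` is an eigenvector, with a given linear character, for the unitriangular matrices whose
columns before `k` are trivial. -/
def IsColumnEigen (ψ : AddChar F R) (k : ℕ) (a : Fin n → F) (y : M) : Prop :=
  ∀ u : GL (Fin n) F, u ∈ unitriangular n F → TrivialColumns k u →
    act R u y = ψ (∑ j, a j * superdiag u j) • y

omit [Fintype F] in
theorem IsColumnEigen.act {ψ : AddChar F R} {k : ℕ} {a : Fin n → F} {y : M}
    (hy : IsColumnEigen ψ (k + 1) a y) {g : GL (Fin n) F} (hg : TrivialRows k g) :
    IsColumnEigen ψ (k + 1) a (act R g y) := by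
  intro u hu hu'
  have h1 : u * g = g * (g⁻¹ * (u * g)) := by group
  rw [← act_mul, h1, act_mul, hy _ (hg.conj_mem_unitriangular hu hu')
    (hg.conj_trivialColumns hu'), map_smul]
  simp only [hg.superdiag_conj hu hu']

omit [Fintype F] in
theorem IsColumnEigen.sum {ψ : AddChar F R} {k : ℕ} {a : Fin n → F} {ι : Type*} (s : Finset ι)
    {f : ι → M} (r : ι → R) (h : ∀ i ∈ s, IsColumnEigen ψ k a (f i)) :
    IsColumnEigen ψ k a (∑ i ∈ s, r i • f i) := by
  intro u hu hu'
  rw [map_sum, Finset.smul_sum]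
  refine Finset.sum_congr rfl fun i hi => ?_
  rw [map_smul, h i hi u hu hu', smul_comm]

theorem sum_addChar_dotProduct [IsDomain R] {ψ : AddChar F R} (hψ : ψ.IsPrimitive)
    (v : Fin n → F) [Decidable (v = 0)] :
    ∑ d : Fin n → F, ψ (∑ i, d i * v i) = if v = 0 then (Fintype.card F : R) ^ n else 0 := by
  classical
  have h1 : ∀ d : Fin n → F, ψ (∑ i, d i * v i) = ∏ i, ψ (d i * v i) := fun d =>
    addChar_map_sum _ _ _
  simp only [h1]
  rw [← Fintype.piFinset_univ, Finset.sum_prod_piFinset Finset.univ (fun i c => ψ (c * v i))]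
  simp only [sum_addChar_mul hψ]
  split_ifs with h
  · subst h
    simp
  · obtain ⟨i, hi⟩ := Function.ne_iff.1 h
    exact Finset.prod_eq_zero (Finset.mem_univ i) (if_neg hi)

/-- Passing to an eigenvector of a column group. -/
theorem IsColumnEigen.exists_colU_eigen [IsDomain R] {ψ : AddChar F R} (hψ : ψ.IsPrimitive)
    (hq : IsUnit (Fintype.card F : R)) {c : Fin n} {a : Fin n → F} {y : M} (hy0 : y ≠ 0)
    (hy : IsColumnEigen ψ ((c : ℕ) + 1) a y) :
    ∃ z : M, z ≠ 0 ∧ IsColumnEigen ψ ((c : ℕ) + 1) a z ∧ ∃ d : Fin n → F,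
      (∀ i, ¬ i < c → d i = 0) ∧
      ∀ v, SteinbergLattice.act R (colU c v : GL (Fin n) F) z = ψ (∑ i, d i * v i) • z := by
  classical
  -- The Fourier components of y for the column group: they sum to q^n y, so one of them is nonzero.
  let f : (Fin n → F) → M := fun d => ∑ v : Fin n → F,
    ψ (∑ i, d i * -v i) • SteinbergLattice.act R (colU c v : GL (Fin n) F) y
  have hsum : ∑ d, f d = ((Fintype.card F : R) ^ n) • y := by
    simp only [f]
    rw [Finset.sum_comm]
    simp only [← Finset.sum_smul]
    have : ∀ v : Fin n → F, ∑ d : Fin n → F, ψ (∑ i, d i * -v i) =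
        if v = 0 then (Fintype.card F : R) ^ n else 0 := by
      intro v
      have h := sum_addChar_dotProduct hψ (-v)
      simp only [Pi.neg_apply] at h
      rw [h]
      simp only [neg_eq_zero]
    simp only [this, ite_smul, zero_smul]
    rw [Finset.sum_ite_eq' Finset.univ (0 : Fin n → F), if_pos (Finset.mem_univ _), colU_zero,
      Subgroup.coe_one, act_one]
  obtain ⟨d, hd⟩ : ∃ d, f d ≠ 0 := by
    by_contra! hcon
    rw [Finset.sum_eq_zero fun d _ => hcon d] at hsum
    obtain ⟨w, hw⟩ := hq.pow n
    rw [← hw] at hsum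
    apply hy0
    have := congrArg (fun m => ((w⁻¹ : Rˣ) : R) • m) hsum
    simpa [smul_smul] using this.symm
  -- The column group only involves coordinates below c, so the functional d may be truncated there.
  refine ⟨f d, hd, IsColumnEigen.sum _ _ fun v _ => hy.act (trivialRows_colU v),
    fun i => if i < c then d i else 0, fun i hi => if_neg hi, fun v => ?_⟩
  let w : Fin n → F := fun i => if i < c then v i else 0
  have hvw : colU c v = colU c w := colU_congr fun i hi => by simp [w, hi]
  have hdw : ∑ i, (if i < c then d i else 0) * v i = ∑ i, d i * w i := by
    refine Finset.sum_congr rfl fun i _ => ?_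
    simp only [w]
    split_ifs <;> simp
  rw [hvw, hdw]
  simp only [f, map_sum, Finset.smul_sum]
  rw [← Equiv.sum_comp (Equiv.addLeft w) (fun v =>
    ψ (∑ i, d i * w i) • ψ (∑ i, d i * -v i) • SteinbergLattice.act R (colU c v : GL (Fin n) F) y)]
  refine Finset.sum_congr rfl fun v' _ => ?_
  rw [map_smul, ← act_mul, Equiv.coe_addLeft, colU_add, Subgroup.coe_mul, smul_smul,
    ← AddChar.map_add_eq_mul, ← Finset.sum_add_distrib]
  congr 2
  refine Finset.sum_congr rfl fun i _ => ?_
  change d i * -v' i = d i * w i + d i * -(w i + v' i)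
  ring

omit [Fintype F] in
theorem act_colU_act {c : Fin n} {g : GL (Fin n) F} (hg : TrivialRows (c : ℕ) g)
    {ψ : AddChar F R} {d : Fin n → F} {z : M}
    (hz : ∀ v, act R (colU c v : GL (Fin n) F) z = ψ (∑ i, d i * v i) • z) {v v' : Fin n → F}
    (h : ∀ i < c, ∑ l, g i l * (if l < c then v' l else 0) = v i) :
    act R (colU c v : GL (Fin n) F) (act R g z) = ψ (∑ i, d i * v' i) • act R g z := by
  rw [← act_mul, colU_mul_eq_mul_colU hg h, act_mul, hz, map_smul]

omit [Fintype F] in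
/-- Moving a character of a column group to the last coordinate. -/
theorem exists_colU_eigen_superdiag {ψ : AddChar F R} {c : Fin n} {a d : Fin n → F} {z : M}
    (hz0 : z ≠ 0) (hz : IsColumnEigen ψ ((c : ℕ) + 1) a z) (hd : ∀ i, ¬ i < c → d i = 0)
    (hzd : ∀ v, act R (colU c v : GL (Fin n) F) z = ψ (∑ i, d i * v i) • z) :
    ∃ z' : M, z' ≠ 0 ∧ IsColumnEigen ψ ((c : ℕ) + 1) a z' ∧ ∃ s : F, ∀ v : Fin n → F,
      act R (colU c v : GL (Fin n) F) z' = ψ (s * superdiag (colU c v : GL (Fin n) F) c) • z' := by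
  by_cases h0 : ∀ i, d i = 0
  · refine ⟨z, hz0, hz, 0, fun v => ?_⟩
    rw [hzd]
    simp [h0]
  push Not at h0
  obtain ⟨i₀, hi₀⟩ := h0
  have hi₀c : i₀ < c := by
    by_contra h
    exact hi₀ (hd i₀ h)
  let r : Fin n := ⟨(c : ℕ) - 1, by omega⟩
  have hrc : (r : ℕ) + 1 = c := by
    rw [Fin.lt_def] at hi₀c
    simp only [r]
    omega
  have hrc' : r < c := by rw [Fin.lt_def]; omega
  -- move a nonzero coordinate into position
  let τ := Equiv.swap i₀ r
  have hτ : ∀ i, τ i < c ↔ i < c := by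
    intro i
    simp only [τ, Equiv.swap_apply_def]
    split_ifs with h1 h2
    · rw [h1]; exact ⟨fun _ => hi₀c, fun _ => hrc'⟩
    · rw [h2]; exact ⟨fun _ => hrc', fun _ => hi₀c⟩
    · rfl
  have hττ : ∀ i, τ (τ i) = i := fun i => Equiv.swap_apply_self _ _ _
  have hg₁ : TrivialRows (c : ℕ) (permGL n F τ) := by
    intro i j hi
    rw [permGL_apply]
    have hir : i ≠ i₀ := by rintro rfl; rw [Fin.lt_def] at hi₀c; omega
    have hir' : i ≠ r := by rintro rfl; omega
    have hfix : τ i = i := Equiv.swap_apply_of_ne_of_ne hir hir'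
    refine if_congr ⟨fun h => ?_, fun h => ?_⟩ rfl rfl
    · rw [← hττ j, ← h, hfix]
    · rw [← h, hfix]
  let d₁ : Fin n → F := fun i => d (τ i)
  have hz₁ : ∀ v, act R (colU c v : GL (Fin n) F) (act R (permGL n F τ) z) =
      ψ (∑ i, d₁ i * v i) • act R (permGL n F τ) z := by
    intro v
    rw [act_colU_act hg₁ hzd (v' := fun i => v (τ i))]
    · congr 2
      rw [← Equiv.sum_comp τ]
      simp only [d₁, hττ]
    · intro i hi
      rw [Finset.sum_eq_single (τ i)]
      · rw [permGL_apply, hττ, if_pos rfl, if_pos ((hτ i).2 hi), one_mul]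
      · intro l _ hl
        rw [permGL_apply, if_neg, zero_mul]
        rintro rfl
        exact hl (hττ l).symm
      · simp
  have hd₁r : d₁ r ≠ 0 := by simpa [d₁, τ] using hi₀
  have hd₁ : ∀ i, ¬ i < c → d₁ i = 0 := fun i hi => hd _ (by rwa [hτ])
  -- clear the other coordinates
  let N : Matrix (Fin n) (Fin n) F := Matrix.of fun i j => if i = r ∧ j < r then d₁ j / d₁ r else 0
  have hN : N * N = 0 := by
    ext i j
    rw [Matrix.mul_apply]
    refine Finset.sum_eq_zero fun l _ => ?_
    by_cases h : l = r
    · simp [N, h]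
    · simp [N, h]
  have hg₂ : TrivialRows (c : ℕ) (oneAddGL N hN) := by
    intro i j hi
    rw [coe_oneAddGL, Matrix.add_apply, Matrix.one_apply]
    have hir' : i ≠ r := by rintro rfl; omega
    simp [N, hir']
  refine ⟨act R (oneAddGL N hN) (act R (permGL n F τ) z), act_ne_zero _ (act_ne_zero _ hz0),
    (hz.act hg₁).act hg₂, d₁ r, fun v => ?_⟩
  -- The vector v' solves g v' = v for the elementary matrix g: its coordinate r is lowered by S.
  -- This correction cancels all other terms of the functional and leaves d₁ r times the coordinate
  -- r of v.
  let S : F := ∑ l, if l < r then d₁ l / d₁ r * v l else 0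
  rw [act_colU_act hg₂ hz₁ (v' := fun i => if i = r then v r - S else v i)]
  · congr 2
    rw [superdiag_of_step _ hrc, colU_apply, if_neg hrc'.ne, if_pos ⟨rfl, hrc'⟩, zero_add]
    have h1 : ∀ i, d₁ i * (if i = r then v r - S else v i) =
        (if i = r then d₁ r * (v r - S) else 0) + d₁ r * (if i < r then d₁ i / d₁ r * v i else 0) := by
      intro i
      rcases lt_trichotomy i r with h | h | h
      · rw [if_neg h.ne, if_neg h.ne, if_pos h]; field_simp; ring
      · rw [if_pos h, if_pos h, if_neg h.not_lt, h]; ring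
      · rw [if_neg h.ne', if_neg h.ne', if_neg (not_lt.2 h.le), hd₁ i (by
          rw [Fin.lt_def] at *; omega)]
        ring
    simp only [h1]
    rw [Finset.sum_add_distrib, Finset.sum_ite_eq' Finset.univ r, if_pos (Finset.mem_univ _),
      ← Finset.mul_sum]
    simp only [S]
    ring
  · intro i hi
    simp only [coe_oneAddGL, Matrix.add_apply, add_mul, Finset.sum_add_distrib]
    have h1 : ∑ l, (1 : Matrix (Fin n) (Fin n) F) i l *
        (if l < c then (if l = r then v r - S else v l) else 0) =
        if i = r then v r - S else v i := by
      rw [Finset.sum_eq_single i]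
      · rw [Matrix.one_apply_eq, one_mul, if_pos hi]
      · intro l _ hl
        rw [Matrix.one_apply_ne hl.symm, zero_mul]
      · simp
    rw [h1]
    by_cases hir : i = r
    · subst hir
      rw [if_pos rfl]
      have h2 : ∀ l, N r l * (if l < c then (if l = r then v r - S else v l) else 0) =
          if l < r then d₁ l / d₁ r * v l else 0 := by
        intro l
        simp only [N, Matrix.of_apply, true_and]
        by_cases hl : l < r
        · rw [if_pos hl, if_pos (hl.trans hrc'), if_neg hl.ne, if_pos hl]
        · rw [if_neg hl, if_neg hl, zero_mul]
      simp only [h2]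
      simp only [S]
      ring
    · rw [if_neg hir, Finset.sum_eq_zero, add_zero]
      intro l _
      simp [N, hir]

/-- Here m counts the columns already treated, from the right. The next column group is
diagonalised, and its character is moved to the last coordinate by matrices that preserve the
eigenvector condition for the later columns. -/
theorem exists_columnEigen [IsDomain R] [Nontrivial M] {ψ : AddChar F R} (hψ : ψ.IsPrimitive)
    (hq : IsUnit (Fintype.card F : R)) (m : ℕ) :
    ∀ k, k + m = n → ∃ y : M, y ≠ 0 ∧ ∃ a : Fin n → F, IsColumnEigen ψ k a y := by
  induction m with
  | zero =>
    intro k hk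
    obtain ⟨y, hy⟩ := exists_ne (0 : M)
    refine ⟨y, hy, 0, fun u _ hu => ?_⟩
    have : u = 1 := by
      apply Units.ext
      ext i j
      rw [hu i j (by omega)]
      simp [Matrix.one_apply]
    rw [this, act_one]
    simp
  | succ m ih =>
    intro k hk
    obtain ⟨y, hy0, a, hy⟩ := ih (k + 1) (by omega)
    let c : Fin n := ⟨k, by omega⟩
    obtain ⟨z, hz0, hz, d, hd, hzd⟩ :=
      IsColumnEigen.exists_colU_eigen (c := c) hψ hq hy0 hy
    obtain ⟨x, hx0, hx, s, hxs⟩ := exists_colU_eigen_superdiag hz0 hz hd hzd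
    -- The old coefficient at c played no role, since column c was trivial in the smaller group.
    refine ⟨x, hx0, Function.update a c s, fun u hu hu' => ?_⟩
    have hua := mem_unitriangular.1 hu
    let v : Fin n → F := fun i => u i c
    have hmul : u = colU c v * (colU c (-v) * u : GL (Fin n) F) := by
      rw [← mul_assoc, ← Subgroup.coe_mul, ← colU_add, add_neg_cancel, colU_zero,
        Subgroup.coe_one, one_mul]
    have hmem : (colU c (-v) * u : GL (Fin n) F) ∈ unitriangular n F := mul_mem (colU c (-v)).2 hu
    have hcol : TrivialColumns (k + 1) (colU c (-v) * u : GL (Fin n) F) := by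
      intro i j hj
      rw [colU_mul_apply]
      rcases Nat.lt_succ_iff_lt_or_eq.1 hj with hj | hj
      · rw [hu' i j hj, hu' c j hj, if_neg (show c ≠ j by rintro rfl; simp [c] at hj)]
        simp
      · have hjc : j = c := Fin.ext hj
        subst hjc
        rw [hua.2 c]
        rcases lt_trichotomy i c with h | h | h
        · rw [if_pos h, if_neg h.ne]; simp [v]
        · rw [h, hua.2 c]; simp
        · rw [hua.1 i c h, if_neg (not_lt.2 h.le), if_neg h.ne', add_zero]
    have hact : act R u x = act R (colU c v : GL (Fin n) F)
        (act R (colU c (-v) * u : GL (Fin n) F) x) := by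
      rw [← act_mul, ← hmul]
    rw [hact, hx _ hmem hcol, map_smul, hxs, smul_smul, ← AddChar.map_add_eq_mul]
    congr 2
    have hsd : ∀ j : Fin n, superdiag u j = superdiag (colU c v : GL (Fin n) F) j +
          superdiag (colU c (-v) * u : GL (Fin n) F) j := by
      intro j
      conv_lhs => rw [hmul]
      exact superdiag_mul (colU c v) ⟨_, hmem⟩ j
    have hc0 : superdiag (colU c (-v) * u : GL (Fin n) F) c = 0 := by
      rcases exists_step_or c with h0 | ⟨i, hi⟩
      · exact superdiag_eq_zero _ h0
      · rw [superdiag_of_step _ hi, hcol i c (by simp [c]), if_neg]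
        rintro rfl
        omega
    have hj0 : ∀ j, j ≠ c → superdiag (colU c v : GL (Fin n) F) j = 0 := by
      intro j hj
      rcases exists_step_or j with h0 | ⟨i, hi⟩
      · exact superdiag_eq_zero _ h0
      · rw [superdiag_of_step _ hi, colU_apply, if_neg (by rintro rfl; omega),
          if_neg (fun h => hj h.1), add_zero]
    have hterm : ∀ j, Function.update a c s j * superdiag u j =
        a j * superdiag (colU c (-v) * u : GL (Fin n) F) j +
          if j = c then s * superdiag (colU c v : GL (Fin n) F) c else 0 := by
      intro j
      rw [hsd]
      by_cases hj : j = c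
      · rw [hj, Function.update_self, hc0, if_pos rfl]; ring
      · rw [Function.update_of_ne hj, hj0 j hj, if_neg hj]; ring
    simp only [hterm, Finset.sum_add_distrib, Finset.sum_ite_eq', Finset.mem_univ, if_true]

/-- Every nonzero module contains an eigenvector for `U`. -/
theorem exists_eigenvector [IsDomain R] [Nontrivial M] {ψ : AddChar F R} (hψ : ψ.IsPrimitive)
    (hq : IsUnit (Fintype.card F : R)) :
    ∃ y : M, y ≠ 0 ∧ ∃ a : Fin n → F, ∀ u : unitriangular n F,
      MonoidAlgebra.single (u : GL (Fin n) F) (1 : R) • y = ((linChar ψ a u : Rˣ) : R) • y := by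
  obtain ⟨y, hy0, a, hy⟩ := exists_columnEigen (M := M) (n := n) hψ hq n 0 (by omega)
  exact ⟨y, hy0, a, fun u => hy u u.2 fun _ _ h => absurd h (Nat.not_lt_zero _)⟩

end Eigenvectors

/-! ### Divisibility by ℓ in the local ring -/

section LocalRing

variable {R : Type*} [CommRing R] [IsLocalRing R] {ℓ : ℕ}

theorem isUnit_or_dvd (hR : IsLocalRing.maximalIdeal R = Ideal.span {(ℓ : R)}) (r : R) :
    IsUnit r ∨ (ℓ : R) ∣ r := by
  by_cases h : IsUnit r
  · exact Or.inl h
  · right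
    rw [← Ideal.mem_span_singleton, ← hR]
    exact (IsLocalRing.mem_maximalIdeal r).2 h

theorem not_isUnit_of_dvd (hR : IsLocalRing.maximalIdeal R = Ideal.span {(ℓ : R)}) {r : R}
    (h : (ℓ : R) ∣ r) : ¬ IsUnit r := by
  rw [← mem_nonunits_iff, ← IsLocalRing.mem_maximalIdeal, hR]
  exact Ideal.mem_span_singleton.2 h

theorem isUnit_of_dvd_sub (hR : IsLocalRing.maximalIdeal R = Ideal.span {(ℓ : R)}) {r s : R}
    (h : (ℓ : R) ∣ r - s) (hr : IsUnit r) : IsUnit s := by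
  refine (isUnit_or_dvd hR s).resolve_right fun hs => not_isUnit_of_dvd hR ?_ hr
  have := dvd_add h hs
  rwa [sub_add_cancel] at this

variable [Fact ℓ.Prime]

theorem isUnit_natCast (hR : IsLocalRing.maximalIdeal R = Ideal.span {(ℓ : R)}) {N : ℕ}
    (h : ¬ ℓ ∣ N) : IsUnit (N : R) := by
  refine (isUnit_or_dvd hR _).resolve_right fun hN => not_isUnit_of_dvd hR ?_ isUnit_one
  have hc : Nat.Coprime ℓ N := (Nat.Prime.coprime_iff_not_dvd Fact.out).2 h
  have hb := congrArg (Int.cast : ℤ → R) (Nat.gcd_eq_gcd_ab ℓ N)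
  rw [hc.gcd_eq_one] at hb
  push_cast at hb
  rw [hb]
  exact dvd_add (Dvd.intro _ rfl) (hN.mul_right _)

theorem exists_natCast_eq (hR : IsLocalRing.maximalIdeal R = Ideal.span {(ℓ : R)}) {N : ℕ}
    (hN : N ≠ 0) : ∃ m : R, IsUnit m ∧ (N : R) = (ℓ : R) ^ padicValNat ℓ N * m := by
  obtain ⟨m, hm⟩ := pow_padicValNat_dvd (p := ℓ) (n := N)
  refine ⟨m, isUnit_natCast hR fun h => ?_, ?_⟩
  · obtain ⟨m', rfl⟩ := h
    exact pow_succ_padicValNat_not_dvd (p := ℓ) hN ⟨m', by rw [pow_succ, mul_assoc]; exact hm⟩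
  · conv_lhs => rw [hm]
    push_cast
    rfl

variable [CharZero R]

omit [IsLocalRing R] in
theorem natCast_prime_ne_zero : (ℓ : R) ≠ 0 :=
  Nat.cast_ne_zero.2 (Nat.Prime.ne_zero Fact.out)

variable [IsDomain R]

theorem pow_dvd_natCast_iff (hR : IsLocalRing.maximalIdeal R = Ideal.span {(ℓ : R)}) {N : ℕ}
    (hN : N ≠ 0) (k : ℕ) : (ℓ : R) ^ k ∣ (N : R) ↔ k ≤ padicValNat ℓ N := by
  obtain ⟨m, hm, h⟩ := exists_natCast_eq hR hN
  rw [h]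
  constructor
  · intro hdvd
    by_contra! hk
    have h1 := (pow_dvd_pow (ℓ : R) (Nat.succ_le_of_lt hk)).trans hdvd
    rw [pow_succ, mul_dvd_mul_iff_left (pow_ne_zero _ natCast_prime_ne_zero)] at h1
    exact not_isUnit_of_dvd hR h1 hm
  · exact fun hk => (pow_dvd_pow _ hk).mul_right _

/-- Coefficients exchanged by numbers of equal valuation are simultaneously units. -/
theorem isUnit_of_mul_natCast_eq (hR : IsLocalRing.maximalIdeal R = Ideal.span {(ℓ : R)})
    {N N' : ℕ} (hN : N ≠ 0) (hN' : N' ≠ 0) (hv : padicValNat ℓ N = padicValNat ℓ N') {c c' : R}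
    (h : c' * (N : R) = c * (N' : R)) (hc : IsUnit c) : IsUnit c' := by
  obtain ⟨m, hm, e⟩ := exists_natCast_eq hR hN
  obtain ⟨m', hm', e'⟩ := exists_natCast_eq hR hN'
  rw [e, e', hv] at h
  have h1 : c' * m = c * m' := by
    apply mul_left_cancel₀ (pow_ne_zero (padicValNat ℓ N') (natCast_prime_ne_zero (R := R) (ℓ := ℓ)))
    linear_combination h
  exact isUnit_of_mul_isUnit_left (h1 ▸ hc.mul hm')

end LocalRing

/-! ### The vectors F_λ in L and their place in the filtration -/

section Reduction

variable {n : ℕ} {F : Type*} [Field F] [Fintype F] {R : Type*} [CommRing R] {ℓ : ℕ}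

omit [Fintype F] in
theorem mem_lMultiples {x : lattice n F R} :
    x ∈ lMultiples n F R ℓ ↔ ∃ y : lattice n F R, (ℓ : R) • y = x := by
  rw [lMultiples, LinearMap.mem_range]
  refine exists_congr fun y => ?_
  rw [LinearMap.smul_apply, LinearMap.id_apply, Nat.cast_smul_eq_nsmul]

omit [Fintype F] in
theorem smul_reduction_eq_zero {c : R} (hc : (ℓ : R) ∣ c) (x : Reduction n F R ℓ) : c • x = 0 := by
  obtain ⟨c, rfl⟩ := hc
  obtain ⟨y, rfl⟩ := (lMultiples n F R ℓ).mkQ_surjective x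
  rw [mul_smul]
  exact (Submodule.Quotient.mk_eq_zero _).2 (mem_lMultiples.2 ⟨c • y, rfl⟩)

/-- Compare values at w₀, where E_λ takes a sign. -/
theorem smul_redCharVector_eq_zero {χ : unitriangular n F →* Rˣ} {c : R}
    (h : c • redCharVector ℓ χ = 0) : (ℓ : R) ∣ c := by
  have h1 : c • charVector χ ∈ lMultiples n F R ℓ := (Submodule.Quotient.mk_eq_zero _).1 h
  obtain ⟨y, hy⟩ := mem_lMultiples.1 h1
  have h2 := congrArg (fun x : lattice n F R =>
    (x : GroupAlg n F R).coeff (permGL n F Fin.revPerm)) hy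
  have h3 : (ℓ : R) * (y : GroupAlg n F R).coeff (permGL n F Fin.revPerm) =
      c * (charVector χ : GroupAlg n F R).coeff (permGL n F Fin.revPerm) := h2
  rw [coeff_charVector_revPerm] at h3
  exact (isUnit_sign (R := R) (Fin.revPerm : Equiv.Perm (Fin n))).dvd_mul_right.1 ⟨_, h3.symm⟩

theorem charSum_smul_redCharVector (χ : unitriangular n F →* Rˣ) :
    charSum χ • redCharVector ℓ χ = (Nat.card (unitriangular n F) : R) • redCharVector ℓ χ :=
  congrArg (lMultiples n F R ℓ).mkQ (charSum_smul_charVector χ)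

theorem exists_charSum_smul_reduction_eq (χ : unitriangular n F →* Rˣ) (x : Reduction n F R ℓ) :
    ∃ c : R, charSum χ • x = c • redCharVector ℓ χ := by
  obtain ⟨y, rfl⟩ := (lMultiples n F R ℓ).mkQ_surjective x
  obtain ⟨c, hc⟩ := exists_charSum_smul_eq χ y
  exact ⟨c, congrArg (lMultiples n F R ℓ).mkQ hc⟩

omit [Fintype F] in
theorem smul_mem_iff_of_isUnit {A M : Type*} [Ring A] [Algebra R A] [AddCommGroup M] [Module R M]
    [Module A M] [IsScalarTower R A M] (N : Submodule A M) {c : R} (hc : IsUnit c) {x : M} :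
    c • x ∈ N ↔ x ∈ N := by
  obtain ⟨c, rfl⟩ := hc
  refine ⟨fun h => ?_, fun h => N.smul_of_tower_mem _ h⟩
  have := N.smul_of_tower_mem ((c⁻¹ : Rˣ) : R) h
  rwa [smul_smul, Units.inv_mul, one_smul] at this

theorem redCharVector_mem {N : Submodule (GroupAlg n F R) (Reduction n F R ℓ)}
    {χ : unitriangular n F →* Rˣ} {x : Reduction n F R ℓ} (hx : x ∈ N) {c : R} (hc : IsUnit c)
    (h : charSum χ • x = c • redCharVector ℓ χ) : redCharVector ℓ χ ∈ N := by
  rw [← smul_mem_iff_of_isUnit N hc, ← h]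
  exact N.smul_mem _ hx

omit [Fintype F] in
theorem charNorm_ne_zero [Finite F] (χ : unitriangular n F →* Rˣ) : charNorm χ ≠ 0 := by
  classical
  rw [charNorm]
  refine (Finset.sum_pos (fun σ _ => Nat.card_pos) ⟨Fin.revPerm, ?_⟩).ne'
  rw [Finset.mem_filter]
  refine ⟨Finset.mem_univ _, fun u hu => ?_⟩
  rw [show u = 1 from Subtype.ext (eq_one_of_mem_cellStab_revPerm hu), map_one]

variable [IsLocalRing R] [Fact ℓ.Prime]

omit [Fintype F] in
theorem isUnit_card_unitriangular [Finite F]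
    (hR : IsLocalRing.maximalIdeal R = Ideal.span {(ℓ : R)}) (hℓ : ¬ ℓ ∣ Nat.card F) :
    IsUnit (Nat.card (unitriangular n F) : R) := by
  rw [card_unitriangular, Nat.cast_pow]
  exact (isUnit_natCast hR hℓ).pow _

/-- The character sum acts on F_μ as the unit |U| and also as c, so c ≡ |U| modulo ℓ. -/
theorem isUnit_of_redCharVector_eq_smul
    (hR : IsLocalRing.maximalIdeal R = Ideal.span {(ℓ : R)}) (hℓ : ¬ ℓ ∣ Nat.card F)
    {χ μ : unitriangular n F →* Rˣ} {a : GroupAlg n F R} {c : R}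
    (h : a • redCharVector ℓ χ = redCharVector ℓ μ)
    (hc : charSum μ • (a • charVector χ) = c • charVector μ) : IsUnit c := by
  have h1 : charSum μ • (a • redCharVector ℓ χ) = c • redCharVector ℓ μ :=
    congrArg (lMultiples n F R ℓ).mkQ hc
  rw [h, charSum_smul_redCharVector, ← sub_eq_zero, ← sub_smul] at h1
  exact isUnit_of_dvd_sub hR (smul_redCharVector_eq_zero h1) (isUnit_card_unitriangular hR hℓ)

variable [IsDomain R] [CharZero R]

/-- Transitions between characters whose norms have equal valuation can be reversed. -/
theorem redCharVector_mem_span_symm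
    (hR : IsLocalRing.maximalIdeal R = Ideal.span {(ℓ : R)}) (hℓ : ¬ ℓ ∣ Nat.card F)
    {χ μ : unitriangular n F →* Rˣ}
    (hv : padicValNat ℓ (charNorm χ) = padicValNat ℓ (charNorm μ))
    (h : redCharVector ℓ μ ∈ Submodule.span (GroupAlg n F R) {redCharVector ℓ χ}) :
    redCharVector ℓ χ⁻¹ ∈ Submodule.span (GroupAlg n F R) {redCharVector ℓ μ⁻¹} := by
  obtain ⟨a, ha⟩ := Submodule.mem_span_singleton.1 h
  obtain ⟨c, hc⟩ := exists_charSum_smul_eq μ (a • charVector χ)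
  have hcu := isUnit_of_redCharVector_eq_smul hR hℓ ha hc
  obtain ⟨a', c', hc', hcc⟩ := exists_adjoint_coefficients χ μ a hc
  have hcu' : IsUnit c' :=
    isUnit_of_mul_natCast_eq hR (charNorm_ne_zero χ) (charNorm_ne_zero μ) hv hcc hcu
  exact redCharVector_mem (x := a' • redCharVector ℓ μ⁻¹)
    (Submodule.smul_mem _ _ (Submodule.mem_span_singleton_self _)) hcu'
    (congrArg (lMultiples n F R ℓ).mkQ hc')

omit [IsLocalRing R] [Fact ℓ.Prime] in
theorem latticeForm_eq {x y : lattice n F R} {t : R}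
    (h : pairing (x : GroupAlg n F R) (y : GroupAlg n F R) = (Nat.card (borel n F) : R) * t) :
    latticeForm x y = algebraMap R (FractionRing R) t := by
  have hB : (Nat.card (borel n F) : FractionRing R) ≠ 0 := Nat.cast_ne_zero.2 Nat.card_pos.ne'
  rw [latticeForm, h, map_mul, map_natCast, inv_mul_cancel_left₀ hB]

omit [IsLocalRing R] [Fact ℓ.Prime] in
theorem charVector_mem_latticeFiltration_iff (χ : unitriangular n F →* Rˣ) (k : ℕ) :
    charVector χ ∈ latticeFiltration n F R ℓ k ↔ (ℓ : R) ^ k ∣ (charNorm χ : R) := by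
  constructor
  · intro h
    obtain ⟨r, hr⟩ := h (latticeGen n F R)
    have h1 : charSum χ⁻¹ • latticeGen n F R = (1 : R) • charVector χ⁻¹ := by
      rw [one_smul, charVector_eq_smul]
    rw [latticeForm_eq (pairing_charVector χ h1), one_mul] at hr
    exact ⟨r, IsFractionRing.injective R (FractionRing R) hr⟩
  · rintro ⟨m, hm⟩ y
    obtain ⟨c, hc⟩ := exists_charSum_smul_eq χ⁻¹ y
    refine ⟨c * m, ?_⟩
    rw [latticeForm_eq (pairing_charVector χ hc), hm]
    congr 1
    ring

/-- Membership in L only says that E_λ + ℓy lies in I(k) for some y. Applying the character sum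
turns this element into a unit multiple of E_λ, so E_λ itself lies in I(k), and the form decides. -/
theorem redCharVector_mem_filtration_iff
    (hR : IsLocalRing.maximalIdeal R = Ideal.span {(ℓ : R)}) (hℓ : ¬ ℓ ∣ Nat.card F)
    (χ : unitriangular n F →* Rˣ) (k : ℕ) :
    redCharVector ℓ χ ∈ filtration n F R ℓ k ↔ k ≤ padicValNat ℓ (charNorm χ) := by
  rw [← pow_dvd_natCast_iff hR (charNorm_ne_zero χ), ← charVector_mem_latticeFiltration_iff]
  refine ⟨?_, fun h => Submodule.mem_map_of_mem h⟩
  rintro ⟨x, hx, hxχ⟩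
  obtain ⟨y, hy⟩ := mem_lMultiples.1 ((Submodule.Quotient.eq _).1 hxχ)
  obtain ⟨c, hc⟩ := exists_charSum_smul_eq χ y
  have hx' : x = charVector χ + (ℓ : R) • y := by rw [hy]; abel
  have h1 : charSum χ • x = ((Nat.card (unitriangular n F) : R) + ℓ * c) • charVector χ := by
    rw [hx', smul_add, charSum_smul_charVector, smul_comm, hc, smul_smul, add_smul]
  have hu : IsUnit ((Nat.card (unitriangular n F) : R) + ℓ * c) := by
    refine isUnit_of_dvd_sub hR (r := (Nat.card (unitriangular n F) : R)) ⟨-c, by ring⟩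
      (isUnit_card_unitriangular hR hℓ)
  rw [← smul_mem_iff_of_isUnit _ hu, ← h1]
  exact Submodule.smul_mem _ _ hx

omit [CharZero R] in
/-- Submodules of the reduction are told apart by the vectors `F_λ`. -/
theorem exists_redCharVector_mem_not_mem
    (hR : IsLocalRing.maximalIdeal R = Ideal.span {(ℓ : R)}) (hℓ : ¬ ℓ ∣ Nat.card F)
    {ψ : AddChar F R} (hψ : ψ.IsPrimitive)
    {N M : Submodule (GroupAlg n F R) (Reduction n F R ℓ)} (h : N < M) :
    ∃ a : Fin n → F, redCharVector ℓ (linChar ψ a) ∈ M ∧ redCharVector ℓ (linChar ψ a) ∉ N := by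
  have hnt : Nontrivial (M ⧸ N.submoduleOf M) := by
    rw [Submodule.Quotient.nontrivial_iff, ne_eq, Submodule.submoduleOf_eq_top]
    exact not_le_of_gt h
  have hq : IsUnit (Fintype.card F : R) := by
    rw [← Nat.card_eq_fintype_card]
    exact isUnit_natCast hR hℓ
  obtain ⟨y, hy0, a, hy⟩ := exists_eigenvector (n := n) (M := M ⧸ N.submoduleOf M) hψ hq
  obtain ⟨x, rfl⟩ := (N.submoduleOf M).mkQ_surjective y
  set χ := linChar ψ a with hχ
  have hU := isUnit_card_unitriangular (n := n) hR hℓ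
  have hxN : (x : Reduction n F R ℓ) ∉ N := fun hx =>
    hy0 ((Submodule.Quotient.mk_eq_zero _).2 (show x ∈ N.submoduleOf M from hx))
  -- With the weights λ(u)u, the character sum of χ⁻¹ is the projection onto χ-eigenvectors, up to
  -- the unit |U|; hence the final vector has coefficients -a.
  have hsum : charSum χ⁻¹ • (N.submoduleOf M).mkQ x =
      (Nat.card (unitriangular n F) : R) • (N.submoduleOf M).mkQ x := by
    have h1 : ∀ u : unitriangular n F,
        (MonoidAlgebra.single (u : GL (Fin n) F) (((χ⁻¹ u : Rˣ)) : R) : GroupAlg n F R) •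
          (N.submoduleOf M).mkQ x = (N.submoduleOf M).mkQ x := by
      intro u
      have h2 : (MonoidAlgebra.single (u : GL (Fin n) F) (((χ⁻¹ u : Rˣ)) : R) : GroupAlg n F R) =
          ((χ⁻¹ u : Rˣ) : R) • MonoidAlgebra.single (u : GL (Fin n) F) (1 : R) := by
        rw [MonoidAlgebra.smul_single, smul_eq_mul, mul_one]
      rw [h2, smul_assoc, hy u, smul_smul, MonoidHom.inv_apply, Units.inv_mul, one_smul]
    rw [charSum, Finset.sum_smul, Finset.sum_congr rfl fun u _ => h1 u, Finset.sum_const,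
      Finset.card_univ, Nat.card_eq_fintype_card, Nat.cast_smul_eq_nsmul]
  have hdiff : charSum χ⁻¹ • (x : Reduction n F R ℓ) -
      (Nat.card (unitriangular n F) : R) • (x : Reduction n F R ℓ) ∈ N :=
    (Submodule.Quotient.eq (N.submoduleOf M)).1 hsum
  have hnot : charSum χ⁻¹ • (x : Reduction n F R ℓ) ∉ N := by
    intro h1
    apply hxN
    rw [← smul_mem_iff_of_isUnit N hU]
    have := N.sub_mem h1 hdiff
    rwa [sub_sub_cancel] at this
  obtain ⟨c, hc⟩ := exists_charSum_smul_reduction_eq χ⁻¹ (x : Reduction n F R ℓ)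
  have hcu : IsUnit c := by
    -- A coefficient divisible by ℓ would kill the projected vector, which is not in N.
    refine (isUnit_or_dvd hR c).resolve_right fun hdvd => hnot ?_
    rw [hc, smul_reduction_eq_zero hdvd]
    exact N.zero_mem
  refine ⟨-a, ?_, ?_⟩
  · rw [← linChar_inv]
    exact redCharVector_mem x.2 hcu hc
  · rw [← linChar_inv]
    intro hmem
    apply hnot
    rw [hc]
    exact N.smul_of_tower_mem _ hmem

end Reduction

/-! ### Block reversals, and permutations carrying links to links -/

section Blocks

variable {n : ℕ} {F : Type*} [Field F]

/-- The longest element of the Young subgroup, obtained by comparing w₀ with the block-increasing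
representative of its coset. -/
theorem exists_blockReversal {b : Fin n → ℕ} (hb : Monotone b) : ∃ π : Equiv.Perm (Fin n),
    (∀ k, b (π k) = b k) ∧ ∀ i j, i < j → b i = b j → π⁻¹ j < π⁻¹ i := by
  obtain ⟨σ, hσ, h⟩ := exists_increasingOn b Fin.revPerm
  refine ⟨σ⁻¹ * Fin.revPerm, fun k => ?_, fun i j hij hbij => ?_⟩
  · rw [Equiv.Perm.mul_apply, h, Fin.revPerm_apply, Fin.revPerm_apply, Fin.rev_rev]
  · have hinv : (Fin.revPerm : Equiv.Perm (Fin n))⁻¹ = Fin.revPerm := by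
      rw [Equiv.Perm.inv_def]; exact Fin.revPerm_symm
    rw [mul_inv_rev, inv_inv, hinv, Equiv.Perm.mul_apply, Equiv.Perm.mul_apply,
      Fin.revPerm_apply, Fin.revPerm_apply]
    exact Fin.rev_lt_rev.2 (hσ.lt hb hij hbij)

/-- The block diagonal part of a unitriangular matrix. -/
def blockDiagPart (b : Fin n → ℕ) (u : unitriangular n F) : unitriangular n F :=
  ⟨unitriangularGL (Matrix.of fun i j => if b i = b j then (u : GL (Fin n) F) i j else 0)
    (fun i j h => by simp [(mem_unitriangular.1 u.2).1 i j h])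
    (fun i => by simp [(mem_unitriangular.1 u.2).2 i]),
   mem_unitriangular.2 ⟨fun i j h => by simp [(mem_unitriangular.1 u.2).1 i j h],
    fun i => by simp [(mem_unitriangular.1 u.2).2 i]⟩⟩

theorem blockDiagPart_apply (b : Fin n → ℕ) (u : unitriangular n F) (i j : Fin n) :
    (blockDiagPart b u : GL (Fin n) F) i j = if b i = b j then (u : GL (Fin n) F) i j else 0 := rfl

theorem blockDiagPart_inv_mul_apply {b : Fin n → ℕ} (hb : Monotone b) (u : unitriangular n F)
    {i j : Fin n} (hij : b i = b j) :
    (((blockDiagPart b u)⁻¹ * u : unitriangular n F) : GL (Fin n) F) i j =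
      if i = j then 1 else 0 := by
  have h1 : (((blockDiagPart b u)⁻¹ * u : unitriangular n F) : GL (Fin n) F) i j =
      (((blockDiagPart b u)⁻¹ * blockDiagPart b u : unitriangular n F) : GL (Fin n) F) i j := by
    rw [Subgroup.coe_mul, Subgroup.coe_mul, Matrix.GeneralLinearGroup.coe_mul,
      Matrix.GeneralLinearGroup.coe_mul, Matrix.mul_apply, Matrix.mul_apply]
    refine Finset.sum_congr rfl fun k _ => ?_
    rw [blockDiagPart_apply]
    rcases lt_trichotomy (b k) (b j) with h | h | h
    · have hki : k < i := by
        by_contra! hik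
        exact absurd (hb hik) (by omega)
      rw [(mem_unitriangular.1 ((blockDiagPart b u)⁻¹).2).1 i k hki, zero_mul, zero_mul]
    · rw [if_pos h]
    · have hjk : j < k := by
        by_contra! hkj
        exact absurd (hb hkj) (by omega)
      rw [if_neg h.ne', (mem_unitriangular.1 u.2).1 k j hjk]
  rw [h1, inv_mul_cancel, Subgroup.coe_one, Units.val_one, Matrix.one_apply]

/-- After removal of the block diagonal part the diagonal blocks are identities, and a permutation
preserving the blocks keeps the rest above them. -/
theorem conj_blockDiagPart_inv_mul_mem {b : Fin n → ℕ} (hb : Monotone b) (u : unitriangular n F)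
    {π : Equiv.Perm (Fin n)} (hπ : ∀ k, b (π k) = b k) :
    (permGL n F π)⁻¹ * (((blockDiagPart b u)⁻¹ * u : unitriangular n F) : GL (Fin n) F) *
      permGL n F π ∈ borel n F := by
  rw [mem_borel]
  intro i j hij
  rw [permGL_conj_apply]
  rcases (hb hij.le).eq_or_lt with h | h
  · rw [blockDiagPart_inv_mul_apply hb u (by rw [hπ, hπ, h]), if_neg]
    exact fun h' => hij.ne' (π.injective h')
  · refine (mem_unitriangular.1 (Subtype.mem _)).1 _ _ ?_
    by_contra! hle
    have := hb hle
    rw [hπ, hπ] at this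
    omega

open scoped Classical in
/-- The indicator of the simple roots inside the blocks of a labelling. -/
noncomputable def linkVec (F : Type*) [Field F] (b : Fin n → ℕ) : Fin n → F :=
  fun j => if ∃ i : Fin n, (i : ℕ) + 1 = j ∧ b i = b j then 1 else 0

theorem linkVec_of_step {b : Fin n → ℕ} {i j : Fin n} (hij : (i : ℕ) + 1 = j) [Decidable (b i = b j)] :
    linkVec F b j = if b i = b j then 1 else 0 := by
  rw [linkVec]
  refine if_congr ⟨?_, fun h => ⟨i, hij, h⟩⟩ rfl rfl
  rintro ⟨i', hi', h⟩
  rwa [show i = i' from Fin.ext (by omega)]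

theorem linkVec_ne_zero_iff {b : Fin n → ℕ} {i j : Fin n} (hij : (i : ℕ) + 1 = j) :
    linkVec F b j ≠ 0 ↔ b i = b j := by
  rw [linkVec_of_step hij]
  split_ifs with h <;> simp [h]

variable {b b' : Fin n → ℕ} {w : Equiv.Perm (Fin n)}

/-- The permutation `w` carries the simple roots inside the blocks of `b` to simple roots inside
the blocks of `b'`. -/
def CarriesLinks (b b' : Fin n → ℕ) (w : Equiv.Perm (Fin n)) : Prop :=
  ∀ i j : Fin n, (i : ℕ) + 1 = j → b i = b j → (w i : ℕ) + 1 = w j ∧ b' (w i) = b' (w j)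

theorem CarriesLinks.increasingOn (h : CarriesLinks b b' w) : IncreasingOn b w := by
  intro i j hij hb
  rw [Fin.lt_def]
  have := (h i j hij hb).1
  omega

theorem CarriesLinks.conj_mem_unitriangular (h : CarriesLinks b b' w) (hb : Monotone b)
    (u : unitriangular n F) :
    (permGL n F w⁻¹)⁻¹ * (blockDiagPart b u : GL (Fin n) F) * permGL n F w⁻¹ ∈
      unitriangular n F := by
  rw [mem_unitriangular]
  refine ⟨fun i j hij => ?_, fun i => ?_⟩
  · rw [permGL_conj_apply, blockDiagPart_apply]
    split_ifs with hbl
    · refine (mem_unitriangular.1 u.2).1 _ _ ?_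
      by_contra! hle
      rcases hle.eq_or_lt with heq | hlt
      · exact hij.ne' (w⁻¹.injective heq)
      · have := h.increasingOn.lt hb hlt hbl
        rw [perm_apply_inv_self, perm_apply_inv_self] at this
        exact lt_asymm hij this
    · rfl
  · rw [permGL_conj_apply]
    exact (mem_unitriangular.1 (blockDiagPart b u).2).2 _

/-- Each linked superdiagonal entry of u moves to a linked one. Any other superdiagonal entry of the
conjugate either has coefficient irrelevant because it vanishes, or would come from a linked pair.
-/
theorem CarriesLinks.linChar_conj {R : Type*} [CommRing R] (h : CarriesLinks b b' w)
    (hb : Monotone b) (ψ : AddChar F R) (u : unitriangular n F) :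
    linChar ψ (linkVec F b') ⟨_, h.conj_mem_unitriangular hb u⟩ = linChar ψ (linkVec F b) u := by
  apply Units.ext
  rw [coe_linChar, coe_linChar]
  congr 1
  rw [← Equiv.sum_comp w]
  refine Finset.sum_congr rfl fun j _ => ?_
  by_cases hj : ∃ i : Fin n, (i : ℕ) + 1 = j ∧ b i = b j
  · obtain ⟨i, hij, hbij⟩ := hj
    obtain ⟨hw, hbw⟩ := h i j hij hbij
    rw [linkVec_of_step hij, linkVec_of_step hw, if_pos hbij, if_pos hbw, superdiag_of_step _ hw,
      superdiag_of_step _ hij, permGL_conj_apply, perm_inv_apply_self, perm_inv_apply_self,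
      blockDiagPart_apply, if_pos hbij]
  · have h0 : linkVec F b j = 0 := if_neg hj
    rw [h0, zero_mul]
    rcases exists_step_or (w j) with hw | ⟨k, hk⟩
    · rw [superdiag_eq_zero _ hw, mul_zero]
    · rw [superdiag_of_step _ hk, permGL_conj_apply, perm_inv_apply_self, blockDiagPart_apply,
        if_neg, mul_zero]
      intro hbl
      apply hj
      have hlt : w⁻¹ k < j := by
        by_contra! hle
        rcases hle.eq_or_lt with heq | hlt
        · rw [heq, perm_apply_inv_self] at hk
          omega
        · have := h.increasingOn.lt hb hlt hbl.symm
          rw [perm_apply_inv_self, Fin.lt_def] at this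
          omega
      rw [Fin.lt_def] at hlt
      -- The indices w⁻¹ k < j share a block, so j - 1, which lies between them, belongs to it too.
      refine ⟨⟨(j : ℕ) - 1, by omega⟩, by simp only; omega, le_antisymm ?_ ?_⟩
      · exact hb (by rw [Fin.le_def]; simp)
      · rw [← hbl]
        exact hb (by rw [Fin.le_def]; simp only; omega)

/-- Moreover `w⁻¹` reverses the remaining simple roots inside the blocks of `b'`. -/
def ReversesRest (b b' : Fin n → ℕ) (w : Equiv.Perm (Fin n)) : Prop :=
  ∀ i j : Fin n, (i : ℕ) + 1 = j → b' i = b' j → b (w⁻¹ i) ≠ b (w⁻¹ j) → w⁻¹ j < w⁻¹ i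

/-- The links coming from b are reversed by π, the remaining links of b' by w⁻¹; since π respects
the blocks, it cannot undo the latter. -/
theorem CarriesLinks.trivialOnCell {R : Type*} [CommRing R] (h : CarriesLinks b b' w)
    (h' : ReversesRest b b' w) (hb : Monotone b) {ψ : AddChar F R} (hψ : ψ.IsPrimitive)
    {π : Equiv.Perm (Fin n)} (hπ : ∀ k, b (π k) = b k)
    (hπ' : ∀ i j, i < j → b i = b j → π⁻¹ j < π⁻¹ i) :
    TrivialOnCell (linChar ψ (linkVec F b')) (w * π) := by
  rw [trivialOnCell_linChar_iff hψ]
  intro i j hij ha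
  rw [linkVec_ne_zero_iff hij] at ha
  rw [mul_inv_rev, Equiv.Perm.mul_apply, Equiv.Perm.mul_apply]
  by_cases hbl : b (w⁻¹ i) = b (w⁻¹ j)
  · refine hπ' _ _ ?_ hbl
    by_contra! hle
    rcases hle.eq_or_lt with heq | hlt
    · have := w⁻¹.injective heq
      subst this
      omega
    · have := h.increasingOn.lt hb hlt hbl.symm
      rw [perm_apply_inv_self, perm_apply_inv_self, Fin.lt_def] at this
      omega
  · have hlt := hb (h' i j hij ha hbl).le
    by_contra! hle
    have h2 := hb hle
    rw [← hπ (π⁻¹ _), ← hπ (π⁻¹ (w⁻¹ j)), perm_apply_inv_self, perm_apply_inv_self] at h2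
    omega

end Blocks

/-! ### Passing from one F_λ to another by a permutation -/

section Moves

variable {n : ℕ} {F : Type*} [Field F] [Fintype F] {R : Type*} [CommRing R]
  {b b' : Fin n → ℕ} {w : Equiv.Perm (Fin n)}

/-- All u contribute equally. The block diagonal part of u⁻¹ crosses w into U and yields the inverse
of λ(u); the remaining factor crosses π into B and is absorbed. -/
theorem CarriesLinks.coeff_charSum_mul (h : CarriesLinks b b' w) (hb : Monotone b)
    (ψ : AddChar F R) {π : Equiv.Perm (Fin n)} (hπ : ∀ k, b (π k) = b k) :
    (charSum (linChar ψ (linkVec F b)) * (MonoidAlgebra.single (permGL n F w)⁻¹ (1 : R) *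
      (charVector (linChar ψ (linkVec F b')) : GroupAlg n F R))).coeff (permGL n F π) =
      (Nat.card (unitriangular n F) : R) *
        (charVector (linChar ψ (linkVec F b')) : GroupAlg n F R).coeff (permGL n F (w * π)) := by
  rw [SteinbergLattice.coeff_charSum_mul, Nat.card_eq_fintype_card, ← Finset.card_univ,
    ← nsmul_eq_mul, ← Finset.sum_const]
  refine Finset.sum_congr rfl fun u _ => ?_
  rw [MonoidAlgebra.coeff_single_mul_apply, one_mul, inv_inv]
  set v : unitriangular n F := u⁻¹ with hv
  set D := blockDiagPart b v
  have hfac : permGL n F w * ((u : GL (Fin n) F)⁻¹ * permGL n F π) =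
      ((permGL n F w⁻¹)⁻¹ * (D : GL (Fin n) F) * permGL n F w⁻¹) *
        (permGL n F (w * π) * ((permGL n F π)⁻¹ * ((D⁻¹ * v : unitriangular n F) : GL (Fin n) F) *
          permGL n F π)) := by
    have hD : ((D⁻¹ * v : unitriangular n F) : GL (Fin n) F) =
        (D : GL (Fin n) F)⁻¹ * (u : GL (Fin n) F)⁻¹ := by rw [hv]; rfl
    rw [hD, map_inv, map_mul]
    group
  rw [hfac]
  have h1 := coeff_charVector_mul_left (linChar ψ (linkVec F b'))
    ⟨_, h.conj_mem_unitriangular hb v⟩ (permGL n F (w * π) * ((permGL n F π)⁻¹ *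
      ((D⁻¹ * v : unitriangular n F) : GL (Fin n) F) * permGL n F π))
  rw [h.linChar_conj hb] at h1
  rw [h1, lattice_coeff_mul_borel (Subtype.mem _) (conj_blockDiagPart_inv_mul_mem hb v hπ),
    ← mul_assoc, ← Units.val_mul, ← map_mul, hv, mul_inv_cancel, map_one, Units.val_one, one_mul]

variable [IsLocalRing R] {ℓ : ℕ} [Fact ℓ.Prime]

theorem isUnit_coeff_charVector (hR : IsLocalRing.maximalIdeal R = Ideal.span {(ℓ : R)})
    (hℓ : ¬ ℓ ∣ Nat.card F) {χ : unitriangular n F →* Rˣ} {σ : Equiv.Perm (Fin n)}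
    (h : TrivialOnCell χ σ) :
    IsUnit ((charVector χ : GroupAlg n F R).coeff (permGL n F σ)) := by
  rw [coeff_charVector_permGL_of_trivial h, card_cellStab, Nat.cast_pow]
  exact (isUnit_sign σ).mul ((isUnit_natCast hR hℓ).pow _)

/-- Project w⁻¹E_λ' onto the line of E_λ and evaluate at the block reversal π. The result is |U|
times the value of E_λ' at wπ, which is a signed power of q because λ' is trivial on that
stabilizer; so the coefficient is a unit. -/
theorem redCharVector_mem_of_carriesLinks
    (hR : IsLocalRing.maximalIdeal R = Ideal.span {(ℓ : R)}) (hℓ : ¬ ℓ ∣ Nat.card F)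
    {ψ : AddChar F R} (hψ : ψ.IsPrimitive) (hb : Monotone b) (h : CarriesLinks b b' w)
    (h' : ReversesRest b b' w) :
    redCharVector ℓ (linChar ψ (linkVec F b)) ∈ Submodule.span (GroupAlg n F R)
      {redCharVector ℓ (linChar ψ (linkVec F b'))} := by
  obtain ⟨π, hπ, hπ'⟩ := exists_blockReversal hb
  set x : lattice n F R := (MonoidAlgebra.single (permGL n F w)⁻¹ (1 : R) : GroupAlg n F R) •
    charVector (linChar ψ (linkVec F b'))
  obtain ⟨c, hc⟩ := exists_charSum_smul_eq (linChar ψ (linkVec F b)) x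
  have h1 := coeff_of_charSum_smul_eq hc (permGL n F π)
  have h2 := h.coeff_charSum_mul hb ψ hπ
  have h3 : c * (charVector (linChar ψ (linkVec F b)) : GroupAlg n F R).coeff (permGL n F π) =
      (Nat.card (unitriangular n F) : R) *
        (charVector (linChar ψ (linkVec F b')) : GroupAlg n F R).coeff (permGL n F (w * π)) := by
    rw [← h1, ← h2]
    rfl
  have hcu : IsUnit c := by
    refine isUnit_of_mul_isUnit_left (h3 ▸ (isUnit_card_unitriangular hR hℓ).mul
      (isUnit_coeff_charVector hR hℓ (h.trivialOnCell h' hb hψ hπ hπ')))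
  refine redCharVector_mem (x := (MonoidAlgebra.single (permGL n F w)⁻¹ (1 : R) : GroupAlg n F R) •
    redCharVector ℓ (linChar ψ (linkVec F b')))
    (Submodule.smul_mem _ _ (Submodule.mem_span_singleton_self _)) hcu ?_
  exact congrArg (lMultiples n F R ℓ).mkQ hc

end Moves

/-! ### Permutations for refinements of labellings -/

section LabelMoves

variable {n : ℕ} {b b' : Fin n → ℕ}

/-- An order-reversing bijection of a block, which is an interval, leaves no gap between images of
neighbours. -/
theorem decreasing_step {π : Equiv.Perm (Fin n)} (hb : Monotone b) (hπ : ∀ k, b (π k) = b k)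
    (hπ' : ∀ i j, i < j → b i = b j → π⁻¹ j < π⁻¹ i) {i j : Fin n} (hij : (i : ℕ) + 1 = j)
    (hbij : b i = b j) : (π j : ℕ) + 1 = π i := by
  have key : ∀ x y, b x = b y → x < y → π y < π x := by
    intro x y hxy hlt
    by_contra! hle
    rcases hle.eq_or_lt with heq | h
    · exact hlt.ne (π.injective heq)
    · have := hπ' _ _ h (by rw [hπ, hπ, hxy])
      rw [perm_inv_apply_self, perm_inv_apply_self] at this
      exact lt_asymm hlt this
  have h1 := key i j hbij (by rw [Fin.lt_def]; omega)
  rw [Fin.lt_def] at h1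
  by_contra hne
  let m : Fin n := ⟨(π j : ℕ) + 1, by omega⟩
  have hjm : π j < m := by rw [Fin.lt_def]; simp [m]
  have hmi : m < π i := by rw [Fin.lt_def]; simp only [m]; omega
  have hbm : b m = b j := by
    have h2 := hb hjm.le
    have h3 := hb hmi.le
    rw [hπ] at h2 h3
    omega
  have h2 := hπ' _ _ hjm (by rw [hπ, hbm])
  have h3 := hπ' _ _ hmi (by rw [hπ, hbm, hbij])
  rw [perm_inv_apply_self, Fin.lt_def] at h2 h3
  omega

theorem label_eq_of_le {x y : Fin n} (hb : Monotone b)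
    (h : ∀ i j : Fin n, (i : ℕ) + 1 = j → b i = b j → b' i = b' j) (hxy : x ≤ y)
    (hbl : b x = b y) : b' x = b' y := by
  have hin : ∀ k, x ≤ k → k ≤ y → b k = b x := fun k h1 h2 =>
    le_antisymm ((hb h2).trans hbl.ge) (hb h1)
  have hstep : ∀ k l : Fin n, x ≤ k → l ≤ y → (k : ℕ) + 1 = l → b' k = b' l := by
    intro k l hxk hly hkl
    have hk : k ≤ y := le_trans (by rw [Fin.le_def]; omega) hly
    have hl : x ≤ l := le_trans hxk (by rw [Fin.le_def]; omega)
    exact h k l hkl ((hin k hxk hk).trans (hin l hl hly).symm)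
  rw [Fin.le_def] at hxy
  exact le_antisymm
    (le_of_forall_step_le ((y : ℕ) - x) x y (by omega) fun k l h1 h2 h3 => (hstep k l h1 h2 h3).le)
    (le_of_forall_step_le (f := fun i => OrderDual.toDual (b' i)) ((y : ℕ) - x) x y (by omega)
      fun k l h1 h2 h3 => (hstep k l h1 h2 h3).ge)

/-- Reverse the fine blocks, then the coarse ones: the order inside each fine block is restored,
while the order of the fine blocks inside a coarse block is reversed. -/
theorem exists_carriesLinks_of_refines (hb : Monotone b) (hb' : Monotone b')
    (h : ∀ i j : Fin n, (i : ℕ) + 1 = j → b i = b j → b' i = b' j) :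
    ∃ w, CarriesLinks b b' w ∧ ReversesRest b b' w := by
  obtain ⟨π, hπ, hπ'⟩ := exists_blockReversal hb
  obtain ⟨ρ, hρ, hρ'⟩ := exists_blockReversal hb'
  have hbl : ∀ x y, b x = b y → b' x = b' y := by
    intro x y hxy
    rcases le_total x y with hle | hle
    · exact label_eq_of_le hb h hle hxy
    · exact (label_eq_of_le hb h hle hxy.symm).symm
  refine ⟨ρ * π, fun i j hij hbij => ⟨?_, ?_⟩, fun i j hij hbij hne => ?_⟩
  · rw [Equiv.Perm.mul_apply, Equiv.Perm.mul_apply]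
    exact decreasing_step hb' hρ hρ' (decreasing_step hb hπ hπ' hij hbij)
      (hbl _ _ (by rw [hπ, hπ, hbij]))
  · rw [Equiv.Perm.mul_apply, Equiv.Perm.mul_apply, hρ, hρ]
    exact hbl _ _ (by rw [hπ, hπ, hbij])
  · have hbπ : ∀ x, b (π⁻¹ x) = b x := fun x => by rw [← hπ (π⁻¹ x), perm_apply_inv_self]
    rw [mul_inv_rev, Equiv.Perm.mul_apply, Equiv.Perm.mul_apply] at hne ⊢
    rw [hbπ, hbπ] at hne
    have h1 := hρ' i j (by rw [Fin.lt_def]; omega) hbij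
    have h2 := hb h1.le
    by_contra! hle
    have h3 := hb hle
    rw [hbπ, hbπ] at h3
    omega

end LabelMoves

/-! ### Rearranging and splitting the blocks of a composition -/

section BlockPermutations

theorem exists_equiv_of_perm {α : Type*} {l l' : List α} (h : l.Perm l') :
    ∃ e : Fin l.length ≃ Fin l'.length, ∀ i, l'.get (e i) = l.get i := by
  classical
  have hcount : ∀ (l : List α) (a : α), Fintype.card {i // l.get i = a} = l.count a := by
    intro l a
    have h1 : (Finset.univ : Finset (Fin l.length)).val.map l.get = (l : Multiset α) := by
      rw [Fin.univ_val_map, List.ofFn_get]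
    rw [← Multiset.coe_count, ← h1, Multiset.count_map, Fintype.card_subtype]
    simp only [Finset.card, Finset.filter_val, eq_comm]
  have hcard : ∀ a, Fintype.card {i // l.get i = a} = Fintype.card {i // l'.get i = a} := by
    intro a
    rw [hcount, hcount, h.count_eq]
  exact ⟨Equiv.ofFiberEquiv fun a => Fintype.equivOfCardEq (hcard a),
    fun i => Equiv.ofFiberEquiv_map _ i⟩

variable {n : ℕ}

/-- Blocks are matched by size and moved as wholes. Every link of the target then comes from a link
of the source, so nothing remains to be reversed. -/
theorem exists_carriesLinks_of_perm {c c' : Composition n} (h : c.blocks.Perm c'.blocks) :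
    ∃ w, CarriesLinks (compLabel c) (compLabel c') w ∧
      ReversesRest (compLabel c) (compLabel c') w := by
  obtain ⟨e, he⟩ : ∃ e : Fin c.length ≃ Fin c'.length, ∀ i, c'.blocksFun (e i) = c.blocksFun i :=
    exists_equiv_of_perm h
  let w : Equiv.Perm (Fin n) := c.blocksFinEquiv.symm.trans
    ((Equiv.sigmaCongr e fun i => finCongr (he i).symm).trans c'.blocksFinEquiv)
  have hw : ∀ x, w x = c'.embedding (e (c.index x)) (finCongr (he _).symm (c.invEmbedding x)) :=
    fun x => rfl
  have hidx : ∀ x, c'.index (w x) = e (c.index x) := fun x => by rw [hw, Composition.index_embedding]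
  have hval : ∀ x, (w x : ℕ) = c'.sizeUpTo (e (c.index x)) + (x - c.sizeUpTo (c.index x)) :=
    fun x => rfl
  have hiff : ∀ x y, compLabel c' (w x) = compLabel c' (w y) ↔ compLabel c x = compLabel c y := by
    intro x y
    simp only [compLabel, hidx, Fin.val_inj, e.injective.eq_iff]
  refine ⟨w, fun i j hij hbij => ⟨?_, (hiff i j).2 hbij⟩, fun i j _ hbij hne => ?_⟩
  · have hidx' : c.index i = c.index j := Fin.ext hbij
    rw [hval, hval, ← hidx']
    have := c.sizeUpTo_index_le i
    omega
  · exfalso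
    apply hne
    rw [← hiff, perm_apply_inv_self, perm_apply_inv_self, hbij]

/-- The boundaries before the split keep their index, those after it are shifted by one, so all
boundaries of the coarse composition survive. -/
theorem compLabel_eq_of_split {c c' : Composition n} {l₁ l₂ : List ℕ} {x y : ℕ}
    (hc : c.blocks = l₁ ++ (x + y) :: l₂) (hc' : c'.blocks = l₁ ++ x :: y :: l₂) {i j : Fin n}
    (hij : (i : ℕ) + 1 = j) (h : compLabel c' i = compLabel c' j) :
    compLabel c i = compLabel c j := by
  rw [compLabel_eq_iff _ hij] at h ⊢
  intro k hk
  rw [Composition.length, hc] at hk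
  rcases le_or_gt k l₁.length with hkl | hkl
  · convert h k (by rw [Composition.length, hc']; simp; omega) using 1
    rw [Composition.sizeUpTo, Composition.sizeUpTo, hc, hc', List.take_append_of_le_length hkl,
      List.take_append_of_le_length hkl]
  · convert h (k + 1) (by rw [Composition.length, hc']; simp at hk ⊢; omega) using 1
    obtain ⟨m, rfl⟩ := Nat.exists_eq_add_of_lt hkl
    have htake : ∀ (k : ℕ) (L : List ℕ), List.take (l₁.length + k) (l₁ ++ L) = l₁ ++ L.take k := by
      intro k L
      rw [List.take_append, List.take_of_length_le (by omega), Nat.add_sub_cancel_left]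
    rw [Composition.sizeUpTo, Composition.sizeUpTo, hc, hc', add_assoc, htake, add_assoc, htake,
      List.take_succ_cons, List.take_succ_cons, List.take_succ_cons]
    simp only [List.sum_append, List.sum_cons]
    ring

end BlockPermutations

/-! ### The modules L'(P) and inclusions between them -/

section CyclicParts

variable {n : ℕ} {F : Type*} [Field F] [Fintype F] {R : Type*} [CommRing R] {ℓ : ℕ}
  {ψ : AddChar F R}

theorem redCharVector_mem_span_of_iff {a a' : Fin n → F}
    (h : ∀ j : Fin n, 0 < (j : ℕ) → (a j = 0 ↔ a' j = 0)) :
    redCharVector ℓ (linChar ψ a) ∈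
      Submodule.span (GroupAlg n F R) {redCharVector ℓ (linChar ψ a')} := by
  obtain ⟨t, ht⟩ := exists_diagGL_smul_charVector (ψ := ψ) h
  exact Submodule.mem_span_singleton.2 ⟨_, congrArg (lMultiples n F R ℓ).mkQ ht⟩

theorem redCharVector_mem_span_linkVec {a : Fin n → F} {b : Fin n → ℕ}
    (h : ∀ i j : Fin n, (i : ℕ) + 1 = j → (b i = b j ↔ a j ≠ 0)) :
    redCharVector ℓ (linChar ψ a) ∈
        Submodule.span (GroupAlg n F R) {redCharVector ℓ (linChar ψ (linkVec F b))} ∧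
      redCharVector ℓ (linChar ψ (linkVec F b)) ∈
        Submodule.span (GroupAlg n F R) {redCharVector ℓ (linChar ψ a)} := by
  have h1 : ∀ j : Fin n, 0 < (j : ℕ) → (a j = 0 ↔ linkVec F b j = 0) := by
    intro j hj
    have hij : ((⟨(j : ℕ) - 1, by omega⟩ : Fin n) : ℕ) + 1 = j := by simp only; omega
    rw [← not_iff_not, ← ne_eq, ← ne_eq, linkVec_ne_zero_iff hij, h _ _ hij]
  exact ⟨redCharVector_mem_span_of_iff h1, redCharVector_mem_span_of_iff fun j hj => (h1 j hj).symm⟩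

omit [Fintype F] in
theorem charNorm_linkVec [Finite F] (hψ : ψ.IsPrimitive) {b : Fin n → ℕ} (hb : Monotone b) :
    charNorm (linChar ψ (linkVec F b)) = (blockUpper n F b).index :=
  charNorm_linChar hψ hb fun _ _ hij => (linkVec_ne_zero_iff hij).symm

variable [IsDomain R] [CharZero R]

theorem cyclicPart_eq_span (hψ : ψ.IsPrimitive) {b : Fin n → ℕ} (hb : Monotone b) :
    cyclicPart R ℓ (blockUpper n F b) =
      Submodule.span (GroupAlg n F R) {redCharVector ℓ (linChar ψ (linkVec F b))} := by
  apply le_antisymm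
  · rw [cyclicPart, Submodule.span_le]
    rintro x ⟨χ, hχ, rfl⟩
    obtain ⟨a, rfl⟩ := exists_eq_linChar hψ χ
    rw [parabolicOfChar_eq_blockUpper_iff hb] at hχ
    refine (redCharVector_mem_span_linkVec fun i j hij => ?_).1
    rw [← hχ i j hij, nontrivialOnRoot_linChar_iff hψ a hij]
  · rw [Submodule.span_singleton_le_iff_mem]
    refine Submodule.subset_span ⟨_, ?_, rfl⟩
    rw [parabolicOfChar_eq_blockUpper_iff hb]
    intro i j hij
    rw [nontrivialOnRoot_linChar_iff hψ _ hij, linkVec_ne_zero_iff hij]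

variable [IsLocalRing R] [Fact ℓ.Prime]

theorem cyclicPart_le_filtration_iff (hR : IsLocalRing.maximalIdeal R = Ideal.span {(ℓ : R)})
    (hℓ : ¬ ℓ ∣ Nat.card F) (hψ : ψ.IsPrimitive) {b : Fin n → ℕ} (hb : Monotone b) (k : ℕ) :
    cyclicPart R ℓ (blockUpper n F b) ≤ filtration n F R ℓ k ↔ k ≤ theta ℓ (blockUpper n F b) := by
  rw [cyclicPart_eq_span hψ hb, Submodule.span_singleton_le_iff_mem,
    redCharVector_mem_filtration_iff hR hℓ, charNorm_linkVec hψ hb, theta]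

theorem exists_cyclicPart_le_not_le (hR : IsLocalRing.maximalIdeal R = Ideal.span {(ℓ : R)})
    (hℓ : ¬ ℓ ∣ Nat.card F) (hψ : ψ.IsPrimitive)
    {N M : Submodule (GroupAlg n F R) (Reduction n F R ℓ)} (h : N < M) :
    ∃ c : Composition n, cyclicPart R ℓ (blockUpper n F (compLabel c)) ≤ M ∧
      ¬ cyclicPart R ℓ (blockUpper n F (compLabel c)) ≤ N := by
  obtain ⟨a, haM, haN⟩ := exists_redCharVector_mem_not_mem hR hℓ hψ h
  obtain ⟨c, hc⟩ := exists_composition_of_links fun _ j => a j ≠ 0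
  obtain ⟨h1, h2⟩ := redCharVector_mem_span_linkVec (R := R) (ℓ := ℓ) (ψ := ψ) hc
  rw [← cyclicPart_eq_span hψ (compLabel_monotone c)] at h1
  refine ⟨c, ?_, fun hle => haN (hle h1)⟩
  rw [cyclicPart_eq_span hψ (compLabel_monotone c), Submodule.span_singleton_le_iff_mem]
  exact (Submodule.span_singleton_le_iff_mem _ _).2 haM h2

/-- Reciprocity reverses the inclusion but inverts the characters. An inverse character has the same
support, so it is conjugate under the diagonal group and generates the same module. -/
theorem cyclicPart_le_symm (hR : IsLocalRing.maximalIdeal R = Ideal.span {(ℓ : R)})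
    (hℓ : ¬ ℓ ∣ Nat.card F) (hψ : ψ.IsPrimitive) {b b' : Fin n → ℕ} (hb : Monotone b)
    (hb' : Monotone b') (hθ : theta ℓ (blockUpper n F b) = theta ℓ (blockUpper n F b'))
    (h : cyclicPart R ℓ (blockUpper n F b') ≤ cyclicPart R ℓ (blockUpper n F b)) :
    cyclicPart R ℓ (blockUpper n F b) ≤ cyclicPart R ℓ (blockUpper n F b') := by
  have hneg : ∀ b : Fin n → ℕ, Submodule.span (GroupAlg n F R)
      {redCharVector ℓ (linChar ψ (linkVec F b))⁻¹} =
      Submodule.span (GroupAlg n F R) {redCharVector ℓ (linChar ψ (linkVec F b))} := by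
    intro b
    rw [linChar_inv]
    apply le_antisymm <;> rw [Submodule.span_singleton_le_iff_mem] <;>
      exact redCharVector_mem_span_of_iff fun j _ => by simp
  rw [cyclicPart_eq_span hψ hb, cyclicPart_eq_span hψ hb',
    Submodule.span_singleton_le_iff_mem] at h
  have h1 := redCharVector_mem_span_symm hR hℓ
    (by rw [charNorm_linkVec hψ hb, charNorm_linkVec hψ hb']; exact hθ) h
  rw [cyclicPart_eq_span hψ hb, cyclicPart_eq_span hψ hb', ← hneg b, ← hneg b',
    Submodule.span_singleton_le_iff_mem]
  exact h1

theorem cyclicPart_le_of_carriesLinks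
    (hR : IsLocalRing.maximalIdeal R = Ideal.span {(ℓ : R)}) (hℓ : ¬ ℓ ∣ Nat.card F)
    (hψ : ψ.IsPrimitive) {b b' : Fin n → ℕ} (hb : Monotone b) (hb' : Monotone b')
    (h : ∃ w, CarriesLinks b b' w ∧ ReversesRest b b' w) :
    cyclicPart R ℓ (blockUpper n F b) ≤ cyclicPart R ℓ (blockUpper n F b') := by
  obtain ⟨w, h1, h2⟩ := h
  rw [cyclicPart_eq_span hψ hb, cyclicPart_eq_span hψ hb', Submodule.span_singleton_le_iff_mem]
  exact redCharVector_mem_of_carriesLinks hR hℓ hψ hb h1 h2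

theorem cyclicPart_eq_of_perm (hR : IsLocalRing.maximalIdeal R = Ideal.span {(ℓ : R)})
    (hℓ : ¬ ℓ ∣ Nat.card F) (hψ : ψ.IsPrimitive) {c c' : Composition n}
    (h : c.blocks.Perm c'.blocks) :
    cyclicPart R ℓ (blockUpper n F (compLabel c)) =
      cyclicPart R ℓ (blockUpper n F (compLabel c')) :=
  le_antisymm
    (cyclicPart_le_of_carriesLinks hR hℓ hψ (compLabel_monotone _) (compLabel_monotone _)
      (exists_carriesLinks_of_perm h))
    (cyclicPart_le_of_carriesLinks hR hℓ hψ (compLabel_monotone _) (compLabel_monotone _)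
      (exists_carriesLinks_of_perm h.symm))

/-- Splitting a block of a composition shrinks the corresponding submodule. -/
theorem exists_split (hR : IsLocalRing.maximalIdeal R = Ideal.span {(ℓ : R)})
    (hℓ : ¬ ℓ ∣ Nat.card F) (hψ : ψ.IsPrimitive) {c : Composition n} {x y : ℕ} (hx : 0 < x)
    (hy : 0 < y) (h : x + y ∈ c.blocks) :
    ∃ c' : Composition n, c'.length = c.length + 1 ∧
      cyclicPart R ℓ (blockUpper n F (compLabel c')) ≤
        cyclicPart R ℓ (blockUpper n F (compLabel c)) ∧
      ∀ g : ℕ → ℕ, (c'.blocks.map g).sum + g (x + y) = (c.blocks.map g).sum + g x + g y := by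
  obtain ⟨l₁, l₂, hl⟩ := List.append_of_mem h
  have hpos : ∀ {i}, i ∈ l₁ ++ x :: y :: l₂ → 0 < i := by
    intro i hi
    simp only [List.mem_append, List.mem_cons] at hi
    have : ∀ j ∈ c.blocks, 0 < j := fun j hj => c.blocks_pos hj
    rw [hl] at this
    rcases hi with hi | rfl | rfl | hi
    · exact this i (by simp [hi])
    · exact hx
    · exact hy
    · exact this i (by simp [hi])
  have hsum : (l₁ ++ x :: y :: l₂).sum = n := by
    have := c.blocks_sum
    rw [hl] at this
    simp only [List.sum_append, List.sum_cons] at this ⊢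
    omega
  refine ⟨⟨l₁ ++ x :: y :: l₂, hpos, hsum⟩, ?_, ?_, fun g => ?_⟩
  · rw [Composition.length, Composition.length, hl]
    simp only [List.length_append, List.length_cons]
    ring
  · exact cyclicPart_le_of_carriesLinks hR hℓ hψ (compLabel_monotone _) (compLabel_monotone _)
      (exists_carriesLinks_of_refines (compLabel_monotone _) (compLabel_monotone _)
        fun i j hij h' => compLabel_eq_of_split hl rfl hij h')
  · rw [hl]
    simp only [List.map_append, List.map_cons, List.sum_append, List.sum_cons]
    ring

end CyclicParts

/-! ### Splitting blocks and the resulting change of φ -/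

section Arithmetic

theorem blockPhi_one {ℓ e d : ℕ} (he : 2 ≤ e) : blockPhi ℓ e d 1 = 0 := by
  simp [blockPhi, Nat.div_eq_of_lt (show 1 < e by omega)]

theorem blockPhi_self {ℓ e d : ℕ} (he : 2 ≤ e) : blockPhi ℓ e d e = d := by
  simp [blockPhi, Nat.div_self (show 0 < e by omega)]

theorem blockPhi_mul {ℓ e d k : ℕ} (he : 2 ≤ e) :
    blockPhi ℓ e d (e * k) = d * k + padicValNat ℓ k.factorial := by
  rw [blockPhi, Nat.mul_div_cancel_left _ (by omega)]

/-- Take for i the largest power ℓ^s below k. By Kummer, no carry occurs at the exponents up to s,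
and k ≤ ℓ^(s+1) leaves at most one more. -/
theorem exists_choose_val_le_one {ℓ : ℕ} [Fact ℓ.Prime] {k : ℕ} (hk : 2 ≤ k) :
    ∃ i, 0 < i ∧ i < k ∧ padicValNat ℓ (k.choose i) ≤ 1 := by
  have hℓ : 1 < ℓ := (Fact.out : ℓ.Prime).one_lt
  set t := Nat.log ℓ k with ht
  obtain ⟨s, hsk, hst⟩ : ∃ s, ℓ ^ s < k ∧ t ≤ s + 1 := by
    rcases (Nat.pow_log_le_self ℓ (show k ≠ 0 by omega)).lt_or_eq with h | h
    · exact ⟨t, h, by omega⟩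
    · refine ⟨t - 1, ?_, by omega⟩
      have ht0 : t ≠ 0 := by
        intro h0
        rw [← ht, h0, pow_zero] at h
        omega
      rw [← h, ← ht]
      exact Nat.pow_lt_pow_right hℓ (by omega)
  refine ⟨ℓ ^ s, pow_pos (by omega) _, hsk, ?_⟩
  rw [padicValNat_choose hsk.le (Nat.lt_succ_self _)]
  calc _ ≤ (Finset.Ioc s (s + 1)).card := by
        refine Finset.card_le_card fun i hi => ?_
        rw [Finset.mem_filter, Finset.mem_Ico] at hi
        rw [Finset.mem_Ioc]
        refine ⟨?_, by omega⟩
        by_contra! his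
        have h1 : ℓ ^ s % ℓ ^ i = 0 := Nat.mod_eq_zero_of_dvd (pow_dvd_pow _ his)
        have h2 := Nat.mod_lt (k - ℓ ^ s) (pow_pos (show 0 < ℓ by omega) i)
        omega
    _ = 1 := by simp

/-- A block whose size is neither `1` nor `e` can be split with a small drop of `φ`. -/
theorem exists_blockPhi_split {ℓ e d : ℕ} [Fact ℓ.Prime] (he : 2 ≤ e) {m : ℕ} (hm : 0 < m)
    (hm1 : m ≠ 1) (hme : m ≠ e) :
    ∃ x y, 0 < x ∧ 0 < y ∧ x + y = m ∧
      blockPhi ℓ e d m ≤ blockPhi ℓ e d x + blockPhi ℓ e d y + 1 := by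
  -- A multiple ek is split into multiples ei and e(k - i), and the loss is the valuation of the
  -- binomial coefficient. Otherwise a block of size 1 is split off without changing ⌊m/e⌋.
  by_cases h : e ∣ m
  · obtain ⟨k, rfl⟩ := h
    have hk0 : k ≠ 0 := by rintro rfl; simp at hm
    have hk1 : k ≠ 1 := by rintro rfl; simp at hme
    obtain ⟨i, hi0, hik, hi⟩ := exists_choose_val_le_one (ℓ := ℓ) (show 2 ≤ k by omega)
    refine ⟨e * i, e * (k - i), Nat.mul_pos (by omega) hi0, Nat.mul_pos (by omega) (by omega),
      by rw [← mul_add, Nat.add_sub_cancel' hik.le], ?_⟩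
    rw [blockPhi_mul he, blockPhi_mul he, blockPhi_mul he, ← Nat.choose_mul_factorial_mul_factorial hik.le,
      padicValNat.mul (mul_ne_zero (Nat.choose_pos hik.le).ne' (Nat.factorial_ne_zero _))
        (Nat.factorial_ne_zero _),
      padicValNat.mul (Nat.choose_pos hik.le).ne' (Nat.factorial_ne_zero _)]
    have hd : d * k = d * i + d * (k - i) := by rw [← mul_add, Nat.add_sub_cancel' hik.le]
    omega
  · refine ⟨1, m - 1, one_pos, by omega, by omega, ?_⟩
    have hdiv : (m - 1) / e = m / e := by
      obtain ⟨m, rfl⟩ := Nat.exists_eq_succ_of_ne_zero hm.ne'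
      rw [Nat.succ_sub_one, Nat.succ_div_of_not_dvd h]
    rw [blockPhi_one he, blockPhi, blockPhi, hdiv]
    omega

/-- The upper bound gives Σ⌊m/e⌋ ≤ a - 1. The lower bound then needs a factorial ⌊m/e⌋! divisible by
ℓ, so that ℓ ≤ ⌊m/e⌋ ≤ a - 1. -/
theorem prime_le_of_sum_blockPhi {ℓ e d a : ℕ} [Fact ℓ.Prime] (l : List ℕ)
    (h1 : d * (a - 1) < (l.map (blockPhi ℓ e d)).sum) (h2 : (l.map (blockPhi ℓ e d)).sum < d * a) :
    ℓ ≤ a - 1 := by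
  have hsum : (l.map (blockPhi ℓ e d)).sum = d * (l.map (· / e)).sum +
      (l.map fun m => padicValNat ℓ (m / e).factorial).sum := by
    rw [← List.sum_map_mul_left, ← List.sum_map_add]
    rfl
  have hs : (l.map (· / e)).sum ≤ a - 1 := by
    have : d * (l.map (· / e)).sum < d * a := by omega
    have := Nat.lt_of_mul_lt_mul_left this
    omega
  obtain ⟨m, hm, hm0⟩ : ∃ m ∈ l, padicValNat ℓ (m / e).factorial ≠ 0 := by
    by_contra! hcon
    have h0 : (l.map fun m => padicValNat ℓ (m / e).factorial).sum = 0 := by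
      rw [List.sum_eq_zero_iff]
      intro x hx
      obtain ⟨m, hm, rfl⟩ := List.mem_map.1 hx
      exact hcon m hm
    have := Nat.mul_le_mul_left d hs
    omega
  have hdvd := dvd_of_one_le_padicValNat (Nat.one_le_iff_ne_zero.2 hm0)
  have hle : ℓ ≤ m / e := ((Fact.out : ℓ.Prime).dvd_factorial).1 hdvd
  exact (hle.trans (List.le_sum_of_mem (List.mem_map_of_mem (f := (· / e)) hm))).trans hs

theorem exists_perm_of_parts {n e : ℕ} (he : 2 ≤ e) {l : List ℕ} (hl : l.sum = n)
    (h : ∀ m ∈ l, m = 1 ∨ m = e) :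
    e * l.count e ≤ n ∧
      l.Perm (List.replicate (n - e * l.count e) 1 ++ List.replicate (l.count e) e) := by
  have hp : l.Perm (List.replicate (l.count 1) 1 ++ List.replicate (l.count e) e) := by
    rw [List.perm_replicate_append_replicate (by omega)]
    exact ⟨rfl, rfl, fun m hm => by simpa using h m hm⟩
  have hs := hp.sum_eq
  rw [List.sum_append, List.sum_replicate, List.sum_replicate, hl, smul_eq_mul, smul_eq_mul,
    mul_one, mul_comm _ e] at hs
  refine ⟨by omega, ?_⟩
  rwa [show n - e * l.count e = l.count 1 by omega]

end Arithmetic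

/-! ### Irreducible submodules of the quotients by filtration terms -/

section Filtration

variable {n : ℕ} {F : Type*} [Field F] {R : Type*} [CommRing R] {ℓ : ℕ}

/-- The submodule `L'(P)` for the parabolic subgroup of a composition. -/
noncomputable abbrev compPart (F R : Type*) [Field F] [CommRing R] (ℓ : ℕ) (c : Composition n) :
    Submodule (GroupAlg n F R) (Reduction n F R ℓ) :=
  cyclicPart R ℓ (blockUpper n F (compLabel c))

/-- The level `ϑ(P)` of the parabolic subgroup of a composition. -/
noncomputable abbrev compLevel (F : Type*) [Field F] (ℓ : ℕ) (c : Composition n) : ℕ :=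
  theta ℓ (blockUpper n F (compLabel c))

theorem map_mkQ_eq_bot_iff {A M : Type*} [Ring A] [AddCommGroup M] [Module A M]
    {N T : Submodule A M} : T.map N.mkQ = ⊥ ↔ T ≤ N := by
  rw [← LinearMap.le_ker_iff_map, Submodule.ker_mkQ]

theorem filtration_antitone [IsDomain R] : Antitone (filtration n F R ℓ) := by
  intro k m hkm
  refine Submodule.map_mono fun x hx y => ?_
  obtain ⟨r, hr⟩ := hx y
  refine ⟨(ℓ : R) ^ (m - k) * r, ?_⟩
  rw [hr, ← mul_assoc, ← pow_add, Nat.add_sub_cancel' hkm]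

variable [Fintype F] [IsDomain R] [CharZero R] [IsLocalRing R] [Fact ℓ.Prime] {ψ : AddChar F R}

theorem compLevel_add_phi (c : Composition n) :
    compLevel F ℓ c + phi ℓ (blockUpper n F (compLabel c)) = theta ℓ (borel n F) :=
  theta_add_phi (borel_le_blockUpper (compLabel_monotone c))

theorem compPart_le_filtration_iff (hR : IsLocalRing.maximalIdeal R = Ideal.span {(ℓ : R)})
    (hℓ : ¬ ℓ ∣ Nat.card F) (hψ : ψ.IsPrimitive) (c : Composition n) (k : ℕ) :
    compPart F R ℓ c ≤ filtration n F R ℓ k ↔ k ≤ compLevel F ℓ c :=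
  cyclicPart_le_filtration_iff hR hℓ hψ (compLabel_monotone c) k

/-- If M were not contained in L(k), some L'(c) in M would escape M ⊓ L(k), contrary to its level.
Thus submodules are compared with the filtration through levels alone. -/
theorem le_filtration_of_forall (hR : IsLocalRing.maximalIdeal R = Ideal.span {(ℓ : R)})
    (hℓ : ¬ ℓ ∣ Nat.card F) (hψ : ψ.IsPrimitive)
    {M : Submodule (GroupAlg n F R) (Reduction n F R ℓ)} {k : ℕ}
    (h : ∀ c : Composition n, compPart F R ℓ c ≤ M → k ≤ compLevel F ℓ c) :
    M ≤ filtration n F R ℓ k := by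
  by_contra hle
  obtain ⟨c, h1, h2⟩ := exists_cyclicPart_le_not_le hR hℓ hψ (inf_lt_left.2 hle)
  exact h2 (le_inf h1 ((compPart_le_filtration_iff hR hℓ hψ c k).2 (h c h1)))

theorem filtration_eq_of_forall (hR : IsLocalRing.maximalIdeal R = Ideal.span {(ℓ : R)})
    (hℓ : ¬ ℓ ∣ Nat.card F) (hψ : ψ.IsPrimitive) {k m : ℕ} (hkm : k ≤ m)
    (h : ∀ c : Composition n, k ≤ compLevel F ℓ c → m ≤ compLevel F ℓ c) :
    filtration n F R ℓ k = filtration n F R ℓ m :=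
  le_antisymm (le_filtration_of_forall hR hℓ hψ fun c hc =>
    h c ((compPart_le_filtration_iff hR hℓ hψ c k).1 hc)) (filtration_antitone hkm)

theorem filtration_zero (hR : IsLocalRing.maximalIdeal R = Ideal.span {(ℓ : R)})
    (hℓ : ¬ ℓ ∣ Nat.card F) (hψ : ψ.IsPrimitive) : filtration n F R ℓ 0 = ⊤ :=
  top_le_iff.1 (le_filtration_of_forall hR hℓ hψ fun _ _ => Nat.zero_le _)

theorem filtration_eq_bot (hR : IsLocalRing.maximalIdeal R = Ideal.span {(ℓ : R)})
    (hℓ : ¬ ℓ ∣ Nat.card F) (hψ : ψ.IsPrimitive) {k : ℕ} (hk : theta ℓ (borel n F) < k) :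
    filtration n F R ℓ k = ⊥ := by
  by_contra h
  obtain ⟨c, h1, -⟩ := exists_cyclicPart_le_not_le hR hℓ hψ (bot_lt_iff_ne_bot.2 h)
  have h2 := (compPart_le_filtration_iff hR hℓ hψ c k).1 h1
  have h3 := compLevel_add_phi (F := F) (ℓ := ℓ) c
  omega

theorem filtration_succ_lt (hR : IsLocalRing.maximalIdeal R = Ideal.span {(ℓ : R)})
    (hℓ : ¬ ℓ ∣ Nat.card F) (hψ : ψ.IsPrimitive) (c : Composition n) :
    filtration n F R ℓ (compLevel F ℓ c + 1) < filtration n F R ℓ (compLevel F ℓ c) := by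
  refine lt_of_le_not_ge (filtration_antitone (Nat.le_succ _)) fun h => ?_
  have h1 := ((compPart_le_filtration_iff hR hℓ hψ c _).2 le_rfl).trans h
  rw [compPart_le_filtration_iff hR hℓ hψ] at h1
  omega

/-- The image of `L'(P)` in `L/L(P)^♯` is irreducible. -/
theorem isAtom_map_compPart (hR : IsLocalRing.maximalIdeal R = Ideal.span {(ℓ : R)})
    (hℓ : ¬ ℓ ∣ Nat.card F) (hψ : ψ.IsPrimitive) (c : Composition n) :
    IsAtom ((compPart F R ℓ c).map (filtration n F R ℓ (compLevel F ℓ c + 1)).mkQ) := by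
  set N := filtration n F R ℓ (compLevel F ℓ c + 1)
  constructor
  · rw [ne_eq, map_mkQ_eq_bot_iff, compPart_le_filtration_iff hR hℓ hψ]
    omega
  · intro S hS
    by_contra hS0
    apply hS.not_ge
    -- As S is nonzero, its preimage meets L'(c) in more than N does, so a whole L'(c') can be found
    -- there.
    have hlt : N ⊓ compPart F R ℓ c < S.comap N.mkQ ⊓ compPart F R ℓ c := by
      refine lt_of_le_of_ne (inf_le_inf_right _ (Submodule.le_comap_mkQ N S)) fun heq => hS0 ?_
      rw [eq_bot_iff]
      intro y hy
      obtain ⟨x, hx, rfl⟩ := hS.le hy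
      have : x ∈ N ⊓ compPart F R ℓ c := by rw [heq]; exact ⟨hy, hx⟩
      exact (Submodule.Quotient.mk_eq_zero N).2 this.1
    obtain ⟨c', h1, h2⟩ := exists_cyclicPart_le_not_le hR hℓ hψ hlt
    obtain ⟨h3, h4⟩ := le_inf_iff.1 h1
    have h5 : ¬ compPart F R ℓ c' ≤ N := fun h => h2 (le_inf h h4)
    rw [compPart_le_filtration_iff hR hℓ hψ] at h5
    have h6 := h4.trans ((compPart_le_filtration_iff hR hℓ hψ c _).2 le_rfl)
    rw [compPart_le_filtration_iff hR hℓ hψ] at h6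
    -- L'(c') lies in L'(c) but not in N, so it has the same level as c; reciprocity gives back all
    -- of L'(c).
    have h7 := cyclicPart_le_symm hR hℓ hψ (compLabel_monotone c) (compLabel_monotone c')
      (show compLevel F ℓ c = compLevel F ℓ c' by omega) h4
    exact Submodule.map_le_iff_le_comap.2 (h7.trans h3)

/-- An L'(c) inside L(t) has level t, and then its image is irreducible, or a higher level, and then
its image is zero. These modules suffice to test the inclusion. -/
theorem map_filtration_le_socle (hR : IsLocalRing.maximalIdeal R = Ideal.span {(ℓ : R)})
    (hℓ : ¬ ℓ ∣ Nat.card F) (hψ : ψ.IsPrimitive) (t : ℕ) :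
    (filtration n F R ℓ t).map (filtration n F R ℓ (t + 1)).mkQ ≤
      socle (GroupAlg n F R) (Reduction n F R ℓ ⧸ filtration n F R ℓ (t + 1)) := by
  rw [Submodule.map_le_iff_le_comap]
  set T := (socle (GroupAlg n F R) (Reduction n F R ℓ ⧸ filtration n F R ℓ (t + 1))).comap
    (filtration n F R ℓ (t + 1)).mkQ
  by_contra hle
  obtain ⟨c, h1, h2⟩ := exists_cyclicPart_le_not_le hR hℓ hψ (inf_lt_left.2 hle)
  apply h2
  refine le_inf h1 ?_
  have h3 := (compPart_le_filtration_iff hR hℓ hψ c t).1 h1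
  rcases h3.eq_or_lt with h | h
  · subst h
    refine Submodule.map_le_iff_le_comap.1 (le_sSup ?_)
    exact isSimpleModule_iff_isAtom.2 (isAtom_map_compPart hR hℓ hψ c)
  · intro x hx
    have hx' := (compPart_le_filtration_iff hR hℓ hψ c (t + 1)).2 h hx
    rw [Submodule.mem_comap, Submodule.mkQ_apply, (Submodule.Quotient.mk_eq_zero _).2 hx']
    exact Submodule.zero_mem _

/-- An irreducible submodule of `L/L(P)^♯` outside `L(P)/L(P)^♯` comes from blocks of size `e`. -/
theorem exists_of_isAtom_not_le (hR : IsLocalRing.maximalIdeal R = Ideal.span {(ℓ : R)})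
    (hℓ : ¬ ℓ ∣ Nat.card F) (hψ : ψ.IsPrimitive) {c₀ : Composition n} {t : ℕ}
    (ht : t = compLevel F ℓ c₀) {N : Submodule (GroupAlg n F R) (Reduction n F R ℓ)}
    (hN : N = filtration n F R ℓ (t + 1))
    {S : Submodule (GroupAlg n F R) (Reduction n F R ℓ ⧸ N)} (hS : IsAtom S)
    (hSle : ¬ S ≤ (filtration n F R ℓ t).map N.mkQ) :
    ∃ (a : ℕ) (Q : Composition n),
      Q.blocks = List.replicate (n - eNum ℓ (Nat.card F) * a) 1 ++
        List.replicate a (eNum ℓ (Nat.card F)) ∧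
      ℓ ≤ a - 1 ∧ a - 1 < n / eNum ℓ (Nat.card F) ∧
      dNum ℓ (Nat.card F) * (a - 1) < phi ℓ (blockUpper n F (compLabel c₀)) ∧
      phi ℓ (blockUpper n F (compLabel c₀)) < dNum ℓ (Nat.card F) * a ∧
      S = (compPart F R ℓ Q).map N.mkQ := by
  classical
  set M := S.comap N.mkQ with hM
  set e := eNum ℓ (Nat.card F)
  set d := dNum ℓ (Nat.card F)
  have he : 2 ≤ e := (eNum_spec hℓ Finite.one_lt_card).1
  have hphi : ∀ c : Composition n, phi ℓ (blockUpper n F (compLabel c)) =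
      (c.blocks.map (blockPhi ℓ e d)).sum := phi_eq_sum hℓ
  have hlev : ∀ c : Composition n, compLevel F ℓ c + (c.blocks.map (blockPhi ℓ e d)).sum =
      theta ℓ (borel n F) := fun c => by rw [← hphi]; exact compLevel_add_phi c
  have hNM : N ≤ M := Submodule.le_comap_mkQ N S
  have hNM' : N < M := by
    refine lt_of_le_of_ne hNM fun heq => hS.ne_bot ?_
    rw [eq_bot_iff]
    intro y hy
    obtain ⟨x, rfl⟩ := N.mkQ_surjective y
    have : x ∈ N := by rw [heq]; exact hy
    exact (Submodule.Quotient.mk_eq_zero N).2 this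
  -- An irreducible S not contained in L(t)/N meets it trivially. So no L'(c) inside M has level
  -- exactly t.
  have hinf : M ⊓ filtration n F R ℓ t ≤ N := by
    rintro x ⟨hxM, hxt⟩
    have h1 : N.mkQ x ∈ S ⊓ (filtration n F R ℓ t).map N.mkQ :=
      ⟨hxM, Submodule.mem_map_of_mem hxt⟩
    rw [disjoint_iff.1 (hS.not_le_iff_disjoint.1 hSle)] at h1
    exact (Submodule.Quotient.mk_eq_zero N).1 h1
  have hne : ∀ c, compPart F R ℓ c ≤ M → compLevel F ℓ c ≠ t := by
    intro c hc heq
    have h1 := (le_inf hc ((compPart_le_filtration_iff hR hℓ hψ c t).2 heq.ge)).trans hinf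
    rw [hN, compPart_le_filtration_iff hR hℓ hψ] at h1
    omega
  have hnle : ∀ c, compPart F R ℓ c ≤ M → (¬ compPart F R ℓ c ≤ N ↔ compLevel F ℓ c < t) := by
    intro c hc
    have := hne c hc
    rw [hN, compPart_le_filtration_iff hR hℓ hψ]
    omega
  -- a composition with as many parts as possible
  obtain ⟨α, hα, hmax⟩ : ∃ α : Composition n, (compPart F R ℓ α ≤ M ∧ ¬ compPart F R ℓ α ≤ N) ∧
      ∀ c, compPart F R ℓ c ≤ M ∧ ¬ compPart F R ℓ c ≤ N → c.length ≤ α.length := by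
    obtain ⟨c, hc⟩ := exists_cyclicPart_le_not_le hR hℓ hψ hNM'
    obtain ⟨α, h1, h2⟩ := Finset.exists_max_image (Finset.univ.filter fun c : Composition n =>
      compPart F R ℓ c ≤ M ∧ ¬ compPart F R ℓ c ≤ N) Composition.length
      ⟨c, Finset.mem_filter.2 ⟨Finset.mem_univ _, hc⟩⟩
    exact ⟨α, (Finset.mem_filter.1 h1).2,
      fun c hc => h2 c (Finset.mem_filter.2 ⟨Finset.mem_univ _, hc⟩)⟩
  have hαt : compLevel F ℓ α < t := (hnle α hα.1).1 hα.2
  -- A split composition has one more part, so by maximality it lies in N and has level above t,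
  -- which means a smaller φ than that of c₀.
  have hsplit : ∀ x y, 0 < x → 0 < y → x + y ∈ α.blocks →
      (α.blocks.map (blockPhi ℓ e d)).sum + blockPhi ℓ e d x + blockPhi ℓ e d y <
        (c₀.blocks.map (blockPhi ℓ e d)).sum + blockPhi ℓ e d (x + y) := by
    intro x y hx hy hxy
    obtain ⟨c, hlen, hle, hg⟩ := exists_split hR hℓ hψ hx hy hxy
    have hcM := le_trans hle hα.1
    have h1 : ¬ compLevel F ℓ c < t := by
      intro h
      have := hmax c ⟨hcM, (hnle c hcM).2 h⟩
      omega
    have h2 := hne c hcM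
    have h3 := hg (blockPhi ℓ e d)
    have h4 := hlev c
    have h5 := hlev c₀
    omega
  have hα₀ : (c₀.blocks.map (blockPhi ℓ e d)).sum < (α.blocks.map (blockPhi ℓ e d)).sum := by
    have h4 := hlev α
    have h5 := hlev c₀
    omega
  -- The value φ(c₀) lies strictly between φ before and after any split, so a split costing at most
  -- 1 is impossible.
  have hparts : ∀ m ∈ α.blocks, m = 1 ∨ m = e := by
    intro m hm
    by_contra! hcon
    obtain ⟨x, y, hx, hy, rfl, hxy⟩ :=
      exists_blockPhi_split (ℓ := ℓ) (d := d) he (α.blocks_pos hm) hcon.1 hcon.2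
    have := hsplit x y hx hy hm
    omega
  obtain ⟨hle, hperm⟩ := exists_perm_of_parts he α.blocks_sum hparts
  set a := α.blocks.count e with ha
  have hφα : (α.blocks.map (blockPhi ℓ e d)).sum = d * a := by
    rw [(hperm.map _).sum_eq, List.map_append, List.map_replicate, List.map_replicate,
      List.sum_append, List.sum_replicate, List.sum_replicate, blockPhi_one he, blockPhi_self he,
      smul_zero, zero_add, smul_eq_mul, mul_comm]
  have ha0 : 0 < a := by
    rw [Nat.pos_iff_ne_zero]
    intro h0
    rw [hφα, h0] at hα₀
    omega
  have hemem : e ∈ α.blocks := List.count_pos_iff.1 ha0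
  -- Splitting a block e as 1 + (e - 1) loses at most d.
  have hlow : d * (a - 1) < (c₀.blocks.map (blockPhi ℓ e d)).sum := by
    have h1 := hsplit 1 (e - 1) one_pos (by omega) (by rwa [Nat.add_sub_cancel' (by omega)])
    rw [Nat.add_sub_cancel' (by omega), blockPhi_self he, hφα] at h1
    have h2 : d * a = d * (a - 1) + d := by
      conv_lhs => rw [← Nat.sub_add_cancel ha0, Nat.mul_succ]
    omega
  rw [hφα] at hα₀
  let Q : Composition n := ⟨List.replicate (n - e * a) 1 ++ List.replicate a e,
    fun {i} hi => α.blocks_pos (hperm.mem_iff.2 hi), by rw [← hperm.sum_eq, α.blocks_sum]⟩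
  refine ⟨a, Q, rfl, prime_le_of_sum_blockPhi _ hlow hα₀, ?_, ?_, ?_, ?_⟩
  · have : a ≤ n / e := (Nat.le_div_iff_mul_le (by omega)).2 (by rwa [mul_comm])
    change a - 1 < n / e
    omega
  · rwa [hphi]
  · rwa [hphi]
  · have hQ : compPart F R ℓ Q = compPart F R ℓ α := cyclicPart_eq_of_perm hR hℓ hψ hperm.symm
    rw [hQ]
    refine ((hS.le_iff_eq ?_).1 (Submodule.map_le_iff_le_comap.2 hα.1)).symm
    rw [ne_eq, map_mkQ_eq_bot_iff]
    exact hα.2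

end Filtration

/-! ### The socle of L/L(P)^♯ and the socle series -/

section Socle

variable {n : ℕ} {F : Type*} [Field F] [Fintype F] {R : Type*} [CommRing R] [IsDomain R]
  [CharZero R] [IsLocalRing R] {ℓ : ℕ} [Fact ℓ.Prime] {ψ : AddChar F R}

theorem socle_eq_or (hR : IsLocalRing.maximalIdeal R = Ideal.span {(ℓ : R)})
    (hℓ : ¬ ℓ ∣ Nat.card F) (hψ : ψ.IsPrimitive) {P : Subgroup (GL (Fin n) F)}
    (hP : borel n F ≤ P) :
    socle (GroupAlg n F R) (Reduction n F R ℓ ⧸ filtrationSharp R ℓ P) =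
        (filtrationAt R ℓ P).map (filtrationSharp R ℓ P).mkQ ∨
      ∃ (a : ℕ) (Q : Composition n),
        Q.blocks = List.replicate (n - eNum ℓ (Nat.card F) * a) 1 ++
          List.replicate a (eNum ℓ (Nat.card F)) ∧
        ℓ ≤ a - 1 ∧ a - 1 < n / eNum ℓ (Nat.card F) ∧
        dNum ℓ (Nat.card F) * (a - 1) < phi ℓ P ∧ phi ℓ P < dNum ℓ (Nat.card F) * a ∧
        IsSimpleModule (GroupAlg n F R) ((cyclicPart R ℓ (parabolicOfComposition F Q)).map
          (filtrationSharp R ℓ P).mkQ) ∧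
        Disjoint ((filtrationAt R ℓ P).map (filtrationSharp R ℓ P).mkQ)
          ((cyclicPart R ℓ (parabolicOfComposition F Q)).map (filtrationSharp R ℓ P).mkQ) ∧
        socle (GroupAlg n F R) (Reduction n F R ℓ ⧸ filtrationSharp R ℓ P) =
          (filtrationAt R ℓ P).map (filtrationSharp R ℓ P).mkQ ⊔
            (cyclicPart R ℓ (parabolicOfComposition F Q)).map (filtrationSharp R ℓ P).mkQ := by
  obtain ⟨c, rfl⟩ := exists_composition_of_borel_le hP
  have hle : (filtrationAt R ℓ (blockUpper n F (compLabel c))).map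
      (filtrationSharp R ℓ (blockUpper n F (compLabel c))).mkQ ≤
      socle (GroupAlg n F R) (Reduction n F R ℓ ⧸
        filtrationSharp R ℓ (blockUpper n F (compLabel c))) :=
    map_filtration_le_socle hR hℓ hψ _
  by_cases h : ∀ S : Submodule (GroupAlg n F R) (Reduction n F R ℓ ⧸
      filtrationSharp R ℓ (blockUpper n F (compLabel c))), IsAtom S →
      S ≤ (filtrationAt R ℓ (blockUpper n F (compLabel c))).map
        (filtrationSharp R ℓ (blockUpper n F (compLabel c))).mkQ
  · left
    exact le_antisymm (sSup_le fun S hS => h S (isSimpleModule_iff_isAtom.1 hS)) hle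
  · right
    push Not at h
    obtain ⟨S, hS, hSle⟩ := h
    obtain ⟨a, Q, hQ, h1, h2, h3, h4, rfl⟩ := exists_of_isAtom_not_le hR hℓ hψ (c₀ := c) rfl rfl hS hSle
    refine ⟨a, Q, hQ, h1, h2, h3, h4, isSimpleModule_iff_isAtom.2 hS,
      (hS.not_le_iff_disjoint.1 hSle).symm, le_antisymm (sSup_le fun T hT => ?_)
      (sup_le hle (le_sSup (isSimpleModule_iff_isAtom.2 hS)))⟩
    have hT' : IsAtom T := isSimpleModule_iff_isAtom.1 hT
    by_cases hTle : T ≤ (filtrationAt R ℓ (blockUpper n F (compLabel c))).map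
        (filtrationSharp R ℓ (blockUpper n F (compLabel c))).mkQ
    · exact le_sup_of_le_left hTle
    · obtain ⟨a', Q', hQ', h1', h2', h3', h4', rfl⟩ :=
        exists_of_isAtom_not_le hR hℓ hψ (c₀ := c) rfl rfl hT' hTle
      -- The open intervals from d(a-1) to da are disjoint for different a, so every further
      -- irreducible submodule comes from the same a.
      have e1 := Nat.lt_of_mul_lt_mul_left (h3.trans h4')
      have e2 := Nat.lt_of_mul_lt_mul_left (h3'.trans h4)
      have hℓ2 := (Fact.out : ℓ.Prime).two_le
      have haa : a' = a := by omega
      subst haa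
      rw [Composition.ext (hQ'.trans hQ.symm)]
      exact le_sup_right

theorem socle_eq_of_le (hR : IsLocalRing.maximalIdeal R = Ideal.span {(ℓ : R)})
    (hℓ : ¬ ℓ ∣ Nat.card F) (hψ : ψ.IsPrimitive) {P : Subgroup (GL (Fin n) F)}
    (hP : borel n F ≤ P) (h : dNum ℓ (Nat.card F) * (n / eNum ℓ (Nat.card F)) ≤ phi ℓ P) :
    socle (GroupAlg n F R) (Reduction n F R ℓ ⧸ filtrationSharp R ℓ P) =
      (filtrationAt R ℓ P).map (filtrationSharp R ℓ P).mkQ := by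
  refine (socle_eq_or hR hℓ hψ hP).resolve_right ?_
  rintro ⟨a, Q, -, -, h2, -, h4, -⟩
  have := Nat.mul_le_mul_left (dNum ℓ (Nat.card F))
    (show a ≤ n / eNum ℓ (Nat.card F) by omega)
  omega

/-- For d = 1 the exceptional case would place an integer strictly between a - 1 and a. -/
theorem comap_socle_eq (hR : IsLocalRing.maximalIdeal R = Ideal.span {(ℓ : R)})
    (hℓ : ¬ ℓ ∣ Nat.card F) (hψ : ψ.IsPrimitive) (hd : dNum ℓ (Nat.card F) = 1)
    (c : Composition n) :
    (socle (GroupAlg n F R) (Reduction n F R ℓ ⧸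
      filtration n F R ℓ (compLevel F ℓ c + 1))).comap
        (filtration n F R ℓ (compLevel F ℓ c + 1)).mkQ = filtration n F R ℓ (compLevel F ℓ c) := by
  have h : socle (GroupAlg n F R) (Reduction n F R ℓ ⧸
      filtration n F R ℓ (compLevel F ℓ c + 1)) =
      (filtration n F R ℓ (compLevel F ℓ c)).map
        (filtration n F R ℓ (compLevel F ℓ c + 1)).mkQ := by
    refine (socle_eq_or hR hℓ hψ
      (borel_le_blockUpper (F := F) (compLabel_monotone c))).resolve_right ?_
    rintro ⟨a, Q, -, -, -, h3, h4, -⟩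
    rw [hd] at h3 h4
    omega
  rw [h, Submodule.comap_map_eq, Submodule.ker_mkQ,
    sup_eq_left.2 (filtration_antitone (Nat.le_succ _))]

theorem comap_socle_top {A M : Type*} [Ring A] [AddCommGroup M] [Module A M] :
    (socle A (M ⧸ (⊤ : Submodule A M))).comap (⊤ : Submodule A M).mkQ = ⊤ :=
  top_le_iff.1 fun x _ => by
    rw [Submodule.mem_comap, Submodule.mkQ_apply,
      (Submodule.Quotient.mk_eq_zero _).2 Submodule.mem_top]
    exact Submodule.zero_mem _

/-- The quotient type depends on the submodule, so the equality is substituted once here instead of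
being rewritten under the quotient. -/
theorem socleSeries_succ {A M : Type*} [Ring A] [AddCommGroup M] [Module A M] {i : ℕ}
    {N : Submodule A M} (h : socleSeries A M i = N) :
    socleSeries A M (i + 1) = (socle A (M ⧸ N)).comap N.mkQ := by
  subst h
  rfl

/-- The filtration only drops just after a level of some composition; take the largest level below
m. -/
theorem filtration_step (hR : IsLocalRing.maximalIdeal R = Ideal.span {(ℓ : R)})
    (hℓ : ¬ ℓ ∣ Nat.card F) (hψ : ψ.IsPrimitive) (m : ℕ) :
    filtration n F R ℓ m = ⊤ ∨ ∃ c : Composition n, compLevel F ℓ c < m ∧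
      filtration n F R ℓ m = filtration n F R ℓ (compLevel F ℓ c + 1) := by
  classical
  by_cases h : ∃ c : Composition n, compLevel F ℓ c < m
  · right
    obtain ⟨c₀, hc₀⟩ := h
    obtain ⟨c, h1, h2⟩ := Finset.exists_max_image (Finset.univ.filter fun c : Composition n =>
      compLevel F ℓ c < m) (compLevel F ℓ) ⟨c₀, Finset.mem_filter.2 ⟨Finset.mem_univ _, hc₀⟩⟩
    have hc := (Finset.mem_filter.1 h1).2
    refine ⟨c, hc, (filtration_eq_of_forall hR hℓ hψ hc fun c' hc' => ?_).symm⟩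
    by_contra! hlt
    have := h2 c' (Finset.mem_filter.2 ⟨Finset.mem_univ _, hlt⟩)
    omega
  · left
    push Not at h
    rw [← filtration_zero hR hℓ hψ]
    exact (filtration_eq_of_forall hR hℓ hψ (Nat.zero_le _) fun c _ => h c).symm

/-- For `d = 1` the socle series runs through the filtration. -/
theorem socleSeries_eq_filtration (hR : IsLocalRing.maximalIdeal R = Ideal.span {(ℓ : R)})
    (hℓ : ¬ ℓ ∣ Nat.card F) (hψ : ψ.IsPrimitive) (hd : dNum ℓ (Nat.card F) = 1) (i : ℕ) :
    (∃ m ≤ theta ℓ (borel n F) + 1 - i,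
      socleSeries (GroupAlg n F R) (Reduction n F R ℓ) i = filtration n F R ℓ m) ∧
    (socleSeries (GroupAlg n F R) (Reduction n F R ℓ) i ≠ ⊤ →
      socleSeries (GroupAlg n F R) (Reduction n F R ℓ) i <
        socleSeries (GroupAlg n F R) (Reduction n F R ℓ) (i + 1)) ∧
    ∀ m', (∃ j ≤ i, filtration n F R ℓ m' =
        socleSeries (GroupAlg n F R) (Reduction n F R ℓ) j) ∨
      socleSeries (GroupAlg n F R) (Reduction n F R ℓ) i ≤ filtration n F R ℓ m' := by
  have hnext : ∀ i m, socleSeries (GroupAlg n F R) (Reduction n F R ℓ) i = filtration n F R ℓ m →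
      (filtration n F R ℓ m = ⊤ ∧
        socleSeries (GroupAlg n F R) (Reduction n F R ℓ) (i + 1) = ⊤) ∨
      ∃ c : Composition n, compLevel F ℓ c < m ∧
        filtration n F R ℓ m = filtration n F R ℓ (compLevel F ℓ c + 1) ∧
        socleSeries (GroupAlg n F R) (Reduction n F R ℓ) (i + 1) =
          filtration n F R ℓ (compLevel F ℓ c) := by
    intro i m him
    rcases filtration_step hR hℓ hψ m with h | ⟨c, hc, h⟩
    · left
      exact ⟨h, by rw [socleSeries_succ (him.trans h), comap_socle_top]⟩
    · right
      exact ⟨c, hc, h, by rw [socleSeries_succ (him.trans h), comap_socle_eq hR hℓ hψ hd]⟩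
  -- The bound on m decreases with i, which forces the socle series to reach L(0) = L after finitely
  -- many steps.
  have hfirst : ∀ i, ∃ m ≤ theta ℓ (borel n F) + 1 - i,
      socleSeries (GroupAlg n F R) (Reduction n F R ℓ) i = filtration n F R ℓ m := by
    intro i
    induction i with
    | zero => exact ⟨_, le_rfl, (filtration_eq_bot hR hℓ hψ (Nat.lt_succ_self _)).symm⟩
    | succ i ih =>
      obtain ⟨m, hm, him⟩ := ih
      rcases hnext i m him with ⟨_, h⟩ | ⟨c, hc, _, h⟩
      · exact ⟨0, Nat.zero_le _, by rw [h, filtration_zero hR hℓ hψ]⟩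
      · exact ⟨_, by omega, h⟩
  refine ⟨hfirst i, fun hne => ?_, ?_⟩
  · obtain ⟨m, -, him⟩ := hfirst i
    rcases hnext i m him with ⟨h, _⟩ | ⟨c, _, h, h'⟩
    · exact absurd (him.trans h) hne
    · rw [h', him, h]
      exact filtration_succ_lt hR hℓ hψ c
  -- No filtration term is skipped: each one has already occurred or still contains the current
  -- socle term.
  · induction i with
    | zero => exact fun m' => Or.inr bot_le
    | succ i ih =>
      intro m'
      rcases ih m' with ⟨j, hj, h⟩ | h
      · exact Or.inl ⟨j, by omega, h⟩
      obtain ⟨m, -, him⟩ := hfirst i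
      rcases hnext i m him with ⟨h1, _⟩ | ⟨c, _, h1, h2⟩
      · rw [him, h1] at h
        exact Or.inl ⟨i, by omega, by rw [him, h1, top_le_iff.1 h]⟩
      · rcases le_or_gt m' (compLevel F ℓ c) with hm' | hm'
        · right
          rw [h2]
          exact filtration_antitone hm'
        · left
          -- A term with index beyond the level of c is squeezed between the current socle term and
          -- itself.
          refine ⟨i, by omega, le_antisymm ?_ h⟩
          rw [him, h1]
          exact filtration_antitone hm'

theorem exists_ltSeries_socleSeries (hR : IsLocalRing.maximalIdeal R = Ideal.span {(ℓ : R)})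
    (hℓ : ¬ ℓ ∣ Nat.card F) (hψ : ψ.IsPrimitive) (hd : dNum ℓ (Nat.card F) = 1) :
    ∃ s : LTSeries (Submodule (GroupAlg n F R) (Reduction n F R ℓ)),
      Set.range s = Set.range (filtration n F R ℓ) ∧ s.head = ⊥ ∧ s.last = ⊤ ∧
      ∀ i : Fin (s.length + 1), s i =
        socleSeries (GroupAlg n F R) (Reduction n F R ℓ) (i : ℕ) := by
  classical
  have key := socleSeries_eq_filtration (n := n) hR hℓ hψ hd
  have htop : ∃ i, socleSeries (GroupAlg n F R) (Reduction n F R ℓ) i = ⊤ := by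
    obtain ⟨m, hm, h⟩ := (key (theta ℓ (borel n F) + 1)).1
    rw [Nat.sub_self, Nat.le_zero] at hm
    exact ⟨_, by rw [h, hm, filtration_zero hR hℓ hψ]⟩
  -- Stopping at the first index where the series is the whole module makes every step strict.
  let s : LTSeries (Submodule (GroupAlg n F R) (Reduction n F R ℓ)) :=
    { length := Nat.find htop
      toFun := fun i => socleSeries (GroupAlg n F R) (Reduction n F R ℓ) (i : ℕ)
      step := fun i => (key i).2.1 (Nat.find_min htop i.2) }
  refine ⟨s, ?_, rfl, Nat.find_spec htop, fun _ => rfl⟩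
  ext N
  constructor
  · rintro ⟨i, rfl⟩
    obtain ⟨m, -, h⟩ := (key i).1
    exact ⟨m, h.symm⟩
  · rintro ⟨m, rfl⟩
    rcases (key (Nat.find htop)).2.2 m with ⟨j, hj, h⟩ | h
    · exact ⟨⟨j, Nat.lt_succ_of_le hj⟩, h.symm⟩
    · rw [Nat.find_spec htop] at h
      exact ⟨Fin.last _, (Nat.find_spec htop).trans (top_le_iff.1 h).symm⟩

end Socle

end SteinbergLattice

/-! ### The theorem -/

theorem theoremA8 (n : ℕ) (hn : 2 ≤ n)
    (p : ℕ) (hp : p.Prime) (F : Type*) [Field F] [Finite F] [CharP F p]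
    (ℓ : ℕ) (hℓ : ℓ.Prime) (hℓp : ℓ ≠ p)
    (R : Type*) [CommRing R] [IsDomain R] [IsPrincipalIdealRing R] [IsLocalRing R] [CharZero R]
    (hR : IsLocalRing.maximalIdeal R = Ideal.span {(ℓ : R)})
    (hζ : ∃ ζ : R, IsPrimitiveRoot ζ p)
    (q e d : ℕ) (hq : q = Nat.card F) (he : e = SteinbergLattice.eNum ℓ q)
    (hd : d = SteinbergLattice.dNum ℓ q) :
    -- If `d = 1`, then removing the repetitions from `L = L(0) ⊇ L(1) ⊇ ...`
    -- leaves exactly the socle series of `L`.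
    (d = 1 →
      ∃ s : LTSeries (Submodule (SteinbergLattice.GroupAlg n F R)
          (SteinbergLattice.Reduction n F R ℓ)),
        Set.range s = Set.range (SteinbergLattice.filtration n F R ℓ) ∧
        s.head = ⊥ ∧ s.last = ⊤ ∧
        ∀ i : Fin (s.length + 1), s i =
          SteinbergLattice.socleSeries (SteinbergLattice.GroupAlg n F R)
            (SteinbergLattice.Reduction n F R ℓ) (i : ℕ)) ∧
    -- The socle of `L / L(P)^♯` for an arbitrary standard parabolic subgroup `P`.
    ∀ P : Subgroup (GL (Fin n) F), SteinbergLattice.borel n F ≤ P →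
      (SteinbergLattice.socle (SteinbergLattice.GroupAlg n F R)
            (SteinbergLattice.Reduction n F R ℓ ⧸ SteinbergLattice.filtrationSharp R ℓ P) =
          (SteinbergLattice.filtrationAt R ℓ P).map
            (SteinbergLattice.filtrationSharp R ℓ P).mkQ ∨
        ∃ (a : ℕ) (Q : Composition n),
          Q.blocks = List.replicate (n - e * a) 1 ++ List.replicate a e ∧
          ℓ ≤ a - 1 ∧ a - 1 < n / e ∧
          d * (a - 1) < SteinbergLattice.phi ℓ P ∧ SteinbergLattice.phi ℓ P < d * a ∧
          IsSimpleModule (SteinbergLattice.GroupAlg n F R)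
            ((SteinbergLattice.cyclicPart R ℓ
                (SteinbergLattice.parabolicOfComposition F Q)).map
              (SteinbergLattice.filtrationSharp R ℓ P).mkQ) ∧
          Disjoint
            ((SteinbergLattice.filtrationAt R ℓ P).map
              (SteinbergLattice.filtrationSharp R ℓ P).mkQ)
            ((SteinbergLattice.cyclicPart R ℓ
                (SteinbergLattice.parabolicOfComposition F Q)).map
              (SteinbergLattice.filtrationSharp R ℓ P).mkQ) ∧
          SteinbergLattice.socle (SteinbergLattice.GroupAlg n F R)
              (SteinbergLattice.Reduction n F R ℓ ⧸ SteinbergLattice.filtrationSharp R ℓ P) =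
            (SteinbergLattice.filtrationAt R ℓ P).map
                (SteinbergLattice.filtrationSharp R ℓ P).mkQ ⊔
              (SteinbergLattice.cyclicPart R ℓ
                  (SteinbergLattice.parabolicOfComposition F Q)).map
                (SteinbergLattice.filtrationSharp R ℓ P).mkQ) ∧
      (d * (n / e) ≤ SteinbergLattice.phi ℓ P →
        SteinbergLattice.socle (SteinbergLattice.GroupAlg n F R)
            (SteinbergLattice.Reduction n F R ℓ ⧸ SteinbergLattice.filtrationSharp R ℓ P) =
          (SteinbergLattice.filtrationAt R ℓ P).map
            (SteinbergLattice.filtrationSharp R ℓ P).mkQ) := by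
  have : Fintype F := Fintype.ofFinite F
  have : Fact ℓ.Prime := ⟨hℓ⟩
  -- The order of F is a power of p, so q is a unit in R.
  have hℓF : ¬ ℓ ∣ Nat.card F := by
    obtain ⟨k, -, hk⟩ := FiniteField.card F p
    rw [Nat.card_eq_fintype_card, hk]
    exact fun h => hℓp ((Nat.prime_dvd_prime_iff_eq hℓ hp).1 (hℓ.dvd_of_dvd_pow h))
  obtain ⟨ζ, hζ⟩ := hζ
  obtain ⟨ψ, hψ⟩ := SteinbergLattice.exists_primitive_addChar (F := F) hp hζ
  subst hq he hd
  exact ⟨SteinbergLattice.exists_ltSeries_socleSeries hR hℓF hψ,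
    fun P hP => ⟨SteinbergLattice.socle_eq_or hR hℓF hψ hP,
      SteinbergLattice.socle_eq_of_le hR hℓF hψ hP⟩⟩
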